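/- Let $k$ be an algebraically closed field of characteristic $0$ and let $B=\bigoplus_{d\ge 0}B_d$ be a (left and right) noetherian $\mathbb N$-graded $k$-algebra, with every $B_d$ finite dimensional, together with an isomorphism $B_0\cong k^n$; let $e_1,\dots,e_n\in B_0$ be the corresponding primitive orthogonal idempotents. Put $B_{\ge r}=\bigoplus_{d\ge r}B_d$, $S_j=e_jB/(e_jB)_{\ge 1}$ (right modules) and $S_j^\vee=Be_j/(Be_j)_{\ge 1}$ (left modules), and let $\underline{\operatorname{Ext}}$ denote the graded Ext of graded right modules. Shifts are $(M[\ell])_d=M_{d+\ell}$. Assume that $B$ is generalized Gorenstein: $B$ has injective dimension $N<\infty$ as a right $B$-module, and there are $\sigma\in\operatorname{Sym}(n)$ and $\ell_1,\dots,\ell_n\in\mathbb Z$ such that, for every $j$, $\underline{\operatorname{Ext}}^i_B(S_j,B)=0$ for $i\ne N$ and $\underline{\operatorname{Ext}}^N_B(S_j,B)\cong S^\vee_{\sigma(j)}[\ell_j]$ as graded left $B$-modules. Let $H^N(B)=\varinjlim_r\underline{\operatorname{Ext}}^N_B(B/B_{\ge r},B)$, a graded right $B$-module. Let $B^\vee=\bigoplus_d\operatorname{Hom}_k(B_d,k)$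 be the graded dual, a right $B$-module by $(\varphi\cdot b)(x)=\varphi(bx)$, and let $e_bB^\vee=\{\varphi\in B^\vee:\varphi(xe_b)=\varphi(x)\ \forall x\in B\}\cong\bigoplus_d\operatorname{Hom}_k(B_de_b,k)$, so that $B^\vee=\bigoplus_{b=1}^n e_bB^\vee$. Let $G$ be the group (under composition) of all graded $k$-algebra automorphisms $g$ of $B$ with $g(e_i)=e_i$ for all $i$. For $g\in G$ let $H^N(g)\colon H^N(B)\to H^N(B^g)=H^N(B)^g$ be the $g$-linear map induced by the right $B$-linear map $g\colon B\to B^g$, where $M^g$ denotes $M$ with the action $m*b=m\,g(b)$. (1) There is an isomorphism $\theta\colon H^N(B)\to\bigoplus_{b=1}^n e_bB^\vee[\ell_b]$ of graded right $B$-modules such that for every $g\in G$ there are $\lambda_1,\dots,\lambda_n\in k^\times$ with $$\theta H^N(g)\theta^{-1}(\varphi)=\lambda_s\,(\varphi\circ g^{-1})\qquad\text{for all } s \text{ and all }\varphi\in e_sB^\vee.\tag{$*$}$$ (2) For each $g\in G$ the scalars are well defined: if $(*)$ holds for some isomorphism $\theta\colon H^N(B)\to B^\vee$ of (ungraded) right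 $B$-modules and some $\lambda_1,\dots,\lambda_n\in k$, then these $\lambda_s$ are the same as those of any other such $\theta$. The homological determinant of $g$ is $\operatorname{Hdet}(g)=\operatorname{diag}(\lambda_1^{-1},\dots,\lambda_n^{-1})$. (3) $\operatorname{Hdet}$ is a group homomorphism from $G$ to the group of invertible $n\times n$ matrices over $k$: $\operatorname{Hdet}(gh)=\operatorname{Hdet}(g)\operatorname{Hdet}(h)$ for all $g,h\in G$. -/

import Mathlib

open CategoryTheory

set_option linter.unusedSectionVars false

namespace HomDet

/-! ### Graded Ext of right modules, by the bar complex

`B` is an algebra over a field `k`, graded by `𝒜 : ℕ → Submodule k B`.  Right `B`-modules are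
`Bᵐᵒᵖ`-modules, and `m · b` is `MulOpposite.op b • m`.  Gradings of modules are families of
`k`-subspaces indexed by `ℤ`.  Since `k` is a field, the bar resolution
`⋯ → M ⊗ B ⊗ B ⊗ B → M ⊗ B ⊗ B → M ⊗ B → M` (tensor products over `k`) is a resolution of a graded
right module `M` by graded projective right modules; applying the graded Hom functor
`⨁_ℓ Hom^ℓ_B(-, N)` to it gives the complex below, whose `i`-th cohomology is the `i`-th right
derived functor of the graded Hom. -/

section Ext

variable {k B M N M' N' : Type*} [Field k] [Ring B] [Algebra k B]
  [AddCommGroup M] [Module k M] [Module Bᵐᵒᵖ M]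
  [AddCommGroup N] [Module k N] [Module Bᵐᵒᵖ N] [IsScalarTower k Bᵐᵒᵖ N]
  [AddCommGroup M'] [Module k M'] [Module Bᵐᵒᵖ M']
  [AddCommGroup N'] [Module k N'] [Module Bᵐᵒᵖ N'] [IsScalarTower k Bᵐᵒᵖ N']

/-- The grading of `B`, extended by zero to negative degrees. -/
def zdeg (𝒜 : ℕ → Submodule k B) : ℤ → Submodule k B
  | Int.ofNat d => 𝒜 d
  | Int.negSucc _ => ⊥

/-- The differential of the bar complex:
`(df)(m; b₀,…,bᵢ) = f(m b₀; b₁,…,bᵢ) + ∑_{j<i} (-1)^{j+1} f(m; b₀,…,bⱼbⱼ₊₁,…,bᵢ)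
  + (-1)^{i+1} f(m; b₀,…,bᵢ₋₁) bᵢ`. -/
def barD (k : Type*) {B M N : Type*} [Field k] [Ring B] [Algebra k B]
    [AddCommGroup M] [Module Bᵐᵒᵖ M]
    [AddCommGroup N] [Module k N] [Module Bᵐᵒᵖ N] [IsScalarTower k Bᵐᵒᵖ N] (i : ℕ) :
    (M → (Fin i → B) → N) →ₗ[k] (M → (Fin (i + 1) → B) → N) where
  toFun f := fun m b =>
    f (MulOpposite.op (b 0) • m) (Fin.tail b)
      + ∑ j : Fin i, (-1 : ℤˣ) ^ ((j : ℕ) + 1) • f m (Fin.contractNth j.castSucc (· * ·) b)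
      + (-1 : ℤˣ) ^ (i + 1) • (MulOpposite.op (b (Fin.last i)) • f m (Fin.init b))
  map_add' f g := by
    funext m b
    simp only [Pi.add_apply, smul_add, Finset.sum_add_distrib]
    abel
  map_smul' c f := by
    funext m b
    have h : ∀ (b : Bᵐᵒᵖ) (n : N), b • c • n = c • b • n := fun b n => by
      rw [← smul_one_smul Bᵐᵒᵖ c n, ← smul_one_smul Bᵐᵒᵖ c (b • n), ← mul_smul, ← mul_smul,
        mul_smul_one, smul_one_mul]
    simp only [Pi.smul_apply, RingHom.id_apply, smul_add, Finset.smul_sum, h]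
    simp only [smul_comm c]

/-- The bar `i`-cochains of degree `ℓ`: `k`-multilinear maps `f : M × Bⁱ → N` which map
`M_p × B_{q₁} × ⋯ × B_{qᵢ}` into `N_{p + q₁ + ⋯ + qᵢ + ℓ}`. -/
def homCochain (𝒜 : ℕ → Submodule k B) (ℳ : ℤ → Submodule k M) (𝒩 : ℤ → Submodule k N)
    (i : ℕ) (ℓ : ℤ) : Submodule k (M → (Fin i → B) → N) where
  carrier := {f |
    (∃ F : M →ₗ[k] MultilinearMap k (fun _ : Fin i => B) N, ∀ m b, F m b = f m b) ∧
    ∀ (p : ℤ) (q : Fin i → ℕ) (m : M) (b : Fin i → B), m ∈ ℳ p → (∀ t, b t ∈ 𝒜 (q t)) →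
      f m b ∈ 𝒩 (p + ∑ t, (q t : ℤ) + ℓ)}
  zero_mem' := ⟨⟨0, fun _ _ => rfl⟩, fun _ _ _ _ _ _ => Submodule.zero_mem _⟩
  add_mem' := by
    rintro f g ⟨⟨F, hF⟩, hf⟩ ⟨⟨G, hG⟩, hg⟩
    exact ⟨⟨F + G, fun m b => by simp [hF, hG]⟩, fun p q m b hm hb =>
      Submodule.add_mem _ (hf p q m b hm hb) (hg p q m b hm hb)⟩
  smul_mem' := by
    rintro c f ⟨⟨F, hF⟩, hf⟩
    exact ⟨⟨c • F, fun m b => by simp [hF]⟩, fun p q m b hm hb =>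
      Submodule.smul_mem _ c (hf p q m b hm hb)⟩

/-- The graded bar `i`-cochains: finite sums of homogeneous ones. -/
def cochains (𝒜 : ℕ → Submodule k B) (ℳ : ℤ → Submodule k M) (𝒩 : ℤ → Submodule k N)
    (i : ℕ) : Submodule k (M → (Fin i → B) → N) :=
  ⨆ ℓ : ℤ, homCochain 𝒜 ℳ 𝒩 i ℓ

/-- The cocycles. -/
def cocycles (𝒜 : ℕ → Submodule k B) (ℳ : ℤ → Submodule k M) (𝒩 : ℤ → Submodule k N)
    (i : ℕ) : Submodule k (M → (Fin i → B) → N) :=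
  cochains 𝒜 ℳ 𝒩 i ⊓ LinearMap.ker (barD k i)

/-- The coboundaries. -/
def coboundaries (𝒜 : ℕ → Submodule k B) (ℳ : ℤ → Submodule k M) (𝒩 : ℤ → Submodule k N) :
    (i : ℕ) → Submodule k (M → (Fin i → B) → N)
  | 0 => ⊥
  | i + 1 => (cochains 𝒜 ℳ 𝒩 i).map (barD k i)

/-- The graded Ext group `Ext^i_B(M, N)` of graded right `B`-modules. -/
abbrev GExt (𝒜 : ℕ → Submodule k B) (ℳ : ℤ → Submodule k M) (𝒩 : ℤ → Submodule k N)
    (i : ℕ) : Type _ :=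
  cocycles 𝒜 ℳ 𝒩 i ⧸ (coboundaries 𝒜 ℳ 𝒩 i).submoduleOf (cocycles 𝒜 ℳ 𝒩 i)

/-- The degree `ℓ` part of the graded Ext group: the classes of cocycles of degree `ℓ`. -/
def gextDeg (𝒜 : ℕ → Submodule k B) (ℳ : ℤ → Submodule k M) (𝒩 : ℤ → Submodule k N)
    (i : ℕ) (ℓ : ℤ) : Submodule k (GExt 𝒜 ℳ 𝒩 i) :=
  ((homCochain 𝒜 ℳ 𝒩 i ℓ).submoduleOf (cocycles 𝒜 ℳ 𝒩 i)).map (Submodule.mkQ _)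

/-- `T` is a morphism of graded bar complexes. -/
def IsBarMap (𝒜 : ℕ → Submodule k B) (ℳ : ℤ → Submodule k M) (𝒩 : ℤ → Submodule k N)
    (ℳ' : ℤ → Submodule k M') (𝒩' : ℤ → Submodule k N')
    (T : ∀ i : ℕ, (M → (Fin i → B) → N) →ₗ[k] (M' → (Fin i → B) → N')) : Prop :=
  (∀ i f, barD k i (T i f) = T (i + 1) (barD k i f)) ∧
    ∀ i, cochains 𝒜 ℳ 𝒩 i ≤ (cochains 𝒜 ℳ' 𝒩' i).comap (T i)

section Maps

variable {𝒜 : ℕ → Submodule k B} {ℳ : ℤ → Submodule k M} {𝒩 : ℤ → Submodule k N}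
  {ℳ' : ℤ → Submodule k M'} {𝒩' : ℤ → Submodule k N'}
  {T : ∀ i : ℕ, (M → (Fin i → B) → N) →ₗ[k] (M' → (Fin i → B) → N')}

theorem IsBarMap.cocycles_le (hT : IsBarMap 𝒜 ℳ 𝒩 ℳ' 𝒩' T) (i : ℕ) :
    ∀ f ∈ cocycles 𝒜 ℳ 𝒩 i, T i f ∈ cocycles 𝒜 ℳ' 𝒩' i := by
  rintro f ⟨hf, hd⟩
  refine ⟨hT.2 i hf, ?_⟩
  have hd' : barD k i f = 0 := hd
  show barD k i (T i f) = 0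
  rw [hT.1, hd', map_zero]

theorem IsBarMap.coboundaries_le (hT : IsBarMap 𝒜 ℳ 𝒩 ℳ' 𝒩' T) (i : ℕ) :
    ∀ f ∈ coboundaries 𝒜 ℳ 𝒩 i, T i f ∈ coboundaries 𝒜 ℳ' 𝒩' i := by
  intro f hf
  cases i with
  | zero =>
    have : f = 0 := hf
    rw [this, map_zero]
    exact Submodule.zero_mem _
  | succ i =>
    obtain ⟨h, hh, rfl⟩ := hf
    exact ⟨T i h, hT.2 i hh, hT.1 i h⟩

/-- The map on graded Ext induced by a morphism of graded bar complexes. -/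
def extMap (T : ∀ i : ℕ, (M → (Fin i → B) → N) →ₗ[k] (M' → (Fin i → B) → N'))
    (hT : IsBarMap 𝒜 ℳ 𝒩 ℳ' 𝒩' T) (i : ℕ) :
    GExt 𝒜 ℳ 𝒩 i →ₗ[k] GExt 𝒜 ℳ' 𝒩' i :=
  Submodule.mapQ _ _ ((T i).restrict (hT.cocycles_le i))
    fun f hf => hT.coboundaries_le i f.1 hf

end Maps

/-- `f ↦ γ ∘ f ∘ (α, ρ, …, ρ)` on bar cochains. -/
def barPull (α : M' →ₗ[k] M) (ρ : B →ₐ[k] B) (γ : N →ₗ[k] N') (i : ℕ) :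
    (M → (Fin i → B) → N) →ₗ[k] (M' → (Fin i → B) → N') where
  toFun f := fun m b => γ (f (α m) (ρ ∘ b))
  map_add' f g := by funext m b; simp
  map_smul' c f := by funext m b; simp

theorem barD_barPull (α : M' →ₗ[k] M) (ρ : B →ₐ[k] B) (γ : N →ₗ[k] N')
    (hα : ∀ (b : B) (m : M'), α (MulOpposite.op b • m) = MulOpposite.op (ρ b) • α m)
    (hγ : ∀ (b : B) (n : N), γ (MulOpposite.op (ρ b) • n) = MulOpposite.op b • γ n)
    (i : ℕ) (f : M → (Fin i → B) → N) :
    barD k i (barPull α ρ γ i f) = barPull α ρ γ (i + 1) (barD k i f) := by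
  funext m b
  have hc : ∀ j : Fin (i + 1), ρ ∘ Fin.contractNth j (· * ·) b
      = Fin.contractNth j (· * ·) (ρ ∘ b) := fun j =>
    Fin.comp_contractNth _ _ (fun x y => map_mul ρ x y) j b
  have hu : ∀ (u : ℤˣ) (n : N), γ (u • n) = u • γ n := fun u n => by
    simp only [Units.smul_def, map_zsmul]
  simp only [barD, barPull, LinearMap.coe_mk, AddHom.coe_mk, map_add, map_sum, hα, hu, hc,
    Function.comp_apply, hγ]
  rfl

theorem barPull_mem_homCochain {𝒜 : ℕ → Submodule k B} {ℳ : ℤ → Submodule k M}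
    {𝒩 : ℤ → Submodule k N} {ℳ' : ℤ → Submodule k M'} {𝒩' : ℤ → Submodule k N'}
    (α : M' →ₗ[k] M) (ρ : B →ₐ[k] B) (γ : N →ₗ[k] N') (s t : ℤ)
    (hα : ∀ d, ∀ m ∈ ℳ' d, α m ∈ ℳ (d + s)) (hρ : ∀ d, ∀ b ∈ 𝒜 d, ρ b ∈ 𝒜 d)
    (hγ : ∀ d, ∀ n ∈ 𝒩 d, γ n ∈ 𝒩' (d + t)) (i : ℕ) (ℓ : ℤ) (f : M → (Fin i → B) → N)
    (hf : f ∈ homCochain 𝒜 ℳ 𝒩 i ℓ) :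
    barPull α ρ γ i f ∈ homCochain 𝒜 ℳ' 𝒩' i (ℓ + s + t) := by
  obtain ⟨⟨F, hF⟩, hf⟩ := hf
  refine ⟨⟨{ toFun := fun m =>
      γ.compMultilinearMap ((F (α m)).compLinearMap fun _ => ρ.toLinearMap)
             map_add' := fun m m' => by ext b; simp
             map_smul' := fun c m => by ext b; simp }, ?_⟩, ?_⟩
  · intro m b
    exact congrArg γ (hF (α m) (ρ ∘ b))
  · intro p q m b hm hb
    have h := hγ _ _ (hf (p + s) q (α m) (ρ ∘ b) (hα _ _ hm) fun t => hρ _ _ (hb t))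
    have e : p + s + ∑ t, (q t : ℤ) + ℓ + t = p + ∑ t, (q t : ℤ) + (ℓ + s + t) := by ring
    rw [e] at h
    exact h

theorem barPull_cochains_le {𝒜 : ℕ → Submodule k B} {ℳ : ℤ → Submodule k M}
    {𝒩 : ℤ → Submodule k N} {ℳ' : ℤ → Submodule k M'} {𝒩' : ℤ → Submodule k N'}
    (α : M' →ₗ[k] M) (ρ : B →ₐ[k] B) (γ : N →ₗ[k] N') (s t : ℤ)
    (hα : ∀ d, ∀ m ∈ ℳ' d, α m ∈ ℳ (d + s)) (hρ : ∀ d, ∀ b ∈ 𝒜 d, ρ b ∈ 𝒜 d)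
    (hγ : ∀ d, ∀ n ∈ 𝒩 d, γ n ∈ 𝒩' (d + t)) (i : ℕ) :
    cochains 𝒜 ℳ 𝒩 i ≤ (cochains 𝒜 ℳ' 𝒩' i).comap (barPull α ρ γ i) :=
  iSup_le fun ℓ f hf => Submodule.mem_iSup_of_mem (ℓ + s + t)
    (barPull_mem_homCochain α ρ γ s t hα hρ hγ i ℓ f hf)

end Ext

/-! ### The graded algebra, its simple modules, and graded quotients -/

section Algebra

variable {k B : Type*} [Field k] [Ring B] [Algebra k B] (𝒜 : ℕ → Submodule k B)
  [GradedAlgebra 𝒜]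

theorem zdeg_mul_mem {a b : B} {d : ℤ} {e : ℤ} (ha : a ∈ zdeg 𝒜 d) (hb : b ∈ zdeg 𝒜 e) :
    a * b ∈ zdeg 𝒜 (d + e) := by
  rcases d with d | d
  · rcases e with e | e
    · exact SetLike.mul_mem_graded (A := 𝒜) (show a ∈ 𝒜 d from ha) (show b ∈ 𝒜 e from hb)
    · have : b = 0 := hb
      rw [this, mul_zero]
      exact Submodule.zero_mem _
  · have : a = 0 := ha
    rw [this, zero_mul]
    exact Submodule.zero_mem _

/-- `B_{≥ r}`, the sum of the pieces of degree at least `r`. -/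
def geq (r : ℕ) : Submodule k B := ⨆ i : {i : ℕ // r ≤ i}, 𝒜 i

variable {𝒜} in
theorem mul_mem_geq_right {r : ℕ} {x : B} (hx : x ∈ geq 𝒜 r) (b : B) : x * b ∈ geq 𝒜 r := by
  induction b using DirectSum.Decomposition.inductionOn 𝒜 with
  | zero => rw [mul_zero]; exact Submodule.zero_mem _
  | add m m' h h' => rw [mul_add]; exact Submodule.add_mem _ h h'
  | @homogeneous j y =>
    refine Submodule.iSup_induction (fun i : {i : ℕ // r ≤ i} => 𝒜 i)
      (motive := fun x => x * (y : B) ∈ geq 𝒜 r) hx ?_ ?_ ?_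
    · intro i x hx
      exact Submodule.mem_iSup_of_mem (⟨i + j, le_add_right i.2⟩ : {i : ℕ // r ≤ i})
        (SetLike.mul_mem_graded hx y.2)
    · rw [zero_mul]; exact Submodule.zero_mem _
    · intro x x' h h'
      rw [add_mul]; exact Submodule.add_mem _ h h'

variable {𝒜} in
theorem mul_mem_geq_left {r : ℕ} (b : B) {x : B} (hx : x ∈ geq 𝒜 r) : b * x ∈ geq 𝒜 r := by
  induction b using DirectSum.Decomposition.inductionOn 𝒜 with
  | zero => rw [zero_mul]; exact Submodule.zero_mem _
  | add m m' h h' => rw [add_mul]; exact Submodule.add_mem _ h h'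
  | @homogeneous j y =>
    refine Submodule.iSup_induction (fun i : {i : ℕ // r ≤ i} => 𝒜 i)
      (motive := fun x => (y : B) * x ∈ geq 𝒜 r) hx ?_ ?_ ?_
    · intro i x hx
      exact Submodule.mem_iSup_of_mem (⟨j + i, le_add_left i.2⟩ : {i : ℕ // r ≤ i})
        (SetLike.mul_mem_graded y.2 hx)
    · rw [mul_zero]; exact Submodule.zero_mem _
    · intro x x' h h'
      rw [mul_add]; exact Submodule.add_mem _ h h'

/-- `B_{≥ r}` as a right ideal. -/
def geqR (r : ℕ) : Submodule Bᵐᵒᵖ B :=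
  { geq 𝒜 r with smul_mem' := fun b _ hx => mul_mem_geq_right hx b.unop }

/-- `B_{≥ r}` as a left ideal. -/
def geqL (r : ℕ) : Submodule B B :=
  { geq 𝒜 r with smul_mem' := fun b _ hx => mul_mem_geq_left b hx }

/-- The right ideal `eB`. -/
abbrev rightGen (e : B) : Submodule Bᵐᵒᵖ B := Submodule.span Bᵐᵒᵖ {e}

/-- The left ideal `Be`. -/
abbrev leftGen (e : B) : Submodule B B := Submodule.span B {e}

/-- The right module `S = eB / (eB)_{≥ 1}`. -/
abbrev SimpleR (e : B) : Type _ := rightGen e ⧸ (geqR 𝒜 1).submoduleOf (rightGen e)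

/-- The left module `S^∨ = Be / (Be)_{≥ 1}`. -/
abbrev SimpleL (e : B) : Type _ := leftGen e ⧸ (geqL 𝒜 1).submoduleOf (leftGen e)

/-- The grading of `eB / (eB)_{≥ 1}` induced by that of `B`. -/
def simpleRDeg (e : B) (d : ℤ) : Submodule k (SimpleR 𝒜 e) :=
  ((zdeg 𝒜 d).comap ((rightGen e).subtype.restrictScalars k)).map
    ((Submodule.mkQ ((geqR 𝒜 1).submoduleOf (rightGen e))).restrictScalars k)

/-- The grading of `Be / (Be)_{≥ 1}` induced by that of `B`. -/
def simpleLDeg (e : B) (d : ℤ) : Submodule k (SimpleL 𝒜 e) :=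
  ((zdeg 𝒜 d).comap ((leftGen e).subtype.restrictScalars k)).map
    ((Submodule.mkQ ((geqL 𝒜 1).submoduleOf (leftGen e))).restrictScalars k)

/-- The right module `B / B_{≥ r}`. -/
abbrev Quo (r : ℕ) : Type _ := B ⧸ geqR 𝒜 r

/-- The grading of `B / B_{≥ r}` induced by that of `B`. -/
def quoDeg (r : ℕ) (d : ℤ) : Submodule k (Quo 𝒜 r) :=
  (zdeg 𝒜 d).map ((Submodule.mkQ (geqR 𝒜 r)).restrictScalars k)

/-- The `k`-linear map `B / B_{≥ r} → B / B_{≥ s}` induced by a `k`-linear map `f : B → B`. -/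
def quoMap {r s : ℕ} (f : B →ₗ[k] B) (h : ∀ x ∈ geq 𝒜 r, f x ∈ geq 𝒜 s) :
    Quo 𝒜 r →ₗ[k] Quo 𝒜 s where
  toFun := Quotient.lift (fun x => (Submodule.Quotient.mk (f x) : Quo 𝒜 s)) fun x y hxy => by
    have hxy' : x - y ∈ geqR 𝒜 r := (Submodule.quotientRel_def _).1 hxy
    refine (Submodule.Quotient.eq _).2 ?_
    rw [← map_sub]
    exact h _ hxy'
  map_add' := by
    rintro ⟨x⟩ ⟨y⟩
    exact congrArg Submodule.Quotient.mk (map_add f x y)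
  map_smul' := by
    rintro c ⟨x⟩
    exact congrArg Submodule.Quotient.mk (map_smul f c x)

theorem quoMap_mem_quoDeg {r s : ℕ} (f : B →ₗ[k] B) (h : ∀ x ∈ geq 𝒜 r, f x ∈ geq 𝒜 s)
    (t : ℤ) (hf : ∀ d, ∀ x ∈ zdeg 𝒜 d, f x ∈ zdeg 𝒜 (d + t)) :
    ∀ d, ∀ m ∈ quoDeg 𝒜 r d, quoMap 𝒜 f h m ∈ quoDeg 𝒜 s (d + t) := by
  rintro d _ ⟨x, hx, rfl⟩
  exact ⟨f x, hf d x hx, rfl⟩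

/-! ### The left action on `Ext^i_B(M, B)` and the generalized Gorenstein condition -/

section LeftAction

variable {M : Type*} [AddCommGroup M] [Module k M] [Module Bᵐᵒᵖ M]

theorem isBarMap_left (ℳ : ℤ → Submodule k M) (b : B) :
    IsBarMap 𝒜 ℳ (zdeg 𝒜) ℳ (zdeg 𝒜)
      (barPull LinearMap.id (AlgHom.id k B) (LinearMap.mulLeft k b)) := by
  refine ⟨fun i f => barD_barPull _ _ _ (fun _ _ => rfl) (fun c n => ?_) i f, fun i f hf => ?_⟩
  · exact (mul_assoc b n c).symm
  · induction b using DirectSum.Decomposition.inductionOn 𝒜 with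
    | zero =>
      have : barPull LinearMap.id (AlgHom.id k B) (LinearMap.mulLeft k (0 : B)) i f = 0 := by
        funext m c; exact zero_mul _
      rw [Submodule.mem_comap, this]
      exact Submodule.zero_mem _
    | add b b' h h' =>
      have : barPull LinearMap.id (AlgHom.id k B) (LinearMap.mulLeft k (b + b')) i f
          = barPull LinearMap.id (AlgHom.id k B) (LinearMap.mulLeft k b) i f
            + barPull LinearMap.id (AlgHom.id k B) (LinearMap.mulLeft k b') i f := by
        funext m c; exact add_mul _ _ _
      rw [Submodule.mem_comap, this]
      exact Submodule.add_mem _ h h'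
    | @homogeneous j y =>
      refine barPull_cochains_le (𝒜 := 𝒜) (ℳ := ℳ) (𝒩 := zdeg 𝒜) _ _ _ 0 j ?_
        (fun _ _ h => h) ?_ i hf
      · intro d m hm; rw [add_zero]; exact hm
      · intro d n hn
        rw [add_comm]
        exact zdeg_mul_mem 𝒜 (d := (j : ℤ)) y.2 hn

/-- Left multiplication by `b` on `Ext^i_B(M, B)`, induced by the right `B`-linear map
`B → B`, `x ↦ b x`. -/
def extLeft (ℳ : ℤ → Submodule k M) (i : ℕ) (b : B) :
    GExt 𝒜 ℳ (zdeg 𝒜) i →ₗ[k] GExt 𝒜 ℳ (zdeg 𝒜) i :=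
  extMap _ (isBarMap_left 𝒜 ℳ b) i

end LeftAction

/-- The primitive orthogonal idempotents of `B` belonging to an isomorphism `B₀ ≅ kⁿ`. -/
def idem {n : ℕ} (ε : (Fin n → k) ≃ₐ[k] 𝒜 0) (j : Fin n) : B := (ε (Pi.single j 1) : 𝒜 0)

/-- `B` (noetherian on both sides, locally finite, with `B₀ ≅ kⁿ`) is generalized Gorenstein:
`injdim B_B = N`, and `Ext^i_B(S_j, B)` vanishes for `i ≠ N` and is isomorphic to
`S^∨_{σ(j)}[ℓ_j]` as a graded left module for `i = N`. -/
structure IsGeneralizedGorenstein {n : ℕ} (ε : (Fin n → k) ≃ₐ[k] 𝒜 0) (N : ℕ)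
    (σ : Equiv.Perm (Fin n)) (ℓ : Fin n → ℤ) : Prop where
  noetherian_left : IsNoetherianRing B
  noetherian_right : IsNoetherianRing Bᵐᵒᵖ
  locallyFinite : ∀ d, FiniteDimensional k (𝒜 d)
  injdim : injectiveDimension (ModuleCat.of Bᵐᵒᵖ B) = (N : WithBot ℕ∞)
  ext_eq_zero : ∀ (j : Fin n) (i : ℕ), i ≠ N →
    Subsingleton (GExt 𝒜 (simpleRDeg 𝒜 (idem 𝒜 ε j)) (zdeg 𝒜) i)
  ext_iso : ∀ j : Fin n,
    ∃ ψ : GExt 𝒜 (simpleRDeg 𝒜 (idem 𝒜 ε j)) (zdeg 𝒜) N ≃ₗ[k]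
        SimpleL 𝒜 (idem 𝒜 ε (σ j)),
      (∀ (b : B) x, ψ (extLeft 𝒜 (simpleRDeg 𝒜 (idem 𝒜 ε j)) N b x) = b • ψ x) ∧
      ∀ (d : ℤ) x, x ∈ gextDeg 𝒜 (simpleRDeg 𝒜 (idem 𝒜 ε j)) (zdeg 𝒜) N d ↔
        ψ x ∈ simpleLDeg 𝒜 (idem 𝒜 ε (σ j)) (d + ℓ j)

/-! ### Local cohomology `H^i(B) = colim_r Ext^i_B(B / B_{≥ r}, B)` -/

/-- `Ext^i_B(B / B_{≥ r}, B)`. -/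
abbrev ExtQuo (i r : ℕ) : Type _ := GExt 𝒜 (quoDeg 𝒜 r) (zdeg 𝒜) i

theorem geq_anti {r s : ℕ} (h : r ≤ s) : geq 𝒜 s ≤ geq 𝒜 r :=
  iSup_le fun i => le_iSup (fun i : {i : ℕ // r ≤ i} => 𝒜 i) ⟨i.1, h.trans i.2⟩

/-- The projection `B / B_{≥ s} → B / B_{≥ r}` for `r ≤ s`. -/
def quoProj {r s : ℕ} (h : r ≤ s) : Quo 𝒜 s →ₗ[k] Quo 𝒜 r :=
  quoMap 𝒜 LinearMap.id (geq_anti 𝒜 h)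

theorem isBarMap_proj {r s : ℕ} (h : r ≤ s) :
    IsBarMap 𝒜 (quoDeg 𝒜 r) (zdeg 𝒜) (quoDeg 𝒜 s) (zdeg 𝒜)
      (barPull (quoProj 𝒜 h) (AlgHom.id k B) (LinearMap.id : B →ₗ[k] B)) := by
  refine ⟨fun i f => barD_barPull _ _ _ ?_ (fun _ _ => rfl) i f, fun i => ?_⟩
  · rintro b ⟨x⟩; rfl
  · refine barPull_cochains_le _ _ _ 0 0 ?_ (fun _ _ h => h) ?_ i
    · exact quoMap_mem_quoDeg 𝒜 _ _ 0 fun d x hx => by rw [add_zero]; exact hx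
    · intro d x hx; rw [add_zero]; exact hx

/-- The transition maps of the direct system. -/
def extProj (i r s : ℕ) (h : r ≤ s) : ExtQuo 𝒜 i r →ₗ[k] ExtQuo 𝒜 i s :=
  extMap _ (isBarMap_proj 𝒜 h) i

/-- The local cohomology `H^i(B)` of the right module `B` with respect to `B_{≥ 1}`. -/
noncomputable abbrev LocalCoh (i : ℕ) : Type _ := Module.DirectLimit (ExtQuo 𝒜 i) (extProj 𝒜 i)

/-- The grading of `H^i(B)`. -/
noncomputable def localCohDeg (i : ℕ) (d : ℤ) : Submodule k (LocalCoh 𝒜 i) :=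
  ⨆ r : ℕ, (gextDeg 𝒜 (quoDeg 𝒜 r) (zdeg 𝒜) i d).map
    (Module.DirectLimit.of k ℕ (ExtQuo 𝒜 i) (extProj 𝒜 i) r)

theorem isBarMap_right (r : ℕ) (b : B) :
    IsBarMap 𝒜 (quoDeg 𝒜 r) (zdeg 𝒜) (quoDeg 𝒜 r) (zdeg 𝒜)
      (barPull (quoMap 𝒜 (LinearMap.mulLeft k b) fun _ h => mul_mem_geq_left b h)
        (AlgHom.id k B) (LinearMap.id : B →ₗ[k] B)) := by
  refine ⟨fun i f => barD_barPull _ _ _ ?_ (fun _ _ => rfl) i f, fun i f hf => ?_⟩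
  · rintro c ⟨x⟩
    exact congrArg Submodule.Quotient.mk (mul_assoc b x c).symm
  · rw [Submodule.mem_comap]
    induction hf using Submodule.iSup_induction' with
    | zero => rw [map_zero]; exact Submodule.zero_mem _
    | add f f' _ _ h h' => rw [map_add]; exact Submodule.add_mem _ h h'
    | mem ℓ f hf =>
      obtain ⟨F, hF⟩ := hf.1
      induction b using DirectSum.Decomposition.inductionOn 𝒜 with
      | zero =>
        convert Submodule.zero_mem (cochains 𝒜 (quoDeg 𝒜 r) (zdeg 𝒜) i) using 1
        funext m c
        obtain ⟨x⟩ := m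
        have : (quoMap 𝒜 (LinearMap.mulLeft k (0 : B)) fun _ h => mul_mem_geq_left 0 h)
            (Submodule.Quotient.mk x : Quo 𝒜 r) = (0 : Quo 𝒜 r) :=
          congrArg Submodule.Quotient.mk (zero_mul x)
        show f ((quoMap 𝒜 (LinearMap.mulLeft k (0 : B)) fun _ h => mul_mem_geq_left 0 h)
            (Submodule.Quotient.mk x : Quo 𝒜 r)) _ = 0
        rw [this, ← hF, map_zero]
        rfl
      | add b b' h h' =>
        convert Submodule.add_mem _ h h' using 1
        funext m c
        obtain ⟨x⟩ := m
        show f (Submodule.Quotient.mk ((b + b') * x)) c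
          = f (Submodule.Quotient.mk (b * x)) c + f (Submodule.Quotient.mk (b' * x)) c
        rw [add_mul, Submodule.Quotient.mk_add, ← hF, ← hF, ← hF, map_add]
        rfl
      | @homogeneous j y =>
        refine barPull_cochains_le (𝒜 := 𝒜) (ℳ := quoDeg 𝒜 r) (𝒩 := zdeg 𝒜) _ _ _ j 0 ?_
          (fun _ _ h => h) ?_ i (Submodule.mem_iSup_of_mem ℓ hf)
        · refine quoMap_mem_quoDeg 𝒜 _ _ j fun d x hx => ?_
          rw [add_comm]
          exact zdeg_mul_mem 𝒜 (d := (j : ℤ)) y.2 hx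
        · intro d n hn; rw [add_zero]; exact hn

/-- The right action of `b` on `Ext^i_B(B / B_{≥ r}, B)`, induced by left multiplication by `b`
on the bimodule `B / B_{≥ r}`. -/
def extRight (i r : ℕ) (b : B) : ExtQuo 𝒜 i r →ₗ[k] ExtQuo 𝒜 i r :=
  extMap _ (isBarMap_right 𝒜 r b) i

/-- The right action of `b` on `H^i(B)`. -/
noncomputable def localCohRight (i : ℕ) (b : B) : LocalCoh 𝒜 i →ₗ[k] LocalCoh 𝒜 i :=
  Module.DirectLimit.map (fun r => extRight 𝒜 i r b) fun r s h => by
    refine LinearMap.ext fun x => ?_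
    obtain ⟨f, rfl⟩ := Submodule.Quotient.mk_surjective _ x
    refine congrArg Submodule.Quotient.mk (Subtype.ext ?_)
    funext m c
    obtain ⟨x⟩ := m
    rfl

/-! ### Graded automorphisms and their action on local cohomology -/

/-- The group (under composition) of graded `k`-algebra automorphisms of `B` that fix the
idempotents `e₁, …, eₙ`. -/
def gradedAut {n : ℕ} (ε : (Fin n → k) ≃ₐ[k] 𝒜 0) : Subgroup (B ≃ₐ[k] B) where
  carrier := {g | (∀ d, (𝒜 d).map g.toLinearMap = 𝒜 d) ∧ ∀ j, g (idem 𝒜 ε j) = idem 𝒜 ε j}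
  one_mem' := ⟨fun d => Submodule.map_id _, fun _ => rfl⟩
  mul_mem' := by
    rintro g h ⟨hg, hg'⟩ ⟨hh, hh'⟩
    refine ⟨fun d => ?_, fun j => ?_⟩
    · have : (g * h).toLinearMap = g.toLinearMap ∘ₗ h.toLinearMap := rfl
      rw [this, Submodule.map_comp, hh, hg]
    · rw [AlgEquiv.mul_apply, hh', hg']
  inv_mem' := by
    rintro g ⟨hg, hg'⟩
    refine ⟨fun d => ?_, fun j => ?_⟩
    · have : (g⁻¹).toLinearMap ∘ₗ g.toLinearMap = LinearMap.id :=
        LinearMap.ext fun x => g.symm_apply_apply x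
      conv_lhs => rw [← hg d]
      rw [← Submodule.map_comp, this, Submodule.map_id]
    · exact (g.symm_apply_eq).2 (hg' j).symm

section Action

variable {n : ℕ} {ε : (Fin n → k) ≃ₐ[k] 𝒜 0}

theorem gradedAut_mem (g : gradedAut 𝒜 ε) (d : ℕ) (x : B) (hx : x ∈ 𝒜 d) :
    (g : B ≃ₐ[k] B) x ∈ 𝒜 d := by
  rw [← g.2.1 d]; exact ⟨x, hx, rfl⟩

theorem gradedAut_mem_zdeg (g : gradedAut 𝒜 ε) (d : ℤ) (x : B) (hx : x ∈ zdeg 𝒜 d) :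
    (g : B ≃ₐ[k] B).toLinearMap x ∈ zdeg 𝒜 (d + 0) := by
  rw [add_zero]
  rcases d with d | d
  · exact gradedAut_mem 𝒜 g d x hx
  · have : x = 0 := hx
    rw [this, map_zero]
    exact Submodule.zero_mem _

theorem gradedAut_mem_geq (g : gradedAut 𝒜 ε) (r : ℕ) (x : B) (hx : x ∈ geq 𝒜 r) :
    (g : B ≃ₐ[k] B).toLinearMap x ∈ geq 𝒜 r := by
  have : geq 𝒜 r ≤ (geq 𝒜 r).comap (g : B ≃ₐ[k] B).toLinearMap :=
    iSup_le fun i y hy => Submodule.mem_iSup_of_mem i (gradedAut_mem 𝒜 g i y hy)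
  exact this hx

theorem isBarMap_aut (g : gradedAut 𝒜 ε) (r : ℕ) :
    IsBarMap 𝒜 (quoDeg 𝒜 r) (zdeg 𝒜) (quoDeg 𝒜 r) (zdeg 𝒜)
      (barPull (quoMap 𝒜 _ (gradedAut_mem_geq 𝒜 g⁻¹ r))
        ((g⁻¹ : gradedAut 𝒜 ε) : B ≃ₐ[k] B).toAlgHom (g : B ≃ₐ[k] B).toLinearMap) := by
  refine ⟨fun i f => barD_barPull _ _ _ ?_ ?_ i f, fun i => ?_⟩
  · rintro b ⟨x⟩
    exact congrArg Submodule.Quotient.mk (map_mul ((g⁻¹ : gradedAut 𝒜 ε) : B ≃ₐ[k] B) x b)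
  · intro b x
    show (g : B ≃ₐ[k] B) (x * (g : B ≃ₐ[k] B).symm b) = (g : B ≃ₐ[k] B) x * b
    rw [map_mul, AlgEquiv.apply_symm_apply]
  · exact barPull_cochains_le _ _ _ 0 0
      (quoMap_mem_quoDeg 𝒜 _ _ 0 (gradedAut_mem_zdeg 𝒜 g⁻¹)) (gradedAut_mem 𝒜 g⁻¹)
      (gradedAut_mem_zdeg 𝒜 g) i

/-- The `g`-linear map on `Ext^i_B(B / B_{≥ r}, B)` given on cochains by
`f ↦ g ∘ f ∘ (g⁻¹, …, g⁻¹)`.  It is the map `Ext^i(B / B_{≥ r}, B) → Ext^i(B / B_{≥ r}, B^g)`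
induced by the right linear map `g : B → B^g`, followed by the identification of the target with
`Ext^i((B / B_{≥ r})^{g⁻¹}, B)` (twisting both arguments by `g⁻¹`) and then, through
`g⁻¹ : B / B_{≥ r} ≅ (B / B_{≥ r})^{g⁻¹}`, with `Ext^i(B / B_{≥ r}, B)`. -/
def extAut (g : gradedAut 𝒜 ε) (i r : ℕ) : ExtQuo 𝒜 i r →ₗ[k] ExtQuo 𝒜 i r :=
  extMap _ (isBarMap_aut 𝒜 g r) i

/-- The `g`-linear map `H^i(g) : H^i(B) → H^i(B^g) = H^i(B)^g`. -/
noncomputable def localCohAut (g : gradedAut 𝒜 ε) (i : ℕ) : LocalCoh 𝒜 i →ₗ[k] LocalCoh 𝒜 i :=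
  Module.DirectLimit.map (fun r => extAut 𝒜 g i r) fun r s h => by
    refine LinearMap.ext fun x => ?_
    obtain ⟨f, rfl⟩ := Submodule.Quotient.mk_surjective _ x
    refine congrArg Submodule.Quotient.mk (Subtype.ext ?_)
    funext m c
    obtain ⟨x⟩ := m
    rfl

end Action

/-! ### The graded dual and the homological determinant -/

/-- The graded dual `B^∨ = ⨁_d Hom_k(B_d, k)`, inside `Hom_k(B, k)`. -/
def gradedDual : Submodule k (Module.Dual k B) :=
  ⨆ d : ℕ, { carrier := {φ | ∀ i, i ≠ d → ∀ x ∈ 𝒜 i, φ x = 0}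
             zero_mem' := fun _ _ _ _ => rfl
             add_mem' := fun {φ ψ} hφ hψ i hi x hx => by
               rw [LinearMap.add_apply, hφ i hi x hx, hψ i hi x hx, add_zero]
             smul_mem' := fun c φ hφ i hi x hx => by
               rw [LinearMap.smul_apply, hφ i hi x hx, smul_zero] }

/-- `θ : H^N(B) ≅ B^∨` is an isomorphism of right `B`-modules, where `(φ · b)(x) = φ(b x)`. -/
def IsRightLinear {N : ℕ} (θ : LocalCoh 𝒜 N ≃ₗ[k] gradedDual 𝒜) : Prop :=
  ∀ (b : B) (x : LocalCoh 𝒜 N),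
    (θ (localCohRight 𝒜 N b x) : Module.Dual k B)
      = (θ x : Module.Dual k B) ∘ₗ LinearMap.mulLeft k b

section Hdet

variable {n : ℕ} (ε : (Fin n → k) ≃ₐ[k] 𝒜 0)

/-- `θ : H^N(B) ≅ B^∨ = ⨁_b e_b B^∨` is graded for the grading of `⨁_b e_b B^∨[ℓ_b]`.  Here
`e_b B^∨ = Hom_k(B e_b, k)` has `Hom_k(B_i e_b, k)` in degree `-i`, so that a functional has degree
`d` in `⨁_b e_b B^∨[ℓ_b]` if, for all `b`, it vanishes on `B_i e_b` unless `-i = d + ℓ_b`. -/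
def IsShiftGraded {N : ℕ} (ℓ : Fin n → ℤ) (θ : LocalCoh 𝒜 N ≃ₗ[k] gradedDual 𝒜) : Prop :=
  ∀ (d : ℤ) (x : LocalCoh 𝒜 N), x ∈ localCohDeg 𝒜 N d ↔
    ∀ (b : Fin n) (i : ℕ), -(i : ℤ) ≠ d + ℓ b →
      ∀ y ∈ 𝒜 i, (θ x : Module.Dual k B) (y * idem 𝒜 ε b) = 0

variable {ε}

/-- Under `θ : H^N(B) ≅ B^∨`, the map `H^N(g)` is `c_s · (g⁻¹)^*` on `e_s B^∨` for all `s`, where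
`(g⁻¹)^* φ = φ ∘ g⁻¹` and `e_s B^∨` consists of the `φ` with `φ(y e_s) = φ(y)` for all `y`. -/
def IsScaledBy {N : ℕ} (θ : LocalCoh 𝒜 N ≃ₗ[k] gradedDual 𝒜) (g : gradedAut 𝒜 ε)
    (c : Fin n → k) : Prop :=
  ∀ (s : Fin n) (x : LocalCoh 𝒜 N),
    (∀ y : B, (θ x : Module.Dual k B) (y * idem 𝒜 ε s) = (θ x : Module.Dual k B) y) →
      (θ (localCohAut 𝒜 g N x) : Module.Dual k B)
        = c s • ((θ x : Module.Dual k B) ∘ₗ ((g : B ≃ₐ[k] B)⁻¹).toLinearMap)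

open Classical in
/-- The homological determinant of `g`: the diagonal matrix with the inverses of the scalars by
which `H^N(g)` differs from `(g⁻¹)^*` under an isomorphism of right modules `H^N(B) ≅ B^∨`
(and zero if there are no such scalars). -/
noncomputable def Hdet (N : ℕ) (g : gradedAut 𝒜 ε) : Matrix (Fin n) (Fin n) k :=
  if h : ∃ c : Fin n → k, ∃ θ : LocalCoh 𝒜 N ≃ₗ[k] gradedDual 𝒜,
      IsRightLinear 𝒜 θ ∧ IsScaledBy 𝒜 θ g c
  then Matrix.diagonal fun s => (h.choose s)⁻¹
  else 0

end Hdet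

end Algebra

end HomDet

/-! The theorem rests on a trace-like functional `t` on `H^N(B)`. Since `Ext^N(S_b, B)` is a line of
degree `-ℓ_b` on which `e_{σ(b)}` acts as the identity from the left, the projections `B / B_{≥ r} →
S_b` give a socle element `u b` in `e_{σ(b)} H^N(B)_{-ℓ_b} e_b`. It is nonzero, because `S_b` is a
direct summand of `B / B_{≥ 1}` and the maps into the direct limit are injective. One chooses `t`
supported on these bidegrees with `t (u b) = 1` (`exists_generatingFunctional`), and sets `θ(x)(b) =
t(x b)` (`dualMap`), which is visibly right linear.

Bijectivity of `θ` is a duality statement. For a finite dimensional graded module `M` killed by some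
`B_{≥ r}`, `r ≥ 1`, a class `f` in `Ext^N(M, B)` and `m ∈ M` pair to the value of `t` on the
pullback of `f` along `B / B_{≥ r} → M`, `x ↦ m x`. For `M = S_j` this pairs two lines nontrivially.
Such an `M` is an iterated extension of shifts of the `S_j`, and `Ext^i(M, B) = 0` for `i ≠ N`, so a
five lemma argument (`IsSplitExact.isPerfect`) makes the pairing perfect for all `M`
(`isPerfect_of_simple`). The case `M = B / B_{≥ r}`, for all `r`, is the bijectivity of `θ`
(`dualMap_bijective`).

An automorphism `g` preserves degrees and both idempotent actions, and the bidegree containing `u b`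
is the line `k · u b` (`IsGeneratingFunctional.eq_smul`). So `H^N(g)(u b) = λ_b u b`, hence `t`
composed with `H^N(g)` is `λ_b t` on `H^N(B) e_b` (`apply_right_localCohAut`). Together with
`H^N(g)(x w) = H^N(g)(x) g(w)` this is the formula (`isScaledBy`).

For uniqueness, the coordinate functional `B → B_0 → k` belonging to `e_s` is fixed by every `g`,
and the corresponding `w ∈ H^N(B)` satisfies `w y = y_s w`. This condition forces any other right
linear `θ'` to send `w` to a multiple of the same functional, so `λ_s` is the eigenvalue of `H^N(g)`
on `w`, which does not depend on `θ` (`IsScaledBy.unique`). Multiplicativity follows from `H^N(g h)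
= H^N(g) H^N(h)`, computed with one `θ`. -/

namespace HomDet

/-! ### The bar complex: recursion for the differential, multilinearity, homogeneity. -/

section Bar

variable {k B M N : Type*} [Field k] [Ring B] [Algebra k B]
  [AddCommGroup M] [Module k M] [Module Bᵐᵒᵖ M] [IsScalarTower k Bᵐᵒᵖ M]
  [AddCommGroup N] [Module k N] [Module Bᵐᵒᵖ N] [IsScalarTower k Bᵐᵒᵖ N]

/-- `f` with its module argument fixed, the first algebra argument becoming the module argument. -/
def slice {i : ℕ} (f : M → (Fin (i + 1) → B) → N) (m : M) : B → (Fin i → B) → N :=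
  fun x b => f m (Fin.cons x b)

theorem contractNth_zero_cons {i : ℕ} (x : B) (b : Fin (i + 1) → B) :
    Fin.contractNth (0 : Fin (i + 2)) (· * ·) (Fin.cons x b : Fin (i + 2) → B)
      = (Fin.cons (x * b 0) (Fin.tail b) : Fin (i + 1) → B) := by
  funext t
  refine Fin.cases ?_ (fun t => ?_) t
  · simp [Fin.contractNth]
  · simp [Fin.contractNth, Fin.tail]

theorem contractNth_succ_cons {i : ℕ} (j : Fin (i + 1)) (x : B) (b : Fin (i + 1) → B) :
    Fin.contractNth j.succ (· * ·) (Fin.cons x b : Fin (i + 2) → B)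
      = (Fin.cons x (Fin.contractNth j (· * ·) b) : Fin (i + 1) → B) := by
  funext t
  refine Fin.cases ?_ (fun t => ?_) t
  · simp [Fin.contractNth]
  · simp [Fin.contractNth]

theorem barD_zero_apply (f : M → (Fin 0 → B) → N) (m : M) (b : Fin 1 → B) :
    barD k 0 f m b
      = f (MulOpposite.op (b 0) • m) default - MulOpposite.op (b 0) • f m default := by
  simp [barD, Subsingleton.elim (Fin.tail b) default, Subsingleton.elim (Fin.init b) default,
    sub_eq_add_neg]

/-- This recursion drives every induction on the bar complex. In the differential of the slice, `x`
is the module argument, so the contraction merging `x` with `b 0` becomes its module-action term;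
the remaining terms shift by one place and change sign. Slicing replaces `M` by `B`, so each fact is
proved first for `M = B` by induction, then for any `M` by one more step. -/
theorem barD_cons {i : ℕ} (f : M → (Fin (i + 1) → B) → N) (m : M) (x : B) (b : Fin (i + 1) → B) :
    barD k (i + 1) f m (Fin.cons x b)
      = f (MulOpposite.op x • m) b - barD k i (slice f m) x b := by
  have h0 : (Fin.castSucc (0 : Fin (i + 1))) = 0 := rfl
  simp only [barD, LinearMap.coe_mk, AddHom.coe_mk, slice, Fin.sum_univ_succ, h0,
    contractNth_zero_cons, ← Fin.succ_castSucc, contractNth_succ_cons, Fin.cons_zero,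
    Fin.tail_cons, MulOpposite.smul_eq_mul_unop, MulOpposite.unop_op, Fin.val_zero, Fin.val_succ]
  have hl : (Fin.cons x b : Fin (i + 2) → B) (Fin.last (i + 1)) = b (Fin.last i) := by
    rw [← Fin.succ_last, Fin.cons_succ]
  have hi : Fin.init (Fin.cons x b : Fin (i + 2) → B) = Fin.cons x (Fin.init b) := by
    funext t
    refine Fin.cases rfl (fun t => ?_) t
    simp [Fin.init, Fin.castSucc_succ]
  rw [hl, hi]
  simp only [pow_succ (-1 : ℤˣ), mul_neg, mul_one, Units.neg_smul, neg_neg,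
    Finset.sum_neg_distrib, pow_zero, one_smul]
  abel

theorem barD_apply_succ {i : ℕ} (f : M → (Fin (i + 1) → B) → N) (m : M) (b : Fin (i + 2) → B) :
    barD k (i + 1) f m b
      = f (MulOpposite.op (b 0) • m) (Fin.tail b) - barD k i (slice f m) (b 0) (Fin.tail b) := by
  conv_lhs => rw [← Fin.cons_self_tail b]
  exact barD_cons f m _ _

/-- The map `x ↦ m x` from `B` to `M` is right linear, so pulling back along it commutes with the
differential. -/
theorem barD_comp_orbit {i : ℕ} (f : M → (Fin i → B) → N) (m : M) :
    barD k i (fun (x : B) b => f (MulOpposite.op x • m) b)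
      = fun (x : B) b => barD k i f (MulOpposite.op x • m) b := by
  funext x b
  simp only [barD, LinearMap.coe_mk, AddHom.coe_mk]
  have : MulOpposite.op (MulOpposite.op (b 0) • x) • m
      = MulOpposite.op (b 0) • MulOpposite.op x • m := by
    rw [← mul_smul]; rfl
  rw [this]

theorem barD_barD_zero (f : M → (Fin 0 → B) → N) : barD k 1 (barD k 0 f) = 0 := by
  funext m b
  rw [barD_apply_succ]
  have : slice (barD k 0 f) m = fun (x : B) b => f (MulOpposite.op x • m) b
      - MulOpposite.op x • f m default := by
    funext x b
    simp only [slice, barD_zero_apply, Fin.cons_zero]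
    rw [Subsingleton.elim b default]
  rw [this, barD_zero_apply, barD_zero_apply]
  simp only [Fin.tail, smul_sub, ← mul_smul]
  simp [MulOpposite.smul_eq_mul_unop]

/-- Slicing `d f` at `m` gives the pullback of `f` along `x ↦ m x` minus `d` of the slice. Applying
`d` kills the second part by hypothesis, and the first part cancels the leading term of the
recursion. -/
theorem barD_barD_succ {i : ℕ} (h : ∀ f : B → (Fin i → B) → N, barD k (i + 1) (barD k i f) = 0)
    (f : M → (Fin (i + 1) → B) → N) : barD k (i + 2) (barD k (i + 1) f) = 0 := by
  funext m b
  rw [barD_apply_succ]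
  have : slice (barD k (i + 1) f) m
      = (fun (x : B) b => f (MulOpposite.op x • m) b) - barD k i (slice f m) := by
    funext x b
    exact barD_cons f m x b
  rw [this, map_sub, h, sub_zero, barD_comp_orbit, sub_self]
  rfl

theorem barD_barD_self (i : ℕ) : ∀ f : B → (Fin i → B) → N, barD k (i + 1) (barD k i f) = 0 := by
  induction i with
  | zero => exact barD_barD_zero
  | succ i ih => exact barD_barD_succ ih

theorem barD_barD : ∀ (i : ℕ) (f : M → (Fin i → B) → N), barD k (i + 1) (barD k i f) = 0
  | 0, f => barD_barD_zero f
  | i + 1, f => barD_barD_succ (barD_barD_self i) f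

/-- `f` is linear in each of its arguments. -/
structure IsMultilinear (k : Type*) {B M N : Type*} [Field k] [Ring B] [Algebra k B]
    [AddCommGroup M] [Module k M] [AddCommGroup N] [Module k N] {i : ℕ}
    (f : M → (Fin i → B) → N) : Prop where
  add : ∀ m m' b, f (m + m') b = f m b + f m' b
  smul : ∀ (c : k) m b, f (c • m) b = c • f m b
  update_add : ∀ m b t x y, f m (Function.update b t (x + y))
    = f m (Function.update b t x) + f m (Function.update b t y)
  update_smul : ∀ m b t (c : k) x, f m (Function.update b t (c • x))
    = c • f m (Function.update b t x)

/-- The unbundled form is the one that passes easily to slices and through the recursion for the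
differential. -/
theorem isMultilinear_iff {i : ℕ} (f : M → (Fin i → B) → N) :
    IsMultilinear k f ↔
      ∃ F : M →ₗ[k] MultilinearMap k (fun _ : Fin i => B) N, ∀ m b, F m b = f m b := by
  constructor
  · intro h
    refine ⟨{ toFun := fun m => { toFun := f m, map_update_add' := ?_, map_update_smul' := ?_ },
              map_add' := fun m m' => MultilinearMap.ext (h.add m m'),
              map_smul' := fun c m => MultilinearMap.ext (h.smul c m) }, fun _ _ => rfl⟩
    · intro _ b t x y
      convert h.update_add m b t x y
    · intro _ b t c x
      convert h.update_smul m b t c x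
  · rintro ⟨F, hF⟩
    constructor <;> intros <;> simp [← hF]

theorem IsMultilinear.map_zero {i : ℕ} {f : M → (Fin i → B) → N} (h : IsMultilinear k f)
    (b : Fin i → B) : f 0 b = 0 := by
  simpa using h.smul 0 0 b

theorem IsMultilinear.slice {i : ℕ} {f : M → (Fin (i + 1) → B) → N} (h : IsMultilinear k f)
    (m : M) : IsMultilinear k (slice f m) := by
  refine ⟨fun x y b => ?_, fun c x b => ?_, fun x b t y z => ?_, fun x b t c y => ?_⟩
  · simpa [HomDet.slice] using h.update_add m (Fin.cons 0 b) 0 x y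
  · simpa [HomDet.slice] using h.update_smul m (Fin.cons 0 b) 0 c x
  · simpa [HomDet.slice, Fin.cons_update] using h.update_add m (Fin.cons x b) t.succ y z
  · simpa [HomDet.slice, Fin.cons_update] using h.update_smul m (Fin.cons x b) t.succ c y

theorem op_smul_smul_comm (b : B) (c : k) (n : N) :
    MulOpposite.op b • c • n = c • MulOpposite.op b • n := by
  rw [← smul_one_smul Bᵐᵒᵖ c n, ← smul_one_smul Bᵐᵒᵖ c (MulOpposite.op b • n), ← mul_smul,
    ← mul_smul, mul_smul_one, smul_one_mul]

theorem op_smul_op_smul (c : k) (b : B) (n : N) :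
    MulOpposite.op (c • b) • n = c • MulOpposite.op b • n := by
  rw [MulOpposite.op_smul, smul_assoc]

theorem isMultilinear_barD_zero {f : M → (Fin 0 → B) → N} (h : IsMultilinear k f) :
    IsMultilinear k (barD k 0 f) := by
  refine ⟨fun m m' b => ?_, fun c m b => ?_, fun m b t x y => ?_, fun m b t c x => ?_⟩ <;>
    simp only [barD_zero_apply]
  · simp only [smul_add, h.add]; abel
  · simp only [op_smul_smul_comm, h.smul, smul_sub]
  · obtain rfl : t = 0 := Subsingleton.elim (α := Fin 1) t 0
    simp only [Function.update_self, MulOpposite.op_add, add_smul, h.add]; abel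
  · obtain rfl : t = 0 := Subsingleton.elim (α := Fin 1) t 0
    simp only [Function.update_self, op_smul_op_smul, h.smul, smul_sub]

theorem isMultilinear_barD_succ {i : ℕ}
    (ih : ∀ f : B → (Fin i → B) → N, IsMultilinear k f → IsMultilinear k (barD k i f))
    {f : M → (Fin (i + 1) → B) → N} (h : IsMultilinear k f) :
    IsMultilinear k (barD k (i + 1) f) := by
  have h' := fun m => ih _ (h.slice m)
  refine ⟨fun m m' b => ?_, fun c m b => ?_, fun m b t x y => ?_, fun m b t c x => ?_⟩ <;>
    simp only [barD_apply_succ]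
  · have : slice f (m + m') = slice f m + slice f m' := by
      funext x b; exact h.add _ _ _
    rw [this, map_add, smul_add, h.add, Pi.add_apply, Pi.add_apply]; abel
  · have : slice f (c • m) = c • slice f m := by
      funext x b; exact h.smul _ _ _
    rw [this, map_smul, op_smul_smul_comm, h.smul, Pi.smul_apply, Pi.smul_apply, smul_sub]
  · refine Fin.cases ?_ (fun t => ?_) t
    · simp only [Function.update_self, Fin.tail_update_zero, MulOpposite.op_add, add_smul, h.add,
        (h' m).add]
      abel
    · simp only [Fin.tail_update_succ, (h' m).update_add, h.update_add,
        Function.update_of_ne (Fin.succ_ne_zero t).symm]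
      abel
  · refine Fin.cases ?_ (fun t => ?_) t
    · simp only [Function.update_self, Fin.tail_update_zero, op_smul_op_smul, h.smul,
        (h' m).smul, smul_sub]
    · simp only [Fin.tail_update_succ, (h' m).update_smul, h.update_smul,
        Function.update_of_ne (Fin.succ_ne_zero t).symm, smul_sub]

theorem isMultilinear_barD_self (i : ℕ) :
    ∀ f : B → (Fin i → B) → N, IsMultilinear k f → IsMultilinear k (barD k i f) := by
  induction i with
  | zero => exact fun _ => isMultilinear_barD_zero
  | succ i ih => exact fun _ => isMultilinear_barD_succ ih

theorem IsMultilinear.barD : ∀ {i : ℕ} {f : M → (Fin i → B) → N}, IsMultilinear k f →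
    IsMultilinear k (barD k i f)
  | 0, _, h => isMultilinear_barD_zero h
  | i + 1, _, h => isMultilinear_barD_succ (isMultilinear_barD_self i) h

/-- `f` maps homogeneous arguments to homogeneous elements, with a shift by `ℓ`. -/
def IsHomogeneousMap (𝒜 : ℕ → Submodule k B) (ℳ : ℤ → Submodule k M) (𝒩 : ℤ → Submodule k N)
    {i : ℕ} (ℓ : ℤ) (f : M → (Fin i → B) → N) : Prop :=
  ∀ (p : ℤ) (q : Fin i → ℕ) (m : M) (b : Fin i → B), m ∈ ℳ p → (∀ t, b t ∈ 𝒜 (q t)) →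
    f m b ∈ 𝒩 (p + ∑ t, (q t : ℤ) + ℓ)

variable {𝒜 : ℕ → Submodule k B} {ℳ : ℤ → Submodule k M} {𝒩 : ℤ → Submodule k N}

theorem mem_homCochain {i : ℕ} {ℓ : ℤ} {f : M → (Fin i → B) → N} :
    f ∈ homCochain 𝒜 ℳ 𝒩 i ℓ ↔ IsMultilinear k f ∧ IsHomogeneousMap 𝒜 ℳ 𝒩 ℓ f := by
  rw [isMultilinear_iff]; rfl

/-- The grading `ℳ` of the right module `M` is compatible with the action of `B`. -/
def IsGradedAction (𝒜 : ℕ → Submodule k B) (ℳ : ℤ → Submodule k M) : Prop :=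
  ∀ (p : ℤ) (q : ℕ) (m : M) (b : B), m ∈ ℳ p → b ∈ 𝒜 q → MulOpposite.op b • m ∈ ℳ (p + q)

/-- Fixing `m` of degree `p` adds `p` to the degree of the map. In negative degrees `zdeg` is zero,
and linearity of the slice in its first argument is what gives the value `0` there. -/
theorem IsHomogeneousMap.slice {i : ℕ} {ℓ p : ℤ} {f : M → (Fin (i + 1) → B) → N}
    (h : IsHomogeneousMap 𝒜 ℳ 𝒩 ℓ f) (hf : IsMultilinear k f) {m : M} (hm : m ∈ ℳ p) :
    IsHomogeneousMap 𝒜 (zdeg 𝒜) 𝒩 (ℓ + p) (slice f m) := by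
  intro s q x b hx hb
  rcases s with s | s
  · have := h p (Fin.cons s q) m (Fin.cons x b) hm (Fin.cases hx hb)
    simp only [Fin.sum_univ_succ, Fin.cons_zero, Fin.cons_succ] at this
    change f m (Fin.cons x b) ∈ _
    convert this using 2
    simp only [Int.ofNat_eq_natCast]; ring
  · have : x = 0 := hx
    rw [this, (hf.slice m).map_zero]
    exact Submodule.zero_mem _

theorem isHomogeneousMap_barD_zero (hM : IsGradedAction 𝒜 ℳ) (hN : IsGradedAction 𝒜 𝒩) {ℓ : ℤ}
    {f : M → (Fin 0 → B) → N} (h : IsHomogeneousMap 𝒜 ℳ 𝒩 ℓ f) :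
    IsHomogeneousMap 𝒜 ℳ 𝒩 ℓ (barD k 0 f) := by
  intro p q m b hm hb
  rw [barD_zero_apply]
  have h1 := h _ default _ default (hM p _ m _ hm (hb 0)) (fun t => t.elim0)
  have h2 := hN _ _ _ _ (h _ default _ default hm (fun t => t.elim0)) (hb 0)
  simp only [Fin.sum_univ_succ, Finset.univ_eq_empty, Finset.sum_empty, add_zero] at h1 h2 ⊢
  exact Submodule.sub_mem _ h1 (by convert h2 using 2; ring)

theorem isHomogeneousMap_barD_succ {i : ℕ}
    (ih : ∀ (ℓ : ℤ) (f : B → (Fin i → B) → N), IsMultilinear k f →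
      IsHomogeneousMap 𝒜 (zdeg 𝒜) 𝒩 ℓ f → IsHomogeneousMap 𝒜 (zdeg 𝒜) 𝒩 ℓ (barD k i f))
    (hM : IsGradedAction 𝒜 ℳ) {ℓ : ℤ}
    {f : M → (Fin (i + 1) → B) → N} (hf : IsMultilinear k f) (h : IsHomogeneousMap 𝒜 ℳ 𝒩 ℓ f) :
    IsHomogeneousMap 𝒜 ℳ 𝒩 ℓ (barD k (i + 1) f) := by
  intro p q m b hm hb
  rw [barD_apply_succ]
  have h1 := h _ (Fin.tail q) _ (Fin.tail b) (hM p _ m _ hm (hb 0)) (fun t => hb t.succ)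
  have h2 := ih _ _ (hf.slice m) (h.slice hf hm) (q 0) (Fin.tail q) (b 0) (Fin.tail b) (hb 0)
    (fun t => hb t.succ)
  rw [Fin.sum_univ_succ]
  refine Submodule.sub_mem _ ?_ ?_
  · convert h1 using 2; simp only [Fin.tail]; ring
  · convert h2 using 2; simp only [Fin.tail]; ring

theorem barD_mem_homCochain_self (hB : IsGradedAction 𝒜 (zdeg 𝒜)) (hN : IsGradedAction 𝒜 𝒩)
    (i : ℕ) : ∀ (ℓ : ℤ) (f : B → (Fin i → B) → N), IsMultilinear k f →
      IsHomogeneousMap 𝒜 (zdeg 𝒜) 𝒩 ℓ f → IsHomogeneousMap 𝒜 (zdeg 𝒜) 𝒩 ℓ (barD k i f) := by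
  induction i with
  | zero => exact fun _ _ _ h => isHomogeneousMap_barD_zero hB hN h
  | succ i ih => exact fun _ _ hf h => isHomogeneousMap_barD_succ ih hB hf h

theorem barD_mem_homCochain (hB : IsGradedAction 𝒜 (zdeg 𝒜)) (hM : IsGradedAction 𝒜 ℳ)
    (hN : IsGradedAction 𝒜 𝒩) {i : ℕ} {ℓ : ℤ} {f : M → (Fin i → B) → N}
    (h : f ∈ homCochain 𝒜 ℳ 𝒩 i ℓ) : barD k i f ∈ homCochain 𝒜 ℳ 𝒩 (i + 1) ℓ := by
  rw [mem_homCochain] at h ⊢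
  refine ⟨h.1.barD, ?_⟩
  cases i with
  | zero => exact isHomogeneousMap_barD_zero hM hN h.2
  | succ i =>
    exact isHomogeneousMap_barD_succ (barD_mem_homCochain_self hB hN i) hM h.1 h.2

theorem barD_mem_cochains (hB : IsGradedAction 𝒜 (zdeg 𝒜)) (hM : IsGradedAction 𝒜 ℳ)
    (hN : IsGradedAction 𝒜 𝒩) {i : ℕ} {f : M → (Fin i → B) → N}
    (h : f ∈ cochains 𝒜 ℳ 𝒩 i) : barD k i f ∈ cochains 𝒜 ℳ 𝒩 (i + 1) := by
  have : cochains 𝒜 ℳ 𝒩 i ≤ (cochains 𝒜 ℳ 𝒩 (i + 1)).comap (barD k i) :=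
    iSup_le fun ℓ f hf => Submodule.mem_iSup_of_mem ℓ (barD_mem_homCochain hB hM hN hf)
  exact this h

theorem coboundaries_le_cocycles (hB : IsGradedAction 𝒜 (zdeg 𝒜)) (hM : IsGradedAction 𝒜 ℳ)
    (hN : IsGradedAction 𝒜 𝒩) : ∀ i, coboundaries 𝒜 ℳ 𝒩 i ≤ cocycles 𝒜 ℳ 𝒩 i
  | 0 => bot_le
  | i + 1 => by
    rintro _ ⟨h, hh, rfl⟩
    exact ⟨barD_mem_cochains hB hM hN hh, barD_barD i h⟩

theorem isMultilinear_of_mem_cochains {i : ℕ} {f : M → (Fin i → B) → N}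
    (h : f ∈ cochains 𝒜 ℳ 𝒩 i) : IsMultilinear k f := by
  induction h using Submodule.iSup_induction' with
  | mem ℓ f hf => exact (mem_homCochain.1 hf).1
  | zero => exact ⟨fun _ _ _ => (add_zero 0).symm, fun c _ _ => (smul_zero c).symm,
      fun _ _ _ _ _ => (add_zero 0).symm, fun _ _ _ c _ => (smul_zero c).symm⟩
  | add f g _ _ hf hg =>
    refine ⟨fun m m' b => ?_, fun c m b => ?_, fun m b t x y => ?_, fun m b t c x => ?_⟩ <;>
      simp only [Pi.add_apply]
    · rw [hf.add, hg.add]; abel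
    · rw [hf.smul, hg.smul, smul_add]
    · rw [hf.update_add, hg.update_add]; abel
    · rw [hf.update_smul, hg.update_smul, smul_add]

/-- A multilinear map that vanishes on homogeneous arguments is zero. -/
theorem IsMultilinear.eq_zero_succ {i : ℕ} (hM : ⨆ p, ℳ p = ⊤)
    (ih : ∀ f : B → (Fin i → B) → N, IsMultilinear k f →
      (∀ (p : ℤ) (q : Fin i → ℕ) (x : B) (b : Fin i → B), x ∈ zdeg 𝒜 p → (∀ t, b t ∈ 𝒜 (q t)) →
        f x b = 0) → f = 0)
    (f : M → (Fin (i + 1) → B) → N) (h : IsMultilinear k f)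
    (h0 : ∀ (p : ℤ) (q : Fin (i + 1) → ℕ) (m : M) (b : Fin (i + 1) → B), m ∈ ℳ p →
      (∀ t, b t ∈ 𝒜 (q t)) → f m b = 0) : f = 0 := by
  funext m b
  have hm : m ∈ ⨆ p, ℳ p := hM ▸ Submodule.mem_top
  induction hm using Submodule.iSup_induction' with
  | zero => exact h.map_zero b
  | add m m' _ _ hm hm' => rw [h.add, hm, hm']; exact add_zero 0
  | mem p m hm =>
    have := ih (HomDet.slice f m) (h.slice m) fun s q x b hx hb => by
      rcases s with s | s
      · exact h0 p (Fin.cons s q) m (Fin.cons x b) hm (Fin.cases hx hb)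
      · have : x = 0 := hx
        rw [this, (h.slice m).map_zero]
    have := congrFun (congrFun this (b 0)) (Fin.tail b)
    rwa [HomDet.slice, Fin.cons_self_tail] at this

theorem IsMultilinear.eq_zero_zero (hM : ⨆ p, ℳ p = ⊤)
    (f : M → (Fin 0 → B) → N) (h : IsMultilinear k f)
    (h0 : ∀ (p : ℤ) (q : Fin 0 → ℕ) (m : M) (b : Fin 0 → B), m ∈ ℳ p →
      (∀ t, b t ∈ 𝒜 (q t)) → f m b = 0) : f = 0 := by
  funext m b
  have hm : m ∈ ⨆ p, ℳ p := hM ▸ Submodule.mem_top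
  induction hm using Submodule.iSup_induction' with
  | zero => exact h.map_zero b
  | add m m' _ _ hm hm' => rw [h.add, hm, hm']; exact add_zero 0
  | mem p m hm => exact h0 p default m b hm fun t => t.elim0

theorem IsMultilinear.eq_zero_self (hB : ⨆ p, zdeg 𝒜 p = ⊤) (i : ℕ) :
    ∀ f : B → (Fin i → B) → N, IsMultilinear k f →
      (∀ (p : ℤ) (q : Fin i → ℕ) (x : B) (b : Fin i → B), x ∈ zdeg 𝒜 p → (∀ t, b t ∈ 𝒜 (q t)) →
        f x b = 0) → f = 0 := by
  induction i with
  | zero => exact IsMultilinear.eq_zero_zero hB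
  | succ i ih => exact IsMultilinear.eq_zero_succ hB ih

theorem IsMultilinear.eq_zero (hB : ⨆ p, zdeg 𝒜 p = ⊤) (hM : ⨆ p, ℳ p = ⊤) :
    ∀ {i : ℕ} {f : M → (Fin i → B) → N}, IsMultilinear k f →
    (∀ (p : ℤ) (q : Fin i → ℕ) (m : M) (b : Fin i → B), m ∈ ℳ p →
      (∀ t, b t ∈ 𝒜 (q t)) → f m b = 0) → f = 0
  | 0, f, h, h0 => eq_zero_zero hM f h h0
  | i + 1, f, h, h0 => eq_zero_succ hM (eq_zero_self hB i) f h h0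

/-- Evaluated at fixed homogeneous arguments, cochains of different degrees take values in different
pieces of `𝒩`; independence of `𝒩` kills each value, and multilinearity extends this to all
arguments. -/
theorem iSupIndep_homCochain (hB : ⨆ p, zdeg 𝒜 p = ⊤) (hM : ⨆ p, ℳ p = ⊤) (hN : iSupIndep 𝒩)
    (i : ℕ) : iSupIndep (homCochain 𝒜 ℳ 𝒩 i) := by
  rw [iSupIndep_iff_finsetSum_eq_zero_imp_eq_zero] at hN ⊢
  intro s v hv hsum ℓ hℓ
  refine (mem_homCochain.1 (hv ℓ hℓ)).1.eq_zero hB hM fun p q m b hm hb => ?_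
  -- The values have degrees `ℓ` translated by the total degree of the arguments, so the index set
  -- is translated accordingly.
  have := hN (s.map (addLeftEmbedding (p + ∑ t, (q t : ℤ))))
    (fun d => v (d - (p + ∑ t, (q t : ℤ))) m b) (fun d hd => ?_) ?_
    (p + ∑ t, (q t : ℤ) + ℓ) (Finset.mem_map_of_mem _ hℓ)
  · simpa using this
  · obtain ⟨e, he, rfl⟩ := Finset.mem_map.1 hd
    have := (mem_homCochain.1 (hv e he)).2 p q m b hm hb
    simpa using this
  · rw [Finset.sum_map]
    have := congrFun (congrFun hsum m) b
    simpa using this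

end Bar

/-! ### Gradings described by their projections. -/

section Grading

variable {k B : Type*} [Field k] [Ring B] [Algebra k B] (𝒜 : ℕ → Submodule k B)
  [GradedAlgebra 𝒜]

theorem isGradedAction_zdeg : IsGradedAction 𝒜 (zdeg 𝒜) :=
  fun _ q _ _ hm hb => zdeg_mul_mem 𝒜 (e := (q : ℤ)) hm hb

/-- The linear maps `p d` are the projections to the pieces of the grading `ℳ` of `M`. -/
structure IsGradingProj {M : Type*} [AddCommGroup M] [Module k M] (ℳ : ℤ → Submodule k M)
    (p : ℤ → M →ₗ[k] M) : Prop where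
  mem : ∀ d m, p d m ∈ ℳ d
  self : ∀ d, ∀ m ∈ ℳ d, p d m = m
  ne : ∀ d e, ∀ m ∈ ℳ d, e ≠ d → p e m = 0
  sum : ∀ m, ∃ s : Finset ℤ, ∑ d ∈ s, p d m = m

theorem IsGradingProj.iSup_eq_top {M : Type*} [AddCommGroup M] [Module k M]
    {ℳ : ℤ → Submodule k M} {p : ℤ → M →ₗ[k] M} (h : IsGradingProj ℳ p) : ⨆ d, ℳ d = ⊤ := by
  refine eq_top_iff.2 fun m _ => ?_
  obtain ⟨s, hs⟩ := h.sum m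
  rw [← hs]
  exact Submodule.sum_mem _ fun d _ => Submodule.mem_iSup_of_mem d (h.mem d m)

theorem IsGradingProj.iSupIndep {M : Type*} [AddCommGroup M] [Module k M]
    {ℳ : ℤ → Submodule k M} {p : ℤ → M →ₗ[k] M} (h : IsGradingProj ℳ p) : iSupIndep ℳ := by
  rw [iSupIndep_iff_finsetSum_eq_zero_imp_eq_zero]
  intro s v hv hs d hd
  have := congrArg (p d) hs
  rw [map_sum, map_zero, Finset.sum_eq_single_of_mem d hd fun e he hne =>
    h.ne e d _ (hv e he) hne.symm] at this
  rwa [h.self d _ (hv d hd)] at this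

/-- Both sides are additive in `m`, so it suffices to compare them on the homogeneous components of
`m`, where each is the component itself or zero. -/
theorem IsGradingProj.comp_eq {M M' : Type*} [AddCommGroup M] [Module k M]
    [AddCommGroup M'] [Module k M'] {ℳ : ℤ → Submodule k M} {ℳ' : ℤ → Submodule k M'}
    {p : ℤ → M →ₗ[k] M} {p' : ℤ → M' →ₗ[k] M'} (h : IsGradingProj ℳ p) (h' : IsGradingProj ℳ' p')
    (f : M →ₗ[k] M') (hf : ∀ d, ∀ m ∈ ℳ d, f m ∈ ℳ' d) (d : ℤ) (m : M) :
    p' d (f m) = f (p d m) := by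
  obtain ⟨s, hs⟩ := h.sum m
  rw [← hs]
  simp only [map_sum]
  refine Finset.sum_congr rfl fun e _ => ?_
  by_cases hde : d = e
  · subst hde
    rw [h.self d _ (h.mem d m), h'.self d _ (hf d _ (h.mem d m))]
  · rw [h.ne e d _ (h.mem e m) hde, h'.ne e d _ (hf e _ (h.mem e m)) hde, map_zero]

/-- The projection of `B` to its piece of degree `d`. -/
def zproj : ℤ → B →ₗ[k] B
  | Int.ofNat d => GradedAlgebra.proj 𝒜 d
  | Int.negSucc _ => 0

theorem isGradingProj_zproj : IsGradingProj (zdeg 𝒜) (zproj 𝒜) := by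
  refine ⟨fun d m => ?_, fun d m hm => ?_, fun d e m hm hne => ?_, fun m => ?_⟩
  · rcases d with d | d
    · exact SetLike.coe_mem (DirectSum.decompose 𝒜 m d)
    · exact Submodule.zero_mem _
  · rcases d with d | d
    · exact DirectSum.decompose_of_mem_same 𝒜 hm
    · exact (show m = 0 from hm).symm
  · rcases d with d | d
    · rcases e with e | e
      · exact DirectSum.decompose_of_mem_ne 𝒜 hm fun h => hne (by rw [h])
      · rfl
    · rw [show m = 0 from hm, map_zero]
  · classical
    refine ⟨(DirectSum.decompose 𝒜 m).support.map Nat.castEmbedding, ?_⟩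
    rw [Finset.sum_map]
    exact DirectSum.sum_support_decompose 𝒜 m

theorem iSup_zdeg : ⨆ d, zdeg 𝒜 d = ⊤ := (isGradingProj_zproj 𝒜).iSup_eq_top

theorem iSupIndep_zdeg : iSupIndep (zdeg 𝒜) := (isGradingProj_zproj 𝒜).iSupIndep

theorem zproj_mem_geq {r : ℕ} (d : ℤ) {x : B} (hx : x ∈ geq 𝒜 r) : zproj 𝒜 d x ∈ geq 𝒜 r := by
  have : geq 𝒜 r ≤ (geq 𝒜 r).comap (zproj 𝒜 d) := iSup_le fun i y hy => by
    by_cases h : d = (i : ℕ)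
    · subst h
      rw [Submodule.mem_comap, (isGradingProj_zproj 𝒜).self (i : ℕ) y hy]
      exact Submodule.mem_iSup_of_mem i hy
    · rw [Submodule.mem_comap, (isGradingProj_zproj 𝒜).ne (i : ℕ) d y hy h]
      exact Submodule.zero_mem _
  exact this hx

end Grading

/-! ### Pieces of the long exact sequence of Ext, and perfect pairings in extensions. -/

section Exact

variable {k B M M' M'' : Type*} [Field k] [Ring B] [Algebra k B] {𝒜 : ℕ → Submodule k B}
  [GradedAlgebra 𝒜]
  [AddCommGroup M] [Module k M] [Module Bᵐᵒᵖ M] [IsScalarTower k Bᵐᵒᵖ M]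
  [AddCommGroup M'] [Module k M'] [Module Bᵐᵒᵖ M'] [IsScalarTower k Bᵐᵒᵖ M']
  [AddCommGroup M''] [Module k M''] [Module Bᵐᵒᵖ M''] [IsScalarTower k Bᵐᵒᵖ M'']
  {ℳ : ℤ → Submodule k M} {ℳ' : ℤ → Submodule k M'} {ℳ'' : ℤ → Submodule k M''}

/-- Precomposition of cochains with values in `B` with a linear map of modules. -/
def pull (α : M' →ₗ[k] M) (i : ℕ) : (M → (Fin i → B) → B) →ₗ[k] (M' → (Fin i → B) → B) :=
  barPull α (AlgHom.id k B) LinearMap.id i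

theorem pull_mem_homCochain {α : M' →ₗ[k] M} (s : ℤ) (hα : ∀ d, ∀ m ∈ ℳ' d, α m ∈ ℳ (d + s))
    {i : ℕ} {ℓ : ℤ} {f : M → (Fin i → B) → B} (hf : f ∈ homCochain 𝒜 ℳ (zdeg 𝒜) i ℓ) :
    pull α i f ∈ homCochain 𝒜 ℳ' (zdeg 𝒜) i (ℓ + s) := by
  have := barPull_mem_homCochain (ℳ := ℳ) (𝒩' := zdeg 𝒜) α (AlgHom.id k B) LinearMap.id s 0 hα
    (fun _ _ h => h) (fun _ _ h => by rwa [add_zero]) i ℓ f hf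
  rwa [add_zero] at this

theorem pull_mem_cochains {α : M' →ₗ[k] M} (s : ℤ) (hα : ∀ d, ∀ m ∈ ℳ' d, α m ∈ ℳ (d + s))
    {i : ℕ} {f : M → (Fin i → B) → B} (hf : f ∈ cochains 𝒜 ℳ (zdeg 𝒜) i) :
    pull α i f ∈ cochains 𝒜 ℳ' (zdeg 𝒜) i :=
  barPull_cochains_le (ℳ := ℳ) (𝒩' := zdeg 𝒜) α (AlgHom.id k B) LinearMap.id s 0 hα
    (fun _ _ h => h) (fun _ _ h => by rwa [add_zero]) i hf

theorem barD_pull {α : M' →ₗ[k] M}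
    (hα : ∀ (b : B) (m : M'), α (MulOpposite.op b • m) = MulOpposite.op b • α m)
    (i : ℕ) (f : M → (Fin i → B) → B) : barD k i (pull α i f) = pull α (i + 1) (barD k i f) :=
  barD_barPull α (AlgHom.id k B) LinearMap.id hα (fun _ _ => rfl) i f

theorem pull_mem_cocycles {α : M' →ₗ[k] M}
    (hα : ∀ (b : B) (m : M'), α (MulOpposite.op b • m) = MulOpposite.op b • α m) {i : ℕ}
    (hc : ∀ f ∈ cochains 𝒜 ℳ (zdeg 𝒜) i, pull α i f ∈ cochains 𝒜 ℳ' (zdeg 𝒜) i)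
    {f : M → (Fin i → B) → B} (hf : f ∈ cocycles 𝒜 ℳ (zdeg 𝒜) i) :
    pull α i f ∈ cocycles 𝒜 ℳ' (zdeg 𝒜) i := by
  refine ⟨hc f hf.1, ?_⟩
  show barD k i _ = 0
  rw [barD_pull hα, show barD k i f = 0 from hf.2, map_zero]

theorem pull_mem_coboundaries {α : M' →ₗ[k] M}
    (hα : ∀ (b : B) (m : M'), α (MulOpposite.op b • m) = MulOpposite.op b • α m)
    (hc : ∀ i, ∀ f ∈ cochains 𝒜 ℳ (zdeg 𝒜) i, pull α i f ∈ cochains 𝒜 ℳ' (zdeg 𝒜) i) :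
    ∀ {i : ℕ} {f : M → (Fin i → B) → B}, f ∈ coboundaries 𝒜 ℳ (zdeg 𝒜) i →
    pull α i f ∈ coboundaries 𝒜 ℳ' (zdeg 𝒜) i
  | 0, f, hf => by
    rw [show f = 0 from hf, map_zero]; exact Submodule.zero_mem _
  | i + 1, _, ⟨h, hh, e⟩ => by
    rw [← e, ← barD_pull hα]
    exact ⟨_, hc i h hh, rfl⟩

theorem barD_eq_zero_of_mem_coboundaries : ∀ {i : ℕ} {f : M → (Fin i → B) → B},
    f ∈ coboundaries 𝒜 ℳ (zdeg 𝒜) i → barD k i f = 0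
  | 0, f, hf => by rw [show f = 0 from hf, map_zero]
  | i + 1, _, ⟨h, _, e⟩ => by rw [← e, barD_barD]

/-- `Ext^i_B(M, B) = 0`. -/
def ExtVanishes (𝒜 : ℕ → Submodule k B) (ℳ : ℤ → Submodule k M) (i : ℕ) : Prop :=
  cocycles 𝒜 ℳ (zdeg 𝒜) i ≤ coboundaries 𝒜 ℳ (zdeg 𝒜) i

theorem extVanishes_of_subsingleton_gExt {i : ℕ} (h : Subsingleton (GExt 𝒜 ℳ (zdeg 𝒜) i)) :
    ExtVanishes 𝒜 ℳ i := fun f hf =>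
  (Submodule.Quotient.mk_eq_zero ((coboundaries 𝒜 ℳ (zdeg 𝒜) i).submoduleOf
    (cocycles 𝒜 ℳ (zdeg 𝒜) i)) (x := ⟨f, hf⟩)).1 (Subsingleton.elim _ _)

theorem extVanishes_of_subsingleton [Subsingleton M] (i : ℕ) : ExtVanishes 𝒜 ℳ i := fun f hf => by
  have : f = 0 := by
    funext m b
    rw [Subsingleton.elim m 0]
    exact (isMultilinear_of_mem_cochains hf.1).map_zero b
  rw [this]
  exact Submodule.zero_mem _

/-- `0 → M' → M → M'' → 0`, with maps `ι` of degree `d` and `π` of degree `0`, is an exact sequence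
of graded right modules that is split over `k` by `ρ` and `s`. -/
structure IsSplitExact (ℳ' : ℤ → Submodule k M') (ℳ : ℤ → Submodule k M)
    (ℳ'' : ℤ → Submodule k M'') (ι : M' →ₗ[k] M) (ρ : M →ₗ[k] M') (π : M →ₗ[k] M'')
    (s : M'' →ₗ[k] M) (d : ℤ) : Prop where
  ι_op : ∀ (b : B) (m : M'), ι (MulOpposite.op b • m) = MulOpposite.op b • ι m
  π_op : ∀ (b : B) (m : M), π (MulOpposite.op b • m) = MulOpposite.op b • π m
  ι_mem : ∀ e, ∀ m ∈ ℳ' e, ι m ∈ ℳ (e + d)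
  ρ_mem : ∀ e, ∀ m ∈ ℳ e, ρ m ∈ ℳ' (e + -d)
  π_mem : ∀ e, ∀ m ∈ ℳ e, π m ∈ ℳ'' (e + 0)
  s_mem : ∀ e, ∀ m ∈ ℳ'' e, s m ∈ ℳ (e + 0)
  ρ_ι : ∀ m, ρ (ι m) = m
  π_s : ∀ m, π (s m) = m
  add : ∀ m, ι (ρ m) + s (π m) = m

namespace IsSplitExact

variable {ι : M' →ₗ[k] M} {ρ : M →ₗ[k] M'} {π : M →ₗ[k] M''} {s : M'' →ₗ[k] M} {d : ℤ}

theorem π_ι (E : IsSplitExact (B := B) ℳ' ℳ ℳ'' ι ρ π s d) (m : M') : π (ι m) = 0 := by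
  have h := congrArg π (E.add (ι m))
  rwa [E.ρ_ι, map_add, E.π_s, add_eq_left] at h

theorem pull_π_injective (E : IsSplitExact (B := B) ℳ' ℳ ℳ'' ι ρ π s d) {i : ℕ} :
    Function.Injective (pull (B := B) π i) := by
  intro u v h
  funext m b
  have := congrFun (congrFun h (s m)) b
  change u (π (s m)) b = v (π (s m)) b at this
  rwa [E.π_s] at this

theorem pull_ι_pull_ρ (E : IsSplitExact (B := B) ℳ' ℳ ℳ'' ι ρ π s d) {i : ℕ}
    (f : M' → (Fin i → B) → B) : pull ι i (pull ρ i f) = f := by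
  funext m b
  show f (ρ (ι m)) b = _
  rw [E.ρ_ι]

theorem pull_ι_pull_π (E : IsSplitExact (B := B) ℳ' ℳ ℳ'' ι ρ π s d) {i : ℕ}
    {f : M'' → (Fin i → B) → B} (hf : IsMultilinear k f) : pull ι i (pull π i f) = 0 := by
  funext m b
  show f (π (ι m)) b = _
  rw [E.π_ι, hf.map_zero]
  rfl

theorem pull_π_mem (E : IsSplitExact (B := B) ℳ' ℳ ℳ'' ι ρ π s d) (i : ℕ) :
    ∀ f ∈ cochains 𝒜 ℳ'' (zdeg 𝒜) i, pull π i f ∈ cochains 𝒜 ℳ (zdeg 𝒜) i :=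
  fun _ hf => pull_mem_cochains 0 E.π_mem hf

theorem pull_ι_mem (E : IsSplitExact (B := B) ℳ' ℳ ℳ'' ι ρ π s d) (i : ℕ) :
    ∀ f ∈ cochains 𝒜 ℳ (zdeg 𝒜) i, pull ι i f ∈ cochains 𝒜 ℳ' (zdeg 𝒜) i :=
  fun _ hf => pull_mem_cochains d E.ι_mem hf

/-- As `m = ι (ρ m) + s (π m)` and `f` vanishes on the image of `ι`, `f` is the pullback along `π`
of its own restriction along `s`. -/
theorem descend (E : IsSplitExact (B := B) ℳ' ℳ ℳ'' ι ρ π s d) {i : ℕ}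
    {f : M → (Fin i → B) → B} (hf : f ∈ cochains 𝒜 ℳ (zdeg 𝒜) i)
    (h0 : pull ι i f = 0) : ∃ u ∈ cochains 𝒜 ℳ'' (zdeg 𝒜) i, pull π i u = f := by
  refine ⟨pull s i f, pull_mem_cochains 0 E.s_mem hf, ?_⟩
  funext m b
  have h1 := (isMultilinear_of_mem_cochains hf).add (ι (ρ m)) (s (π m)) b
  rw [E.add, show f (ι (ρ m)) b = 0 from congrFun (congrFun h0 (ρ m)) b, zero_add] at h1
  exact h1.symm

theorem descend_cocycle (E : IsSplitExact (B := B) ℳ' ℳ ℳ'' ι ρ π s d) {i : ℕ}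
    {f : M → (Fin i → B) → B} (hf : f ∈ cocycles 𝒜 ℳ (zdeg 𝒜) i)
    (h0 : pull ι i f = 0) : ∃ u ∈ cocycles 𝒜 ℳ'' (zdeg 𝒜) i, pull π i u = f := by
  obtain ⟨u, hu, rfl⟩ := E.descend hf.1 h0
  refine ⟨u, ⟨hu, E.pull_π_injective ?_⟩, rfl⟩
  rw [← barD_pull E.π_op, map_zero]
  exact hf.2

/-- A primitive on `M'` is extended to `M` by the retraction `ρ`. That `ρ` is only `k`-linear does
no harm: the differential is taken on `M` and restricted along the right linear `ι`. -/
theorem exists_coboundary (E : IsSplitExact (B := B) ℳ' ℳ ℳ'' ι ρ π s d) : ∀ {i : ℕ}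
    {f : M' → (Fin i → B) → B}, f ∈ coboundaries 𝒜 ℳ' (zdeg 𝒜) i →
    ∃ c ∈ coboundaries 𝒜 ℳ (zdeg 𝒜) i, pull ι i c = f
  | 0, f, hf => ⟨0, Submodule.zero_mem _, by rw [map_zero, show f = 0 from hf]⟩
  | i + 1, f, ⟨h, hh, e⟩ => by
    refine ⟨barD k i (pull ρ i h), ⟨_, pull_mem_cochains (-d) E.ρ_mem hh, rfl⟩, ?_⟩
    rw [← barD_pull E.ι_op, E.pull_ι_pull_ρ, e]

/-- Exactness of `Ext^i(M'', B) → Ext^i(M, B) → Ext^i(M', B)` in the middle. -/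
theorem cocycle_reduce (E : IsSplitExact (B := B) ℳ' ℳ ℳ'' ι ρ π s d) (hM : IsGradedAction 𝒜 ℳ)
    {i : ℕ} {f : M → (Fin i → B) → B} (hf : f ∈ cocycles 𝒜 ℳ (zdeg 𝒜) i)
    (h : pull ι i f ∈ coboundaries 𝒜 ℳ' (zdeg 𝒜) i) :
    ∃ u ∈ cocycles 𝒜 ℳ'' (zdeg 𝒜) i, f - pull π i u ∈ coboundaries 𝒜 ℳ (zdeg 𝒜) i := by
  obtain ⟨c, hc, hcf⟩ := E.exists_coboundary h
  have hc' := coboundaries_le_cocycles (isGradedAction_zdeg 𝒜) hM (isGradedAction_zdeg 𝒜) i hc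
  obtain ⟨u, hu, huf⟩ := E.descend_cocycle (Submodule.sub_mem _ hf hc')
    (by rw [map_sub, hcf, sub_self])
  exact ⟨u, hu, by rwa [huf, sub_sub_cancel]⟩

theorem extVanishes (E : IsSplitExact (B := B) ℳ' ℳ ℳ'' ι ρ π s d) (hM : IsGradedAction 𝒜 ℳ)
    {i : ℕ} (h' : ExtVanishes 𝒜 ℳ' i) (h'' : ExtVanishes 𝒜 ℳ'' i) : ExtVanishes 𝒜 ℳ i := by
  intro f hf
  obtain ⟨u, hu, huf⟩ := E.cocycle_reduce hM hf
    (h' (pull_mem_cocycles E.ι_op (E.pull_ι_mem i) hf))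
  have := pull_mem_coboundaries E.π_op E.pull_π_mem (h'' hu)
  simpa using Submodule.add_mem _ huf this

/-- Surjectivity of `Ext^i(M, B) → Ext^i(M', B)` on cocycles. The differential of the extension of
`f` by `ρ` vanishes on `M'`, so it descends to a cocycle on `M''` (the connecting class); a
primitive of that corrects the extension. -/
theorem exists_cocycle (E : IsSplitExact (B := B) ℳ' ℳ ℳ'' ι ρ π s d) (hM : IsGradedAction 𝒜 ℳ)
    {i : ℕ} (h'' : ExtVanishes 𝒜 ℳ'' (i + 1)) {f : M' → (Fin i → B) → B}
    (hf : f ∈ cocycles 𝒜 ℳ' (zdeg 𝒜) i) :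
    ∃ g ∈ cocycles 𝒜 ℳ (zdeg 𝒜) i, pull ι i g = f := by
  have hρ : pull ρ i f ∈ cochains 𝒜 ℳ (zdeg 𝒜) i := pull_mem_cochains (-d) E.ρ_mem hf.1
  have hd : barD k i (pull ρ i f) ∈ cocycles 𝒜 ℳ (zdeg 𝒜) (i + 1) :=
    ⟨barD_mem_cochains (isGradedAction_zdeg 𝒜) hM (isGradedAction_zdeg 𝒜) hρ, barD_barD _ _⟩
  obtain ⟨u, hu, hud⟩ := E.descend_cocycle hd (by
    rw [← barD_pull E.ι_op, E.pull_ι_pull_ρ]; exact hf.2)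
  obtain ⟨v, hv, rfl⟩ := h'' hu
  refine ⟨pull ρ i f - pull π i v, ⟨Submodule.sub_mem _ hρ (E.pull_π_mem i v hv), ?_⟩, ?_⟩
  · show barD k i _ = 0
    rw [map_sub, barD_pull E.π_op, hud, sub_self]
  · rw [map_sub, E.pull_ι_pull_ρ, E.pull_ι_pull_π (isMultilinear_of_mem_cochains hv), sub_zero]

/-- Injectivity of `Ext^i(M'', B) → Ext^i(M, B)`. A primitive on `M` restricts to a cocycle on `M'`,
which is a coboundary; subtracting an extension of it makes the primitive descend to `M''`. The
condition `j + 1 = i` asks for nothing when `i = 0`, where pullback along `π` is injective on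
cochains. -/
theorem mem_coboundaries_of_pull (E : IsSplitExact (B := B) ℳ' ℳ ℳ'' ι ρ π s d)
    (hM : IsGradedAction 𝒜 ℳ) :
    ∀ {i : ℕ}, (∀ j, j + 1 = i → ExtVanishes 𝒜 ℳ' j) →
    ∀ {u : M'' → (Fin i → B) → B}, u ∈ cocycles 𝒜 ℳ'' (zdeg 𝒜) i →
    pull π i u ∈ coboundaries 𝒜 ℳ (zdeg 𝒜) i → u ∈ coboundaries 𝒜 ℳ'' (zdeg 𝒜) i
  | 0, _, u, _, h => E.pull_π_injective (by rw [map_zero]; exact h)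
  | i + 1, h', u, hu, ⟨h, hh, hhu⟩ => by
    have hι : pull ι i h ∈ cocycles 𝒜 ℳ' (zdeg 𝒜) i := by
      refine ⟨E.pull_ι_mem i h hh, ?_⟩
      show barD k i _ = 0
      rw [barD_pull E.ι_op, hhu, E.pull_ι_pull_π (isMultilinear_of_mem_cochains hu.1)]
    obtain ⟨c, hc, hch⟩ := E.exists_coboundary (h' i rfl hι)
    have hc' : c ∈ cochains 𝒜 ℳ (zdeg 𝒜) i :=
      (coboundaries_le_cocycles (isGradedAction_zdeg 𝒜) hM (isGradedAction_zdeg 𝒜) i hc).1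
    obtain ⟨v, hv, hvh⟩ := E.descend (Submodule.sub_mem _ hh hc') (by rw [map_sub, hch, sub_self])
    refine ⟨v, hv, E.pull_π_injective ?_⟩
    rw [← barD_pull E.π_op, hvh, map_sub, barD_eq_zero_of_mem_coboundaries hc, sub_zero, hhu]

end IsSplitExact

/-- The map `B / B_{≥ r} → M`, `x ↦ m x`, for a module `M` with `M B_{≥ r} = 0`. -/
def orbit {r : ℕ} (hr : ∀ x ∈ geq 𝒜 r, ∀ m : M, MulOpposite.op x • m = 0) (m : M) :
    Quo 𝒜 r →ₗ[k] M :=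
  ((geqR 𝒜 r).liftQ
    { toFun := fun x => MulOpposite.op x • m
      map_add' := fun x y => by rw [MulOpposite.op_add, add_smul]
      map_smul' := fun c x => by
        rw [RingHom.id_apply, ← mul_smul]; rfl } fun x hx => hr x hx m).restrictScalars k

theorem orbit_op {r : ℕ} (hr : ∀ x ∈ geq 𝒜 r, ∀ m : M, MulOpposite.op x • m = 0) (m : M)
    (b : B) (x : Quo 𝒜 r) :
    orbit (k := k) hr m (MulOpposite.op b • x) = MulOpposite.op b • orbit (k := k) hr m x :=
  LinearMap.map_smul (_ : Quo 𝒜 r →ₗ[Bᵐᵒᵖ] M) (MulOpposite.op b) x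

theorem orbit_add {r : ℕ} (hr : ∀ x ∈ geq 𝒜 r, ∀ m : M, MulOpposite.op x • m = 0) (m m' : M)
    (x : Quo 𝒜 r) :
    orbit (k := k) hr (m + m') x = orbit (k := k) hr m x + orbit (k := k) hr m' x := by
  obtain ⟨x⟩ := x
  exact smul_add _ _ _

theorem orbit_smul {r : ℕ} (hr : ∀ x ∈ geq 𝒜 r, ∀ m : M, MulOpposite.op x • m = 0) (c : k) (m : M)
    (x : Quo 𝒜 r) : orbit (k := k) hr (c • m) x = c • orbit (k := k) hr m x := by
  obtain ⟨x⟩ := x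
  exact op_smul_smul_comm _ _ _

theorem comp_orbit {r : ℕ} (hr : ∀ x ∈ geq 𝒜 r, ∀ m : M, MulOpposite.op x • m = 0)
    (hr' : ∀ x ∈ geq 𝒜 r, ∀ m : M', MulOpposite.op x • m = 0) {α : M' →ₗ[k] M}
    (hα : ∀ (b : B) (m : M'), α (MulOpposite.op b • m) = MulOpposite.op b • α m) (m : M')
    (x : Quo 𝒜 r) : α (orbit (k := k) hr' m x) = orbit (k := k) hr (α m) x := by
  obtain ⟨x⟩ := x
  exact hα x m

theorem pull_orbit_add {r : ℕ} (hr : ∀ x ∈ geq 𝒜 r, ∀ m : M, MulOpposite.op x • m = 0) {i : ℕ}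
    {f : M → (Fin i → B) → B} (hf : IsMultilinear k f) (m m' : M) :
    pull (orbit (k := k) hr (m + m')) i f = pull (orbit hr m) i f + pull (orbit hr m') i f := by
  funext x b
  show f (orbit (k := k) hr (m + m') x) b = _
  rw [orbit_add, hf.add]
  rfl

theorem pull_orbit_smul {r : ℕ} (hr : ∀ x ∈ geq 𝒜 r, ∀ m : M, MulOpposite.op x • m = 0) {i : ℕ}
    {f : M → (Fin i → B) → B} (hf : IsMultilinear k f) (c : k) (m : M) :
    pull (orbit (k := k) hr (c • m)) i f = c • pull (orbit hr m) i f := by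
  funext x b
  show f (orbit (k := k) hr (c • m) x) b = _
  rw [orbit_smul, hf.smul]
  rfl

/-- For `m` of degree `p` the map `x ↦ m x` has degree `p`; a general `m` is a sum of homogeneous
ones, and the pullback is additive in `m`. -/
theorem pull_orbit_mem_cochains {r : ℕ} (hr : ∀ x ∈ geq 𝒜 r, ∀ m : M, MulOpposite.op x • m = 0)
    (hM : IsGradedAction 𝒜 ℳ) (htop : ⨆ d, ℳ d = ⊤) {i : ℕ} {f : M → (Fin i → B) → B}
    (hf : f ∈ cochains 𝒜 ℳ (zdeg 𝒜) i) (m : M) :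
    pull (orbit hr m) i f ∈ cochains 𝒜 (quoDeg 𝒜 r) (zdeg 𝒜) i := by
  have hl := isMultilinear_of_mem_cochains hf
  have hm : m ∈ ⨆ p, ℳ p := htop ▸ Submodule.mem_top
  induction hm using Submodule.iSup_induction' with
  | zero =>
    have := pull_orbit_smul hr hl 0 0
    rw [zero_smul, zero_smul] at this
    rw [this]
    exact Submodule.zero_mem _
  | add m m' _ _ hm hm' =>
    rw [pull_orbit_add hr hl]
    exact Submodule.add_mem _ hm hm'
  | mem p m hm =>
    refine pull_mem_cochains p ?_ hf
    rintro d _ ⟨x, hx, rfl⟩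
    rcases d with d | d
    · have := hM p d m x hm hx
      rwa [add_comm] at this
    · rw [show x = 0 from hx, map_zero, map_zero]
      exact Submodule.zero_mem _

/-- The functional `m ↦ T (f ∘ (x ↦ m x))` on `M` given by a cochain `f` and a functional `T` on
the cochains of `B / B_{≥ r}`. -/
def evalFunctional {r i : ℕ} (T : (Quo 𝒜 r → (Fin i → B) → B) →ₗ[k] k)
    (hr : ∀ x ∈ geq 𝒜 r, ∀ m : M, MulOpposite.op x • m = 0) {f : M → (Fin i → B) → B}
    (hf : IsMultilinear k f) : M →ₗ[k] k where
  toFun m := T (pull (orbit hr m) i f)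
  map_add' m m' := by rw [pull_orbit_add hr hf, map_add]
  map_smul' c m := by rw [pull_orbit_smul hr hf, map_smul, RingHom.id_apply]

/-- The pairing of `Ext^i_B(M, B)` with `M` given by a functional `T` is perfect. -/
structure IsPerfect {r : ℕ} (ℳ : ℤ → Submodule k M) (i : ℕ)
    (T : (Quo 𝒜 r → (Fin i → B) → B) →ₗ[k] k)
    (hr : ∀ x ∈ geq 𝒜 r, ∀ m : M, MulOpposite.op x • m = 0) : Prop where
  inj : ∀ f ∈ cocycles 𝒜 ℳ (zdeg 𝒜) i, (∀ m, T (pull (orbit hr m) i f) = 0) →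
    f ∈ coboundaries 𝒜 ℳ (zdeg 𝒜) i
  surj : ∀ φ : M →ₗ[k] k, ∃ f ∈ cocycles 𝒜 ℳ (zdeg 𝒜) i, ∀ m, T (pull (orbit hr m) i f) = φ m

theorem pull_pull_orbit {r : ℕ} (hr : ∀ x ∈ geq 𝒜 r, ∀ m : M, MulOpposite.op x • m = 0)
    (hr' : ∀ x ∈ geq 𝒜 r, ∀ m : M', MulOpposite.op x • m = 0) {α : M' →ₗ[k] M}
    (hα : ∀ (b : B) (m : M'), α (MulOpposite.op b • m) = MulOpposite.op b • α m) (m : M') (i : ℕ)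
    (f : M → (Fin i → B) → B) :
    pull (orbit hr' m) i (pull α i f) = pull (orbit hr (α m)) i f := by
  funext x b
  show f (α (orbit (k := k) hr' m x)) b = _
  rw [comp_orbit hr hr' hα]
  rfl

theorem IsPerfect.of_subsingleton [Subsingleton M] {r i : ℕ}
    (T : (Quo 𝒜 r → (Fin i → B) → B) →ₗ[k] k)
    (hr : ∀ x ∈ geq 𝒜 r, ∀ m : M, MulOpposite.op x • m = 0) : IsPerfect ℳ i T hr := by
  refine ⟨fun f hf _ => extVanishes_of_subsingleton i hf, fun φ => ⟨0, Submodule.zero_mem _, ?_⟩⟩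
  intro m
  rw [map_zero, map_zero, Subsingleton.elim m 0, map_zero]

/-- The five lemma for the pairings of `M'`, `M`, `M''`. Because `T` kills coboundaries, the pairing
depends only on the class of a cocycle. Only surjectivity uses the vanishing of `Ext^{i+1}(M'', B)`,
to lift cocycles from `M'` to `M`. -/
theorem IsSplitExact.isPerfect {ι : M' →ₗ[k] M} {ρ : M →ₗ[k] M'} {π : M →ₗ[k] M''}
    {s : M'' →ₗ[k] M} {d : ℤ} (E : IsSplitExact (B := B) ℳ' ℳ ℳ'' ι ρ π s d)
    (hM : IsGradedAction 𝒜 ℳ) (htop : ⨆ d, ℳ d = ⊤) {r i : ℕ}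
    {T : (Quo 𝒜 r → (Fin i → B) → B) →ₗ[k] k}
    (hT : ∀ f ∈ coboundaries 𝒜 (quoDeg 𝒜 r) (zdeg 𝒜) i, T f = 0)
    {hr : ∀ x ∈ geq 𝒜 r, ∀ m : M, MulOpposite.op x • m = 0}
    {hr' : ∀ x ∈ geq 𝒜 r, ∀ m : M', MulOpposite.op x • m = 0}
    {hr'' : ∀ x ∈ geq 𝒜 r, ∀ m : M'', MulOpposite.op x • m = 0}
    (hv : ExtVanishes 𝒜 ℳ'' (i + 1)) (h' : IsPerfect ℳ' i T hr') (h'' : IsPerfect ℳ'' i T hr'') :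
    IsPerfect ℳ i T hr := by
  have hc : ∀ f ∈ coboundaries 𝒜 ℳ (zdeg 𝒜) i, ∀ m, T (pull (orbit hr m) i f) = 0 :=
    fun f hf m => hT _ (pull_mem_coboundaries (orbit_op hr m)
      (fun i f hf => pull_orbit_mem_cochains hr hM htop hf m) hf)
  refine ⟨fun f hf h0 => ?_, fun φ => ?_⟩
  · obtain ⟨u, hu, huf⟩ := E.cocycle_reduce hM hf (h'.inj _
      (pull_mem_cocycles E.ι_op (E.pull_ι_mem i) hf) fun m => by
        rw [pull_pull_orbit hr hr' E.ι_op, h0])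
    -- Modulo coboundaries `f` is the pullback of `u`, so pairing `f` with `s m` computes the
    -- pairing of `u` with `m`.
    have : u ∈ coboundaries 𝒜 ℳ'' (zdeg 𝒜) i := h''.inj u hu fun m => by
      have := hc _ huf (s m)
      rwa [map_sub, map_sub, h0, pull_pull_orbit hr'' hr E.π_op, E.π_s, zero_sub,
        neg_eq_zero] at this
    simpa using Submodule.add_mem _ huf (pull_mem_coboundaries E.π_op E.pull_π_mem this)
  · obtain ⟨f', hf', hφ'⟩ := h'.surj (φ ∘ₗ ι)
    obtain ⟨g, hg, rfl⟩ := E.exists_cocycle hM hv hf'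
    have hl := isMultilinear_of_mem_cochains hg.1
    -- The lift `g` already represents `φ` on the image of `ι`, so the error is determined by its
    -- restriction along `s` and is corrected by a cocycle from `M''`.
    obtain ⟨u, hu, hφ''⟩ := h''.surj ((φ - evalFunctional T hr hl) ∘ₗ s)
    refine ⟨g + pull π i u, Submodule.add_mem _ hg
      (pull_mem_cocycles E.π_op (E.pull_π_mem i) hu), fun m => ?_⟩
    rw [map_add, map_add, pull_pull_orbit hr'' hr E.π_op, hφ'', LinearMap.comp_apply,
      LinearMap.sub_apply]
    have h1 : evalFunctional T hr hl (ι (ρ m)) = φ (ι (ρ m)) := by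
      rw [← LinearMap.comp_apply φ, ← hφ', pull_pull_orbit hr hr' E.ι_op]
      rfl
    have h2 : evalFunctional T hr hl m = evalFunctional T hr hl (ι (ρ m))
        + evalFunctional T hr hl (s (π m)) := by rw [← map_add, E.add]
    have h3 : φ m = φ (ι (ρ m)) + φ (s (π m)) := by rw [← map_add, E.add]
    rw [show T (pull (orbit hr m) i g) = evalFunctional T hr hl m from rfl, h2, h1, h3]
    ring

end Exact

/-! ### Graded submodules and quotients, homogeneous socle vectors, truncations `B / B_{≥ r}`. -/

section Quotient

variable {k B M X : Type*} [Field k] [Ring B] [Algebra k B] {𝒜 : ℕ → Submodule k B}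
  [GradedAlgebra 𝒜]
  [AddCommGroup M] [Module k M] [Module Bᵐᵒᵖ M] [IsScalarTower k Bᵐᵒᵖ M]
  [AddCommGroup X] [Module k X]
  {ℳ : ℤ → Submodule k M}

/-- `ℳ` is a grading of the right `B`-module `M`. -/
structure IsGradedModule (𝒜 : ℕ → Submodule k B) (ℳ : ℤ → Submodule k M) : Prop where
  act : IsGradedAction 𝒜 ℳ
  exists_proj : ∃ p, IsGradingProj ℳ p

theorem IsGradedModule.iSup_eq_top (h : IsGradedModule 𝒜 ℳ) : ⨆ d, ℳ d = ⊤ :=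
  h.exists_proj.choose_spec.iSup_eq_top

/-- A `k`-linear map from the quotient by a `Bᵐᵒᵖ`-submodule. -/
def liftK (L : Submodule Bᵐᵒᵖ M) (f : M →ₗ[k] X) (h : ∀ x ∈ L, f x = 0) : (M ⧸ L) →ₗ[k] X :=
  (L.restrictScalars k).liftQ f h ∘ₗ (Submodule.Quotient.restrictScalarsEquiv k L).symm.toLinearMap

/-- The projection to the quotient by a `Bᵐᵒᵖ`-submodule as a `k`-linear map. -/
abbrev mkK (k : Type*) {B M : Type*} [Field k] [Ring B] [Algebra k B] [AddCommGroup M] [Module k M]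
    [Module Bᵐᵒᵖ M] [IsScalarTower k Bᵐᵒᵖ M] (L : Submodule Bᵐᵒᵖ M) : M →ₗ[k] (M ⧸ L) :=
  L.mkQ.restrictScalars k

theorem isGradedModule_quotient (hM : IsGradedAction 𝒜 ℳ) {p : ℤ → M →ₗ[k] M}
    (hp : IsGradingProj ℳ p) (L : Submodule Bᵐᵒᵖ M) (hL : ∀ d, ∀ m ∈ L, p d m ∈ L) :
    IsGradedModule 𝒜 fun d => (ℳ d).map (mkK k L) := by
  refine ⟨?_, fun d => liftK L (mkK k L ∘ₗ p d) fun x hx =>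
    (Submodule.Quotient.mk_eq_zero L).2 (hL d x hx), ?_, ?_, ?_, ?_⟩
  · rintro e q _ b ⟨m, hm, rfl⟩ hb
    exact ⟨_, hM e q m b hm hb, rfl⟩
  · rintro d ⟨m⟩
    exact ⟨_, hp.mem d m, rfl⟩
  · rintro d _ ⟨m, hm, rfl⟩
    exact congrArg (mkK k L) (hp.self d m hm)
  · rintro d e _ ⟨m, hm, rfl⟩ hne
    exact (congrArg (mkK k L) (hp.ne d e m hm hne)).trans (map_zero _)
  · rintro ⟨m⟩
    obtain ⟨s, hs⟩ := hp.sum m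
    refine ⟨s, ?_⟩
    conv_rhs => rw [← hs]
    exact (map_sum (mkK k L) _ _).symm

theorem isGradedModule_submodule (hM : IsGradedAction 𝒜 ℳ) {p : ℤ → M →ₗ[k] M}
    (hp : IsGradingProj ℳ p) (L : Submodule Bᵐᵒᵖ M) (hL : ∀ d, ∀ m ∈ L, p d m ∈ L) :
    IsGradedModule 𝒜 fun d => (ℳ d).comap (L.subtype.restrictScalars k) := by
  refine ⟨?_, fun d => ((p d).restrict (p := L.restrictScalars k)
    (q := L.restrictScalars k) (hL d) : L →ₗ[k] L),
    ?_, ?_, ?_, ?_⟩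
  · rintro e q m b hm hb
    exact hM e q m b hm hb
  · exact fun d m => hp.mem d m
  · exact fun d m hm => Subtype.ext (hp.self d m hm)
  · exact fun d e m hm hne => Subtype.ext (hp.ne d e m hm hne)
  · intro m
    obtain ⟨s, hs⟩ := hp.sum m
    refine ⟨s, Subtype.ext ?_⟩
    conv_rhs => rw [← hs]
    exact map_sum (L.subtype.restrictScalars k) _ _

theorem smul_eq_zero_of_mem_geq {r : ℕ} {m : M}
    (h : ∀ i, r ≤ i → ∀ b ∈ 𝒜 i, MulOpposite.op b • m = 0) :
    ∀ x ∈ geq 𝒜 r, MulOpposite.op x • m = 0 := fun x hx => by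
  induction hx using Submodule.iSup_induction' with
  | zero => rw [MulOpposite.op_zero, zero_smul]
  | add x y _ _ hx hy => rw [MulOpposite.op_add, add_smul, hx, hy, add_zero]
  | mem i x hx => exact h i.1 i.2 x hx

theorem mem_geq_of_mem {r i : ℕ} (h : r ≤ i) {x : B} (hx : x ∈ 𝒜 i) : x ∈ geq 𝒜 r :=
  Submodule.mem_iSup_of_mem (⟨i, h⟩ : {i : ℕ // r ≤ i}) hx

/-- If some `b` of positive degree does not kill `m`, then `m b` is a nonzero homogeneous element
annihilated already from one degree lower; this descent ends because `1 ∈ B_0` cannot kill `m`. -/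
theorem exists_homogeneous_socle (hM : IsGradedAction 𝒜 ℳ) (s : ℕ) : ∀ (d : ℤ), ∀ m ∈ ℳ d, m ≠ 0 →
    (∀ i, s ≤ i → ∀ b ∈ 𝒜 i, MulOpposite.op b • m = 0) →
    ∃ d, ∃ m ∈ ℳ d, m ≠ 0 ∧ ∀ i, 1 ≤ i → ∀ b ∈ 𝒜 i, MulOpposite.op b • m = 0 := by
  induction s with
  | zero =>
    intro d m hm h0 h
    exact absurd (by simpa using h 0 le_rfl 1 SetLike.GradedOne.one_mem) h0
  | succ s ih =>
    intro d m hm h0 h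
    by_cases h1 : ∀ i, 1 ≤ i → ∀ b ∈ 𝒜 i, MulOpposite.op b • m = 0
    · exact ⟨d, m, hm, h0, h1⟩
    · push Not at h1
      obtain ⟨i, hi, b, hb, hbm⟩ := h1
      refine ih _ _ (hM d i m b hm hb) hbm fun j hj c hc => ?_
      rw [← mul_smul, ← MulOpposite.op_mul]
      exact h (i + j) (by omega) _ (SetLike.mul_mem_graded hb hc)

/-- The sum of the components of degree less than `r`. -/
def trunc (𝒜 : ℕ → Submodule k B) [GradedAlgebra 𝒜] (r : ℕ) : B →ₗ[k] B :=
  ∑ i ∈ Finset.range r, GradedAlgebra.proj 𝒜 i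

theorem trunc_apply_of_mem {r i : ℕ} {x : B} (hx : x ∈ 𝒜 i) :
    trunc 𝒜 r x = if i < r then x else 0 := by
  rw [trunc, LinearMap.sum_apply]
  split_ifs with h
  · rw [Finset.sum_eq_single_of_mem i (Finset.mem_range.2 h)]
    · exact DirectSum.decompose_of_mem_same 𝒜 hx
    · intro j _ hj
      exact DirectSum.decompose_of_mem_ne 𝒜 hx hj.symm
  · refine Finset.sum_eq_zero fun j hj => DirectSum.decompose_of_mem_ne 𝒜 hx ?_
    rintro rfl
    exact h (Finset.mem_range.1 hj)

theorem trunc_of_mem_geq {r : ℕ} : ∀ x ∈ geq 𝒜 r, trunc 𝒜 r x = 0 := by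
  have : geq 𝒜 r ≤ LinearMap.ker (trunc 𝒜 r) := iSup_le fun i x hx => by
    rw [LinearMap.mem_ker, trunc_apply_of_mem hx, if_neg (not_lt.2 i.2)]
  exact fun x hx => this hx

theorem sub_trunc_mem_geq (r : ℕ) (x : B) : x - trunc 𝒜 r x ∈ geq 𝒜 r := by
  induction x using DirectSum.Decomposition.inductionOn 𝒜 with
  | zero => rw [map_zero, sub_zero]; exact Submodule.zero_mem _
  | add x y hx hy => rw [map_add, add_sub_add_comm]; exact Submodule.add_mem _ hx hy
  | @homogeneous i x =>
    rw [trunc_apply_of_mem x.2]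
    split_ifs with h
    · rw [sub_self]; exact Submodule.zero_mem _
    · rw [sub_zero]; exact mem_geq_of_mem (not_lt.1 h) x.2

theorem trunc_mem_zdeg (r : ℕ) (d : ℤ) {x : B} (hx : x ∈ zdeg 𝒜 d) : trunc 𝒜 r x ∈ zdeg 𝒜 d := by
  rcases d with d | d
  · rw [trunc_apply_of_mem hx]
    split_ifs
    · exact hx
    · exact Submodule.zero_mem _
  · rw [show x = 0 from hx, map_zero]; exact Submodule.zero_mem _

theorem isGradedModule_quoDeg (r : ℕ) : IsGradedModule 𝒜 (quoDeg 𝒜 r) :=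
  isGradedModule_quotient (isGradedAction_zdeg 𝒜) (isGradingProj_zproj 𝒜) (geqR 𝒜 r)
    fun d _ hm => zproj_mem_geq 𝒜 d hm

theorem quo_smul_eq_zero (r : ℕ) : ∀ x ∈ geq 𝒜 r, ∀ m : Quo 𝒜 r, MulOpposite.op x • m = 0 := by
  rintro x hx ⟨m⟩
  exact (Submodule.Quotient.mk_eq_zero _).2 (mul_mem_geq_left m hx)

theorem finiteDimensional_quo (h : ∀ d, FiniteDimensional k (𝒜 d)) (r : ℕ) :
    FiniteDimensional k (Quo 𝒜 r) := by
  let F : (∀ i : Fin r, 𝒜 i) →ₗ[k] Quo 𝒜 r :=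
    ∑ i : Fin r, mkK k (geqR 𝒜 r) ∘ₗ (𝒜 i).subtype ∘ₗ LinearMap.proj i
  refine Module.Finite.of_surjective F ?_
  rintro ⟨x⟩
  refine ⟨fun i => DirectSum.decompose 𝒜 x i, ?_⟩
  have h1 : F (fun i => DirectSum.decompose 𝒜 x i) = mkK k (geqR 𝒜 r) (trunc 𝒜 r x) := by
    simp only [F, LinearMap.sum_apply, LinearMap.comp_apply, trunc, map_sum]
    rw [Finset.sum_range]
    rfl
  rw [h1]
  refine ((Submodule.Quotient.eq _).2 ?_).symm
  exact sub_trunc_mem_geq r x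

/-- The kernel of `B / B_{≥ s} → B / B_{≥ r}`. -/
def quoKer (𝒜 : ℕ → Submodule k B) [GradedAlgebra 𝒜] (r s : ℕ) : Submodule Bᵐᵒᵖ (Quo 𝒜 s) :=
  (geqR 𝒜 r).map (geqR 𝒜 s).mkQ

/-- The grading of `quoKer`. -/
def quoKerDeg (𝒜 : ℕ → Submodule k B) [GradedAlgebra 𝒜] (r s : ℕ) (d : ℤ) :
    Submodule k (quoKer 𝒜 r s) :=
  (quoDeg 𝒜 s d).comap ((quoKer 𝒜 r s).subtype.restrictScalars k)

theorem isGradedModule_quoKerDeg (r s : ℕ) : IsGradedModule 𝒜 (quoKerDeg 𝒜 r s) := by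
  have h := isGradedModule_quoDeg (𝒜 := 𝒜) s
  obtain ⟨p, hp⟩ := h.exists_proj
  refine isGradedModule_submodule h.act hp (quoKer 𝒜 r s) ?_
  rintro d _ ⟨x, hx, rfl⟩
  refine ⟨zproj 𝒜 d x, zproj_mem_geq 𝒜 d hx, ?_⟩
  exact ((isGradingProj_zproj 𝒜).comp_eq hp (mkK k (geqR 𝒜 s)) (fun d x hx => ⟨x, hx, rfl⟩) d x).symm

/-- Truncation below degree `r` is a graded `k`-linear section of the projection; subtracting it
retracts onto the kernel. -/
theorem exists_isSplitExact_quoProj {r s : ℕ} (h : r ≤ s) :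
    ∃ (ι : quoKer 𝒜 r s →ₗ[k] Quo 𝒜 s) (ρ : Quo 𝒜 s →ₗ[k] quoKer 𝒜 r s)
      (σ : Quo 𝒜 r →ₗ[k] Quo 𝒜 s),
      IsSplitExact (B := B) (quoKerDeg 𝒜 r s) (quoDeg 𝒜 s) (quoDeg 𝒜 r) ι ρ (quoProj 𝒜 h) σ 0 := by
  let σ : Quo 𝒜 r →ₗ[k] Quo 𝒜 s := liftK (geqR 𝒜 r) (mkK k (geqR 𝒜 s) ∘ₗ trunc 𝒜 r) fun x hx => by
    rw [LinearMap.comp_apply, trunc_of_mem_geq x hx, map_zero]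
  let τ : Quo 𝒜 s →ₗ[k] Quo 𝒜 s := LinearMap.id - σ ∘ₗ quoProj 𝒜 h
  have hmem : ∀ x, τ x ∈ (quoKer 𝒜 r s).restrictScalars k := by
    rintro ⟨x⟩
    exact ⟨x - trunc 𝒜 r x, sub_trunc_mem_geq r x, rfl⟩
  have hσ : ∀ d, ∀ m ∈ quoDeg 𝒜 r d, σ m ∈ quoDeg 𝒜 s d := by
    rintro d _ ⟨x, hx, rfl⟩
    exact ⟨trunc 𝒜 r x, trunc_mem_zdeg r d hx, rfl⟩
  have hπ : ∀ d, ∀ m ∈ quoDeg 𝒜 s d, quoProj 𝒜 h m ∈ quoDeg 𝒜 r d := by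
    rintro d _ ⟨x, hx, rfl⟩
    exact ⟨x, hx, rfl⟩
  refine ⟨(quoKer 𝒜 r s).subtype.restrictScalars k,
    (τ.codRestrict _ hmem : Quo 𝒜 s →ₗ[k] quoKer 𝒜 r s), σ,
    ⟨fun _ _ => rfl, ?_, ?_, ?_, ?_, ?_, ?_, ?_, ?_⟩⟩
  · rintro b ⟨x⟩; rfl
  · intro e m hm; rw [add_zero]; exact hm
  · intro e m hm
    rw [neg_zero, add_zero]
    exact Submodule.sub_mem _ hm (hσ e _ (hπ e m hm))
  · intro e m hm; rw [add_zero]; exact hπ e m hm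
  · intro e m hm; rw [add_zero]; exact hσ e m hm
  · rintro ⟨_, x, hx, rfl⟩
    refine Subtype.ext ?_
    show (geqR 𝒜 s).mkQ x - (geqR 𝒜 s).mkQ (trunc 𝒜 r x) = (geqR 𝒜 s).mkQ x
    rw [trunc_of_mem_geq x hx, map_zero, sub_zero]
  · rintro ⟨x⟩
    refine (Submodule.Quotient.eq _).2 ?_
    show trunc 𝒜 r x - x ∈ geq 𝒜 r
    rw [← neg_sub]
    exact Submodule.neg_mem _ (sub_trunc_mem_geq r x)
  · intro m
    exact sub_add_cancel m _

end Quotient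

/-! ### The idempotents and the one dimensional modules `S_j`. -/

section Simple

variable {k B : Type*} [Field k] [Ring B] [Algebra k B] (𝒜 : ℕ → Submodule k B)
  [GradedAlgebra 𝒜] {n : ℕ} (ε : (Fin n → k) ≃ₐ[k] 𝒜 0)

theorem idem_mem (j : Fin n) : idem 𝒜 ε j ∈ 𝒜 0 := (ε (Pi.single j 1)).2

theorem idem_mul_self (j : Fin n) : idem 𝒜 ε j * idem 𝒜 ε j = idem 𝒜 ε j := by
  have := congrArg (fun x : 𝒜 0 => (x : B)) (map_mul ε (Pi.single j 1) (Pi.single j 1))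
  simp only [← Pi.single_mul, mul_one] at this
  exact this.symm

theorem idem_mul_of_ne {i j : Fin n} (h : i ≠ j) : idem 𝒜 ε i * idem 𝒜 ε j = 0 := by
  have := congrArg (fun x : 𝒜 0 => (x : B)) (map_mul ε (Pi.single i 1) (Pi.single j 1))
  have h0 : (Pi.single i 1 * Pi.single j 1 : Fin n → k) = 0 := by
    funext t
    by_cases ht : t = i
    · subst ht; simp [h]
    · simp [ht]
  rw [h0, map_zero] at this
  exact this.symm

theorem sum_idem : ∑ j, idem 𝒜 ε j = 1 := by
  have := congrArg (fun x : 𝒜 0 => (x : B)) (map_one ε)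
  have h1 : (1 : Fin n → k) = ∑ j, Pi.single j 1 := by
    funext t; simp [Finset.sum_apply, Pi.single_apply]
  rw [h1, map_sum] at this
  simpa [idem] using this

theorem exists_eq_sum_idem {x : B} (hx : x ∈ 𝒜 0) : ∃ c : Fin n → k, x = ∑ j, c j • idem 𝒜 ε j := by
  refine ⟨ε.symm ⟨x, hx⟩, ?_⟩
  have h1 : ∀ c : Fin n → k, c = ∑ j, c j • (Pi.single j 1 : Fin n → k) := fun c => by
    funext t; simp [Finset.sum_apply, Pi.single_apply]
  have := congrArg (fun x : 𝒜 0 => (x : B)) (ε.apply_symm_apply ⟨x, hx⟩)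
  rw [h1 (ε.symm ⟨x, hx⟩), map_sum] at this
  simpa [idem] using this.symm

/-- Both products see only the `j`-th coordinate of `x` in `B_0 ≅ k^n`, which is why the same scalar
works on either side. -/
theorem exists_idem_mul {x : B} (hx : x ∈ 𝒜 0) (j : Fin n) :
    ∃ c : k, idem 𝒜 ε j * x = c • idem 𝒜 ε j ∧ x * idem 𝒜 ε j = c • idem 𝒜 ε j := by
  obtain ⟨c, rfl⟩ := exists_eq_sum_idem 𝒜 ε hx
  refine ⟨c j, ?_, ?_⟩
  · rw [Finset.mul_sum, Finset.sum_eq_single j, mul_smul_comm, idem_mul_self]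
    · intro i _ hi; rw [mul_smul_comm, idem_mul_of_ne 𝒜 ε hi.symm, smul_zero]
    · simp
  · rw [Finset.sum_mul, Finset.sum_eq_single j, smul_mul_assoc, idem_mul_self]
    · intro i _ hi; rw [smul_mul_assoc, idem_mul_of_ne 𝒜 ε hi, smul_zero]
    · simp

/-- The generator of `S_j`. -/
def simpleGen (j : Fin n) : SimpleR 𝒜 (idem 𝒜 ε j) :=
  Submodule.Quotient.mk ⟨idem 𝒜 ε j, Submodule.subset_span rfl⟩

theorem trunc_one_mem (x : B) : trunc 𝒜 1 x ∈ 𝒜 0 := by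
  rw [trunc, Finset.sum_range_one]
  exact SetLike.coe_mem (DirectSum.decompose 𝒜 x 0)

theorem exists_eq_smul_simpleGen (j : Fin n) (x : SimpleR 𝒜 (idem 𝒜 ε j)) :
    ∃ c : k, x = c • simpleGen 𝒜 ε j := by
  obtain ⟨⟨x, hx⟩⟩ := x
  obtain ⟨⟨b⟩, rfl⟩ := Submodule.mem_span_singleton.1 hx
  obtain ⟨c, hc, -⟩ := exists_idem_mul 𝒜 ε (trunc_one_mem 𝒜 b) j
  refine ⟨c, (Submodule.Quotient.eq _).2 ?_⟩
  show idem 𝒜 ε j * b - c • idem 𝒜 ε j ∈ geq 𝒜 1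
  rw [← hc, ← mul_sub]
  exact mul_mem_geq_left _ (sub_trunc_mem_geq 1 b)

theorem op_smul_simpleGen (j : Fin n) :
    MulOpposite.op (idem 𝒜 ε j) • simpleGen 𝒜 ε j = simpleGen 𝒜 ε j :=
  congrArg Submodule.Quotient.mk (Subtype.ext (idem_mul_self 𝒜 ε j))

theorem simpleR_smul_eq_zero (j : Fin n) :
    ∀ x ∈ geq 𝒜 1, ∀ m : SimpleR 𝒜 (idem 𝒜 ε j), MulOpposite.op x • m = 0 := by
  rintro x hx ⟨m⟩
  exact (Submodule.Quotient.mk_eq_zero _).2 (mul_mem_geq_left (m : B) hx)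

theorem simpleGen_mem (j : Fin n) : simpleGen 𝒜 ε j ∈ simpleRDeg 𝒜 (idem 𝒜 ε j) 0 :=
  ⟨_, idem_mem 𝒜 ε j, rfl⟩

theorem eq_zero_of_mem_simpleRDeg (j : Fin n) {d : ℤ} (hd : d ≠ 0) {x : SimpleR 𝒜 (idem 𝒜 ε j)}
    (hx : x ∈ simpleRDeg 𝒜 (idem 𝒜 ε j) d) : x = 0 := by
  obtain ⟨y, hy, rfl⟩ := hx
  refine (Submodule.Quotient.mk_eq_zero _).2 ?_
  rcases d with d | d
  · exact mem_geq_of_mem (𝒜 := 𝒜) (i := d) (by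
      rcases d with _ | d
      · exact absurd rfl hd
      · omega) hy
  · have : (y : B) = 0 := hy
    show (y : B) ∈ geq 𝒜 1
    rw [this]
    exact Submodule.zero_mem _

end Simple

/-! ### Filtration of finite dimensional graded modules by shifts of the `S_j`. -/

section Induction

variable {k B : Type*} [Field k] [Ring B] [Algebra k B] {𝒜 : ℕ → Submodule k B}
  [GradedAlgebra 𝒜] {n : ℕ} (ε : (Fin n → k) ≃ₐ[k] 𝒜 0)
  {M : Type*} [AddCommGroup M] [Module k M] [Module Bᵐᵒᵖ M] [IsScalarTower k Bᵐᵒᵖ M]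
  {ℳ : ℤ → Submodule k M}

/-- The idempotents sum to `1`, so some `m e_j` is nonzero for a homogeneous socle vector `m`; it
stays homogeneous as `e_j` has degree `0`. -/
theorem exists_socle_idem [Nontrivial M] (hM : IsGradedModule 𝒜 ℳ) {r : ℕ}
    (hr : ∀ x ∈ geq 𝒜 r, ∀ m : M, MulOpposite.op x • m = 0) :
    ∃ (j : Fin n) (d : ℤ), ∃ m ∈ ℳ d, m ≠ 0 ∧ MulOpposite.op (idem 𝒜 ε j) • m = m ∧
      ∀ x ∈ geq 𝒜 1, MulOpposite.op x • m = 0 := by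
  obtain ⟨p, hp⟩ := hM.exists_proj
  obtain ⟨m, hm⟩ := exists_ne (0 : M)
  obtain ⟨s, hs⟩ := hp.sum m
  obtain ⟨d, -, hd⟩ : ∃ d ∈ s, p d m ≠ 0 := Finset.exists_ne_zero_of_sum_ne_zero (by rwa [hs])
  obtain ⟨d, m, hmd, hm, h1⟩ := exists_homogeneous_socle hM.act r d (p d m) (hp.mem d m) hd
    fun i hi b hb => hr b (mem_geq_of_mem hi hb) _
  have : ∑ j, MulOpposite.op (idem 𝒜 ε j) • m ≠ 0 := by
    rwa [← Finset.sum_smul, ← Finset.op_sum, sum_idem, MulOpposite.op_one, one_smul]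
  obtain ⟨j, -, hj⟩ := Finset.exists_ne_zero_of_sum_ne_zero this
  refine ⟨j, d, MulOpposite.op (idem 𝒜 ε j) • m, ?_, hj, ?_, ?_⟩
  · have := hM.act d 0 m _ hmd (idem_mem 𝒜 ε j)
    rwa [Nat.cast_zero, add_zero] at this
  · rw [← mul_smul, ← MulOpposite.op_mul, idem_mul_self]
  · intro x hx
    rw [← mul_smul, ← MulOpposite.op_mul]
    exact smul_eq_zero_of_mem_geq h1 _ (mul_mem_geq_left _ hx)

/-- The map `S_j → M` given by an element `m = m e_j` of `M` with `m B_{≥ 1} = 0`. -/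
def simpleMap (j : Fin n) (m : M) (h1 : ∀ x ∈ geq 𝒜 1, MulOpposite.op x • m = 0) :
    SimpleR 𝒜 (idem 𝒜 ε j) →ₗ[Bᵐᵒᵖ] M :=
  ((geqR 𝒜 1).submoduleOf (rightGen (idem 𝒜 ε j))).liftQ
    { toFun := fun x => MulOpposite.op (x : B) • m
      map_add' := fun x y => by
        rw [Submodule.coe_add, MulOpposite.op_add, add_smul]
      map_smul' := fun c x => by
        rw [RingHom.id_apply, ← mul_smul]; rfl } fun x hx => h1 x hx

/-- The vector `m` spans a copy of `S_j` shifted by `d`, and `L` is that line. The quotient has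
smaller dimension, so this is the induction step. -/
theorem exists_isSplitExact_simple (hM : IsGradedModule 𝒜 ℳ) {j : Fin n} {d : ℤ} {m : M}
    (hmd : m ∈ ℳ d) (hm0 : m ≠ 0) (hmj : MulOpposite.op (idem 𝒜 ε j) • m = m)
    (h1 : ∀ x ∈ geq 𝒜 1, MulOpposite.op x • m = 0) :
    ∃ (L : Submodule Bᵐᵒᵖ M) (ι : SimpleR 𝒜 (idem 𝒜 ε j) →ₗ[k] M)
      (ρ : M →ₗ[k] SimpleR 𝒜 (idem 𝒜 ε j)) (s : (M ⧸ L) →ₗ[k] M), m ∈ L ∧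
      IsGradedModule 𝒜 (fun d => (ℳ d).map (mkK k L)) ∧
      IsSplitExact (B := B) (simpleRDeg 𝒜 (idem 𝒜 ε j)) ℳ (fun d => (ℳ d).map (mkK k L)) ι ρ
        (mkK k L) s d := by
  obtain ⟨p, hp⟩ := hM.exists_proj
  let ι : SimpleR 𝒜 (idem 𝒜 ε j) →ₗ[k] M := (simpleMap ε j m h1).restrictScalars k
  have hι : ∀ c : k, ι (c • simpleGen 𝒜 ε j) = c • m := fun c => by
    rw [map_smul]; exact congrArg (c • ·) hmj
  obtain ⟨φ, hφ⟩ : ∃ φ : Module.Dual k M, φ m ≠ 0 := by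
    by_contra! h
    exact hm0 ((Module.forall_dual_apply_eq_zero_iff k m).1 h)
  -- Projecting to degree `d` before applying `φ` makes the retraction homogeneous; dividing by `φ
  -- m` makes it the identity on the line of `m`.
  let ρ : M →ₗ[k] SimpleR 𝒜 (idem 𝒜 ε j) :=
    ((φ m)⁻¹ • φ ∘ₗ p d).smulRight (simpleGen 𝒜 ε j)
  have hρ : ∀ x, ρ x = ((φ m)⁻¹ * φ (p d x)) • simpleGen 𝒜 ε j := fun x => rfl
  have hρι : ∀ x, ρ (ι x) = x := fun x => by
    obtain ⟨c, rfl⟩ := exists_eq_smul_simpleGen 𝒜 ε j x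
    rw [hι, hρ, map_smul, hp.self d m hmd, map_smul, smul_eq_mul]
    congr 1
    field_simp
  have hL : ∀ x ∈ LinearMap.range (simpleMap ε j m h1), x = ι (ρ x) := by
    rintro _ ⟨x, rfl⟩
    show ι x = ι (ρ (ι x))
    rw [hρι]
  let s : (M ⧸ LinearMap.range (simpleMap ε j m h1)) →ₗ[k] M :=
    liftK _ (LinearMap.id - ι ∘ₗ ρ) fun x hx => by
      rw [LinearMap.sub_apply, LinearMap.id_apply, LinearMap.comp_apply, ← hL x hx, sub_self]
  have hρd : ∀ e, ∀ x ∈ ℳ e, ρ x ∈ simpleRDeg 𝒜 (idem 𝒜 ε j) (e + -d) := by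
    intro e x hx
    rw [hρ]
    by_cases he : d = e
    · subst he
      rw [add_neg_cancel]
      exact Submodule.smul_mem _ _ (simpleGen_mem 𝒜 ε j)
    · rw [hp.ne e d x hx he, map_zero, mul_zero, zero_smul]
      exact Submodule.zero_mem _
  have hιd : ∀ e, ∀ x ∈ simpleRDeg 𝒜 (idem 𝒜 ε j) e, ι x ∈ ℳ (e + d) := by
    intro e x hx
    by_cases he : e = 0
    · subst he
      obtain ⟨c, rfl⟩ := exists_eq_smul_simpleGen 𝒜 ε j x
      rw [hι, zero_add]
      exact Submodule.smul_mem _ _ hmd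
    · rw [eq_zero_of_mem_simpleRDeg 𝒜 ε j he hx, map_zero]
      exact Submodule.zero_mem _
  refine ⟨LinearMap.range (simpleMap ε j m h1), ι, ρ, s, ⟨simpleGen 𝒜 ε j, hmj⟩,
    isGradedModule_quotient hM.act hp _ ?_, ?_, ?_, hιd, hρd, ?_, ?_, hρι, ?_, ?_⟩
  · intro e x hx
    by_cases he : e = d
    · subst he
      rw [hL x hx, hρ, hι, map_smul, hp.self e m hmd, ← hι]
      exact ⟨_, rfl⟩
    · rw [hL x hx, hρ, hι, map_smul, hp.ne d e m hmd he, smul_zero]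
      exact Submodule.zero_mem _
  · exact fun b x => LinearMap.map_smul (simpleMap ε j m h1) _ _
  · exact fun b x => LinearMap.map_smul (LinearMap.range (simpleMap ε j m h1)).mkQ _ _
  · intro e x hx
    rw [add_zero]
    exact ⟨x, hx, rfl⟩
  · rintro e _ ⟨x, hx, rfl⟩
    rw [add_zero]
    have := hιd _ _ (hρd e x hx)
    rw [neg_add_cancel_right] at this
    exact Submodule.sub_mem _ hx this
  · rintro ⟨x⟩
    refine (Submodule.Quotient.eq _).2 ?_
    show x - ι (ρ x) - x ∈ _
    rw [sub_sub_cancel_left]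
    exact Submodule.neg_mem _ ⟨_, rfl⟩
  · intro x
    exact add_sub_cancel (ι (ρ x)) x

theorem finrank_lt_of_surjective {V W : Type*} [AddCommGroup V] [Module k V] [FiniteDimensional k V]
    [AddCommGroup W] [Module k W] (f : V →ₗ[k] W) (hf : Function.Surjective f) {v : V} (hv : v ≠ 0)
    (hfv : f v = 0) : Module.finrank k W < Module.finrank k V := by
  rw [← LinearMap.finrank_range_add_finrank_ker f, LinearMap.range_eq_top.2 hf, finrank_top]
  exact Nat.lt_add_of_pos_right (Module.finrank_pos_iff_exists_ne_zero.2
    ⟨⟨v, hfv⟩, fun h => hv (congrArg Subtype.val h)⟩)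

universe u

/-- Finite dimensional graded modules killed by `B_{≥ r}` are iterated extensions of shifts of the
modules `S_j`. -/
theorem graded_induction {r : ℕ}
    (P : ∀ (M : Type u) [AddCommGroup M] [Module k M] [Module Bᵐᵒᵖ M] [IsScalarTower k Bᵐᵒᵖ M],
      (ℤ → Submodule k M) → Prop)
    (h0 : ∀ (M : Type u) [AddCommGroup M] [Module k M] [Module Bᵐᵒᵖ M] [IsScalarTower k Bᵐᵒᵖ M]
      (ℳ : ℤ → Submodule k M), Subsingleton M → P M ℳ)
    (h1 : ∀ (M M'' : Type u) [AddCommGroup M] [Module k M] [Module Bᵐᵒᵖ M]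
      [IsScalarTower k Bᵐᵒᵖ M] [AddCommGroup M''] [Module k M''] [Module Bᵐᵒᵖ M'']
      [IsScalarTower k Bᵐᵒᵖ M''] (ℳ : ℤ → Submodule k M) (ℳ'' : ℤ → Submodule k M'')
      (j : Fin n) (ι : SimpleR 𝒜 (idem 𝒜 ε j) →ₗ[k] M) (ρ : M →ₗ[k] SimpleR 𝒜 (idem 𝒜 ε j))
      (π : M →ₗ[k] M'') (s : M'' →ₗ[k] M) (d : ℤ),
      IsSplitExact (B := B) (simpleRDeg 𝒜 (idem 𝒜 ε j)) ℳ ℳ'' ι ρ π s d →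
      IsGradedModule 𝒜 ℳ → (∀ x ∈ geq 𝒜 r, ∀ m : M, MulOpposite.op x • m = 0) →
      FiniteDimensional k M'' → IsGradedModule 𝒜 ℳ'' →
      (∀ x ∈ geq 𝒜 r, ∀ m : M'', MulOpposite.op x • m = 0) → P M'' ℳ'' → P M ℳ) (t : ℕ) :
    ∀ (M : Type u) [AddCommGroup M] [Module k M] [Module Bᵐᵒᵖ M] [IsScalarTower k Bᵐᵒᵖ M]
      [FiniteDimensional k M] (ℳ : ℤ → Submodule k M), IsGradedModule 𝒜 ℳ →
      (∀ x ∈ geq 𝒜 r, ∀ m : M, MulOpposite.op x • m = 0) → Module.finrank k M = t → P M ℳ := by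
  induction t using Nat.strong_induction_on with
  | _ t ih =>
    intro M _ _ _ _ _ ℳ hM hr ht
    rcases subsingleton_or_nontrivial M with hs | hs
    · exact h0 M ℳ hs
    obtain ⟨j, d, m, hmd, hm0, hmj, hm1⟩ := exists_socle_idem ε hM hr
    obtain ⟨L, ι, ρ, s, hmL, hQ, E⟩ := exists_isSplitExact_simple ε hM hmd hm0 hmj hm1
    have hfin : FiniteDimensional k (M ⧸ L) :=
      Module.Finite.of_surjective (mkK k L) (Submodule.mkQ_surjective L)
    have hr'' : ∀ x ∈ geq 𝒜 r, ∀ y : M ⧸ L, MulOpposite.op x • y = 0 := by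
      rintro x hx ⟨y⟩
      exact congrArg Submodule.Quotient.mk (hr x hx y)
    refine h1 M _ ℳ _ j ι ρ _ s d E hM hr hfin hQ hr'' (ih _ ?_ _ _ hQ hr'' rfl)
    rw [← ht]
    exact finrank_lt_of_surjective (mkK k L) (Submodule.mkQ_surjective L) hm0
      ((Submodule.Quotient.mk_eq_zero L).2 hmL)

theorem extVanishes_of_simple {i : ℕ}
    (h : ∀ j, ExtVanishes 𝒜 (simpleRDeg 𝒜 (idem 𝒜 ε j)) i) [FiniteDimensional k M]
    (hM : IsGradedModule 𝒜 ℳ) {r : ℕ} (hr : ∀ x ∈ geq 𝒜 r, ∀ m : M, MulOpposite.op x • m = 0) :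
    ExtVanishes 𝒜 ℳ i :=
  graded_induction ε (fun _ _ _ _ _ ℳ => ExtVanishes 𝒜 ℳ i)
    (fun _ _ _ _ _ _ _ => extVanishes_of_subsingleton i)
    (fun _ _ _ _ _ _ _ _ _ _ _ _ j _ _ _ _ _ E hM _ _ _ _ h'' => E.extVanishes hM.act (h j) h'')
    _ M ℳ hM hr rfl

theorem isPerfect_of_simple {i r : ℕ} (hr1 : 1 ≤ r) {T : (Quo 𝒜 r → (Fin i → B) → B) →ₗ[k] k}
    (hT : ∀ f ∈ coboundaries 𝒜 (quoDeg 𝒜 r) (zdeg 𝒜) i, T f = 0)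
    (h : ∀ j, ExtVanishes 𝒜 (simpleRDeg 𝒜 (idem 𝒜 ε j)) (i + 1))
    (hp : ∀ j, IsPerfect (simpleRDeg 𝒜 (idem 𝒜 ε j)) i T
      fun x hx m => simpleR_smul_eq_zero 𝒜 ε j x (geq_anti 𝒜 hr1 hx) m) [FiniteDimensional k M]
    (hM : IsGradedModule 𝒜 ℳ) (hr : ∀ x ∈ geq 𝒜 r, ∀ m : M, MulOpposite.op x • m = 0) :
    IsPerfect ℳ i T hr :=
  graded_induction ε (r := r) (fun _ _ _ _ _ ℳ => ∀ hr, IsPerfect ℳ i T hr)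
    (fun _ _ _ _ _ _ _ hr => IsPerfect.of_subsingleton T hr)
    (fun _ _ _ _ _ _ _ _ _ _ _ _ j _ _ _ _ _ E hM _ _ hM'' hr'' h'' _ =>
      E.isPerfect hM.act hM.iSup_eq_top hT (extVanishes_of_simple ε h hM'' hr'') (hp j) (h'' hr''))
    _ M ℳ hM hr rfl hr

end Induction

/-! ### Ext is the direct sum of its homogeneous pieces. -/

section ExtGrading

variable {k B M : Type*} [Field k] [Ring B] [Algebra k B] {𝒜 : ℕ → Submodule k B}
  [GradedAlgebra 𝒜]
  [AddCommGroup M] [Module k M] [Module Bᵐᵒᵖ M] [IsScalarTower k Bᵐᵒᵖ M]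
  {ℳ : ℤ → Submodule k M}

/-- The class of a cocycle. -/
def extClass (ℳ : ℤ → Submodule k M) {i : ℕ} (f : M → (Fin i → B) → B)
    (hf : f ∈ cocycles 𝒜 ℳ (zdeg 𝒜) i) : GExt 𝒜 ℳ (zdeg 𝒜) i :=
  Submodule.Quotient.mk ⟨f, hf⟩

theorem exists_extClass {i : ℕ} (x : GExt 𝒜 ℳ (zdeg 𝒜) i) : ∃ f hf, x = extClass ℳ f hf := by
  obtain ⟨⟨f, hf⟩, rfl⟩ := Submodule.Quotient.mk_surjective _ x
  exact ⟨f, hf, rfl⟩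

theorem extClass_eq_zero {i : ℕ} {f : M → (Fin i → B) → B}
    {hf : f ∈ cocycles 𝒜 ℳ (zdeg 𝒜) i} :
    extClass ℳ f hf = 0 ↔ f ∈ coboundaries 𝒜 ℳ (zdeg 𝒜) i :=
  Submodule.Quotient.mk_eq_zero ((coboundaries 𝒜 ℳ (zdeg 𝒜) i).submoduleOf
    (cocycles 𝒜 ℳ (zdeg 𝒜) i))

theorem extClass_mem_gextDeg {i : ℕ} {d : ℤ} {f : M → (Fin i → B) → B}
    {hf : f ∈ cocycles 𝒜 ℳ (zdeg 𝒜) i} (hd : f ∈ homCochain 𝒜 ℳ (zdeg 𝒜) i d) :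
    extClass ℳ f hf ∈ gextDeg 𝒜 ℳ (zdeg 𝒜) i d :=
  ⟨⟨f, hf⟩, hd, rfl⟩

theorem exists_extClass_of_mem {i : ℕ} {d : ℤ} {x : GExt 𝒜 ℳ (zdeg 𝒜) i}
    (hx : x ∈ gextDeg 𝒜 ℳ (zdeg 𝒜) i d) :
    ∃ f hf, f ∈ homCochain 𝒜 ℳ (zdeg 𝒜) i d ∧ x = extClass ℳ f hf := by
  obtain ⟨⟨f, hf⟩, hd, rfl⟩ := hx
  exact ⟨f, hf, hd, rfl⟩

theorem IsGradedModule.iSupIndep_homCochain (hM : IsGradedModule 𝒜 ℳ) (i : ℕ) :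
    iSupIndep (homCochain 𝒜 ℳ (zdeg 𝒜) i) :=
  HomDet.iSupIndep_homCochain (iSup_zdeg 𝒜) hM.iSup_eq_top (iSupIndep_zdeg 𝒜) i

theorem IsGradedModule.barD_mem (hM : IsGradedModule 𝒜 ℳ) {i : ℕ} {d : ℤ}
    {f : M → (Fin i → B) → B} (hf : f ∈ homCochain 𝒜 ℳ (zdeg 𝒜) i d) :
    barD k i f ∈ homCochain 𝒜 ℳ (zdeg 𝒜) (i + 1) d :=
  barD_mem_homCochain (isGradedAction_zdeg 𝒜) hM.act (isGradedAction_zdeg 𝒜) hf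

/-- The differential preserves degrees and degrees are independent, so each homogeneous component of
a cocycle is a cocycle. -/
theorem iSup_gextDeg (hM : IsGradedModule 𝒜 ℳ) (i : ℕ) :
    ⨆ d, gextDeg 𝒜 ℳ (zdeg 𝒜) i d = ⊤ := by
  refine eq_top_iff.2 fun x _ => ?_
  obtain ⟨f, hf, rfl⟩ := exists_extClass x
  obtain ⟨v, hv, hsum⟩ := (Submodule.mem_iSup_iff_exists_finsupp _ _).1 hf.1
  have h0 : ∑ d ∈ v.support, barD k i (v d) = 0 := by
    rw [← map_sum, show ∑ d ∈ v.support, v d = f from hsum]; exact hf.2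
  have h1 := (iSupIndep_iff_finsetSum_eq_zero_imp_eq_zero _).1 (hM.iSupIndep_homCochain (i + 1))
    v.support _ (fun d _ => hM.barD_mem (hv d)) h0
  have h2 : ∀ d, v d ∈ cocycles 𝒜 ℳ (zdeg 𝒜) i := fun d => by
    refine ⟨Submodule.mem_iSup_of_mem d (hv d), ?_⟩
    by_cases hd : d ∈ v.support
    · exact h1 d hd
    · rw [Finsupp.notMem_support_iff.1 hd]; exact Submodule.zero_mem _
  have h3 : extClass ℳ f hf = ∑ d ∈ v.support, extClass ℳ (v d) (h2 d) := by
    have : (⟨f, hf⟩ : cocycles 𝒜 ℳ (zdeg 𝒜) i) = ∑ d ∈ v.support, ⟨v d, h2 d⟩ := by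
      refine Subtype.ext ?_
      rw [AddSubmonoidClass.coe_finsetSum]
      exact hsum.symm
    exact (congrArg (Submodule.mkQ _) this).trans (map_sum _ _ _)
  rw [h3]
  exact Submodule.sum_mem _ fun d _ => Submodule.mem_iSup_of_mem d (extClass_mem_gextDeg (hv d))

/-- Comparing degrees in `∑ v d = d h`, the component of `h` in degree `d` is a primitive of `v d`.
-/
theorem mem_coboundaries_of_sum_mem (hM : IsGradedModule 𝒜 ℳ) : ∀ {i : ℕ} {S : Finset ℤ}
    {v : ℤ → M → (Fin i → B) → B} (_ : ∀ d ∈ S, v d ∈ homCochain 𝒜 ℳ (zdeg 𝒜) i d)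
    (_ : ∑ d ∈ S, v d ∈ coboundaries 𝒜 ℳ (zdeg 𝒜) i), ∀ d ∈ S,
    v d ∈ coboundaries 𝒜 ℳ (zdeg 𝒜) i
  | 0, S, v, hv, hs => (iSupIndep_iff_finsetSum_eq_zero_imp_eq_zero _).1
      (hM.iSupIndep_homCochain 0) S v hv hs
  | i + 1, S, v, hv, ⟨h, hh, e⟩ => by
    classical
    obtain ⟨w, hw, hsum⟩ := (Submodule.mem_iSup_iff_exists_finsupp _ _).1 hh
    have hsum' : ∑ d ∈ S ∪ w.support, w d = h := by
      rw [← hsum]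
      exact (Finsupp.sum_of_support_subset w Finset.subset_union_right (fun _ x => x)
        (fun _ _ => rfl)).symm
    -- The primitive may have components outside `S`, so `v` is extended by zero and both sums run
    -- over a common index set.
    have h0 : ∑ d ∈ S ∪ w.support, ((if d ∈ S then v d else 0) - barD k i (w d)) = 0 := by
      rw [Finset.sum_sub_distrib, ← map_sum, hsum', e, Finset.sum_ite_mem,
        Finset.union_inter_cancel_left, sub_self]
    intro d hd
    have := (iSupIndep_iff_finsetSum_eq_zero_imp_eq_zero _).1 (hM.iSupIndep_homCochain (i + 1))
      _ _ (fun d _ => Submodule.sub_mem _ ?_ (hM.barD_mem (hw d))) h0 d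
      (Finset.mem_union_left _ hd)
    · rw [if_pos hd, sub_eq_zero] at this
      exact ⟨w d, Submodule.mem_iSup_of_mem d (hw d), this.symm⟩
    · split_ifs with hd
      · exact hv d hd
      · exact Submodule.zero_mem _

theorem iSupIndep_gextDeg (hM : IsGradedModule 𝒜 ℳ) (i : ℕ) :
    iSupIndep (gextDeg 𝒜 ℳ (zdeg 𝒜) i) := by
  rw [iSupIndep_iff_finsetSum_eq_zero_imp_eq_zero]
  intro S x hx hs d hd
  have h1 : ∀ d, ∃ f hf, d ∈ S → f ∈ homCochain 𝒜 ℳ (zdeg 𝒜) i d ∧ x d = extClass ℳ f hf := by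
    intro d
    by_cases hd : d ∈ S
    · obtain ⟨f, hf, h, h'⟩ := exists_extClass_of_mem (hx d hd)
      exact ⟨f, hf, fun _ => ⟨h, h'⟩⟩
    · exact ⟨0, Submodule.zero_mem _, fun h => absurd h hd⟩
  choose f hf h using h1
  have h2 : extClass ℳ (∑ d ∈ S, f d) (Submodule.sum_mem _ fun d _ => hf d) = 0 := by
    rw [← hs]
    have : (⟨∑ d ∈ S, f d, Submodule.sum_mem _ fun d _ => hf d⟩ : cocycles 𝒜 ℳ (zdeg 𝒜) i)
        = ∑ d ∈ S, ⟨f d, hf d⟩ := by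
      refine Subtype.ext ?_
      rw [AddSubmonoidClass.coe_finsetSum]
    refine ((congrArg (Submodule.mkQ _) this).trans (map_sum _ _ _)).trans ?_
    exact Finset.sum_congr rfl fun d hd => (h d hd).2.symm
  rw [(h d hd).2, extClass_eq_zero]
  exact mem_coboundaries_of_sum_mem hM (fun d hd => (h d hd).1) (extClass_eq_zero.1 h2) d hd

end ExtGrading

/-! ### Local cohomology: grading, injectivity of the structure maps, two commuting actions of `B`,
action of automorphisms. -/

section LocalCohomology

variable {k B : Type*} [Field k] [Ring B] [Algebra k B] {𝒜 : ℕ → Submodule k B}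
  [GradedAlgebra 𝒜]

noncomputable instance (i : ℕ) : AddCommGroup (LocalCoh 𝒜 i) :=
  Module.DirectLimit.addCommGroup (ExtQuo 𝒜 i) (extProj 𝒜 i)

instance (i : ℕ) : DirectedSystem (ExtQuo 𝒜 i) fun r s h => extProj 𝒜 i r s h where
  map_self r x := by
    obtain ⟨f, hf, rfl⟩ := exists_extClass x
    refine congrArg Submodule.Quotient.mk (Subtype.ext ?_)
    funext m c
    obtain ⟨x⟩ := m
    rfl
  map_map t s r hrs hst x := by
    obtain ⟨f, hf, rfl⟩ := exists_extClass x
    refine congrArg Submodule.Quotient.mk (Subtype.ext ?_)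
    funext m c
    obtain ⟨x⟩ := m
    rfl

/-- The map `Ext^i(B / B_{≥ r}, B) → H^i(B)`. -/
noncomputable abbrev toLocalCoh (𝒜 : ℕ → Submodule k B) [GradedAlgebra 𝒜] (i r : ℕ) :
    ExtQuo 𝒜 i r →ₗ[k] LocalCoh 𝒜 i :=
  Module.DirectLimit.of k ℕ (ExtQuo 𝒜 i) (extProj 𝒜 i) r

theorem exists_toLocalCoh (i s : ℕ) (x : LocalCoh 𝒜 i) : ∃ r, s ≤ r ∧ ∃ f hf,
    x = toLocalCoh 𝒜 i r (extClass (quoDeg 𝒜 r) f hf) := by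
  obtain ⟨r, y, rfl⟩ := Module.DirectLimit.exists_of x
  obtain ⟨f, hf, h⟩ := exists_extClass (extProj 𝒜 i r (max s r) (le_max_right _ _) y)
  refine ⟨max s r, le_max_left _ _, f, hf, ?_⟩
  rw [← h]
  exact (Module.DirectLimit.of_f).symm

theorem extProj_mem_gextDeg (i : ℕ) {r s : ℕ} (h : r ≤ s) (d : ℤ) {x : ExtQuo 𝒜 i r}
    (hx : x ∈ gextDeg 𝒜 (quoDeg 𝒜 r) (zdeg 𝒜) i d) :
    extProj 𝒜 i r s h x ∈ gextDeg 𝒜 (quoDeg 𝒜 s) (zdeg 𝒜) i d := by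
  obtain ⟨f, hf, hd, rfl⟩ := exists_extClass_of_mem hx
  have : pull (quoProj 𝒜 h) i f ∈ homCochain 𝒜 (quoDeg 𝒜 s) (zdeg 𝒜) i (d + 0) :=
    pull_mem_homCochain 0 (quoMap_mem_quoDeg 𝒜 _ _ 0 fun d x hx => by
      rw [add_zero]; exact hx) hd
  rw [add_zero] at this
  exact extClass_mem_gextDeg this

theorem mem_localCohDeg {i : ℕ} {d : ℤ} {x : LocalCoh 𝒜 i} :
    x ∈ localCohDeg 𝒜 i d ↔
      ∃ r, ∃ y ∈ gextDeg 𝒜 (quoDeg 𝒜 r) (zdeg 𝒜) i d, toLocalCoh 𝒜 i r y = x := by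
  rw [localCohDeg, Submodule.mem_iSup_of_directed]
  · rfl
  · refine Monotone.directed_le fun r s h => ?_
    rintro _ ⟨y, hy, rfl⟩
    exact ⟨_, extProj_mem_gextDeg i h d hy, Module.DirectLimit.of_f⟩

theorem iSup_localCohDeg (i : ℕ) : ⨆ d, localCohDeg 𝒜 i d = ⊤ := by
  refine eq_top_iff.2 fun x _ => ?_
  obtain ⟨r, y, rfl⟩ := Module.DirectLimit.exists_of x
  have hy : y ∈ ⨆ d, gextDeg 𝒜 (quoDeg 𝒜 r) (zdeg 𝒜) i d :=
    iSup_gextDeg (isGradedModule_quoDeg (𝒜 := 𝒜) r) i ▸ Submodule.mem_top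
  have : ⨆ d, gextDeg 𝒜 (quoDeg 𝒜 r) (zdeg 𝒜) i d
      ≤ (⨆ d, localCohDeg 𝒜 i d).comap (toLocalCoh 𝒜 i r) :=
    iSup_le fun d y hy => Submodule.mem_iSup_of_mem d (mem_localCohDeg.2 ⟨r, y, hy, rfl⟩)
  exact this hy

/-- Representatives of finitely many elements move to one stage, and a vanishing sum becomes zero at
some later stage; there independence is that of the grading of Ext. -/
theorem iSupIndep_localCohDeg (i : ℕ) : iSupIndep (localCohDeg 𝒜 i) := by
  rw [iSupIndep_iff_finsetSum_eq_zero_imp_eq_zero]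
  intro S x hx hs d hd
  have h1 : ∀ d, ∃ r, ∃ y : ExtQuo 𝒜 i r, d ∈ S →
      y ∈ gextDeg 𝒜 (quoDeg 𝒜 r) (zdeg 𝒜) i d ∧ toLocalCoh 𝒜 i r y = x d := by
    intro d
    by_cases hd : d ∈ S
    · obtain ⟨r, y, h⟩ := mem_localCohDeg.1 (hx d hd)
      exact ⟨r, y, fun _ => h⟩
    · exact ⟨0, 0, fun h => absurd h hd⟩
  choose r y h using h1
  have hR : ∀ d ∈ S, r d ≤ S.sup r := fun d hd => Finset.le_sup hd
  let z : ℤ → ExtQuo 𝒜 i (S.sup r) := fun d =>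
    if hd : d ∈ S then extProj 𝒜 i _ _ (hR d hd) (y d) else 0
  have hz : ∀ d ∈ S, z d ∈ gextDeg 𝒜 (quoDeg 𝒜 (S.sup r)) (zdeg 𝒜) i d ∧
      toLocalCoh 𝒜 i (S.sup r) (z d) = x d := by
    intro d hd
    simp only [z, dif_pos hd]
    exact ⟨extProj_mem_gextDeg i _ d (h d hd).1, Module.DirectLimit.of_f.trans (h d hd).2⟩
  have h2 : toLocalCoh 𝒜 i (S.sup r) (∑ d ∈ S, z d) = 0 := by
    rw [map_sum, ← hs]
    exact Finset.sum_congr rfl fun d hd => (hz d hd).2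
  obtain ⟨s, hs, h3⟩ := Module.DirectLimit.of.zero_exact h2
  rw [map_sum] at h3
  have := (iSupIndep_iff_finsetSum_eq_zero_imp_eq_zero _).1
    (iSupIndep_gextDeg (isGradedModule_quoDeg (𝒜 := 𝒜) s) i) S _
    (fun d hd => extProj_mem_gextDeg i hs d (hz d hd).1) h3 d hd
  rw [← (hz d hd).2, ← Module.DirectLimit.of_f (hij := hs), this, map_zero]

/-- The kernel of a transition map comes from `Ext^{i-1}` of the kernel of `B / B_{≥ s} → B / B_{≥
r}`, which is assumed to vanish. -/
theorem toLocalCoh_injective {i r : ℕ} (h : ∀ s, r ≤ s → ∀ j, j + 1 = i →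
      ExtVanishes 𝒜 (quoKerDeg 𝒜 r s) j) : Function.Injective (toLocalCoh 𝒜 i r) := by
  refine (injective_iff_map_eq_zero _).2 fun x hx => ?_
  obtain ⟨s, hs, h0⟩ := Module.DirectLimit.of.zero_exact hx
  obtain ⟨f, hf, rfl⟩ := exists_extClass x
  obtain ⟨ι, ρ, σ, E⟩ := exists_isSplitExact_quoProj (𝒜 := 𝒜) hs
  rw [extClass_eq_zero]
  refine E.mem_coboundaries_of_pull (isGradedModule_quoDeg s).act (h s hs) hf ?_
  have hp : pull (quoProj 𝒜 hs) i f ∈ cocycles 𝒜 (quoDeg 𝒜 s) (zdeg 𝒜) i :=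
    pull_mem_cocycles E.π_op (E.pull_π_mem i) hf
  exact (extClass_eq_zero (hf := hp)).1 h0

theorem localCohRight_toLocalCoh (i r : ℕ) (b : B) (x : ExtQuo 𝒜 i r) :
    localCohRight 𝒜 i b (toLocalCoh 𝒜 i r x) = toLocalCoh 𝒜 i r (extRight 𝒜 i r b x) :=
  Module.DirectLimit.map_apply_of _ _ _

theorem localCohRight_add (i : ℕ) (b c : B) (x : LocalCoh 𝒜 i) :
    localCohRight 𝒜 i (b + c) x = localCohRight 𝒜 i b x + localCohRight 𝒜 i c x := by
  obtain ⟨r, -, f, hf, rfl⟩ := exists_toLocalCoh i 0 x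
  rw [localCohRight_toLocalCoh, localCohRight_toLocalCoh, localCohRight_toLocalCoh, ← map_add]
  refine congrArg _ (congrArg Submodule.Quotient.mk (Subtype.ext ?_))
  funext m a
  obtain ⟨x⟩ := m
  refine Eq.trans ?_ ((isMultilinear_of_mem_cochains hf.1).add _ _ _)
  show f (Submodule.Quotient.mk ((b + c) * x)) a = _
  rw [add_mul]
  rfl

theorem localCohRight_smul (i : ℕ) (c : k) (b : B) (x : LocalCoh 𝒜 i) :
    localCohRight 𝒜 i (c • b) x = c • localCohRight 𝒜 i b x := by
  obtain ⟨r, -, f, hf, rfl⟩ := exists_toLocalCoh i 0 x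
  rw [localCohRight_toLocalCoh, localCohRight_toLocalCoh, ← map_smul]
  refine congrArg _ (congrArg Submodule.Quotient.mk (Subtype.ext ?_))
  funext m a
  obtain ⟨x⟩ := m
  refine Eq.trans ?_ ((isMultilinear_of_mem_cochains hf.1).smul _ _ _)
  show f (Submodule.Quotient.mk ((c • b) * x)) a = _
  rw [smul_mul_assoc]
  rfl

theorem localCohRight_one (i : ℕ) (x : LocalCoh 𝒜 i) : localCohRight 𝒜 i 1 x = x := by
  obtain ⟨r, -, f, hf, rfl⟩ := exists_toLocalCoh i 0 x
  rw [localCohRight_toLocalCoh]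
  refine congrArg _ (congrArg Submodule.Quotient.mk (Subtype.ext ?_))
  funext m a
  obtain ⟨x⟩ := m
  show f (Submodule.Quotient.mk (1 * x)) a = _
  rw [one_mul]
  rfl

theorem localCohRight_mul (i : ℕ) (b c : B) (x : LocalCoh 𝒜 i) :
    localCohRight 𝒜 i (b * c) x = localCohRight 𝒜 i c (localCohRight 𝒜 i b x) := by
  obtain ⟨r, -, f, hf, rfl⟩ := exists_toLocalCoh i 0 x
  rw [localCohRight_toLocalCoh, localCohRight_toLocalCoh, localCohRight_toLocalCoh]
  refine congrArg _ (congrArg Submodule.Quotient.mk (Subtype.ext ?_))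
  funext m a
  obtain ⟨x⟩ := m
  show f (Submodule.Quotient.mk ((b * c) * x)) a = _
  rw [mul_assoc]
  rfl

/-- The left action of `b` on `H^i(B)`. -/
noncomputable def localCohLeft (𝒜 : ℕ → Submodule k B) [GradedAlgebra 𝒜] (i : ℕ) (b : B) :
    LocalCoh 𝒜 i →ₗ[k] LocalCoh 𝒜 i :=
  Module.DirectLimit.map (fun r => extLeft 𝒜 (quoDeg 𝒜 r) i b) fun r s h => by
    refine LinearMap.ext fun x => ?_
    obtain ⟨f, hf, rfl⟩ := exists_extClass x
    rfl

theorem localCohLeft_toLocalCoh (i r : ℕ) (b : B) (x : ExtQuo 𝒜 i r) :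
    localCohLeft 𝒜 i b (toLocalCoh 𝒜 i r x)
      = toLocalCoh 𝒜 i r (extLeft 𝒜 (quoDeg 𝒜 r) i b x) :=
  Module.DirectLimit.map_apply_of _ _ _

theorem localCohLeft_mul (i : ℕ) (b c : B) (x : LocalCoh 𝒜 i) :
    localCohLeft 𝒜 i (b * c) x = localCohLeft 𝒜 i b (localCohLeft 𝒜 i c x) := by
  obtain ⟨r, -, f, hf, rfl⟩ := exists_toLocalCoh i 0 x
  rw [localCohLeft_toLocalCoh, localCohLeft_toLocalCoh, localCohLeft_toLocalCoh]
  refine congrArg _ (congrArg Submodule.Quotient.mk (Subtype.ext ?_))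
  funext m a
  exact mul_assoc _ _ _

theorem localCohLeft_zero (i : ℕ) (x : LocalCoh 𝒜 i) : localCohLeft 𝒜 i 0 x = 0 := by
  obtain ⟨r, -, f, hf, rfl⟩ := exists_toLocalCoh i 0 x
  rw [localCohLeft_toLocalCoh, ← map_zero (toLocalCoh 𝒜 i r)]
  refine congrArg _ (congrArg Submodule.Quotient.mk (Subtype.ext ?_))
  funext m a
  exact zero_mul _

theorem localCohLeft_localCohRight (i : ℕ) (b c : B) (x : LocalCoh 𝒜 i) :
    localCohLeft 𝒜 i b (localCohRight 𝒜 i c x) = localCohRight 𝒜 i c (localCohLeft 𝒜 i b x) := by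
  obtain ⟨r, -, f, hf, rfl⟩ := exists_toLocalCoh i 0 x
  rw [localCohLeft_toLocalCoh, localCohRight_toLocalCoh, localCohRight_toLocalCoh,
    localCohLeft_toLocalCoh]
  rfl

theorem localCohRight_mem (i : ℕ) {d : ℤ} {j : ℕ} {b : B} (hb : b ∈ 𝒜 j) {x : LocalCoh 𝒜 i}
    (hx : x ∈ localCohDeg 𝒜 i d) : localCohRight 𝒜 i b x ∈ localCohDeg 𝒜 i (d + j) := by
  obtain ⟨r, y, hy, rfl⟩ := mem_localCohDeg.1 hx
  obtain ⟨f, hf, hd, rfl⟩ := exists_extClass_of_mem hy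
  rw [localCohRight_toLocalCoh]
  refine mem_localCohDeg.2 ⟨r, _, extClass_mem_gextDeg (pull_mem_homCochain j ?_ hd), rfl⟩
  refine quoMap_mem_quoDeg 𝒜 _ _ j fun d x hx => ?_
  rw [add_comm]
  exact zdeg_mul_mem 𝒜 (d := (j : ℤ)) hb hx

theorem localCohLeft_mem (i : ℕ) {d : ℤ} {b : B} (hb : b ∈ 𝒜 0) {x : LocalCoh 𝒜 i}
    (hx : x ∈ localCohDeg 𝒜 i d) : localCohLeft 𝒜 i b x ∈ localCohDeg 𝒜 i d := by
  obtain ⟨r, y, hy, rfl⟩ := mem_localCohDeg.1 hx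
  obtain ⟨f, hf, hd, rfl⟩ := exists_extClass_of_mem hy
  rw [localCohLeft_toLocalCoh]
  have := barPull_mem_homCochain (ℳ' := quoDeg 𝒜 r) (𝒩' := zdeg 𝒜) LinearMap.id (AlgHom.id k B)
    (LinearMap.mulLeft k b) 0 0 (fun d m hm => by rw [add_zero]; exact hm)
    (fun _ _ h => h) (fun d m hm => by
      rw [add_comm]
      exact zdeg_mul_mem 𝒜 (d := ((0 : ℕ) : ℤ)) hb hm) i d f hd
  rw [add_zero, add_zero] at this
  exact mem_localCohDeg.2 ⟨r, _, extClass_mem_gextDeg this, rfl⟩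

section Aut

variable {n : ℕ} {ε : (Fin n → k) ≃ₐ[k] 𝒜 0}

theorem localCohAut_toLocalCoh (g : gradedAut 𝒜 ε) (i r : ℕ) (x : ExtQuo 𝒜 i r) :
    localCohAut 𝒜 g i (toLocalCoh 𝒜 i r x) = toLocalCoh 𝒜 i r (extAut 𝒜 g i r x) :=
  Module.DirectLimit.map_apply_of _ _ _

theorem localCohAut_mul (g h : gradedAut 𝒜 ε) (i : ℕ) (x : LocalCoh 𝒜 i) :
    localCohAut 𝒜 (g * h) i x = localCohAut 𝒜 g i (localCohAut 𝒜 h i x) := by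
  obtain ⟨r, -, f, hf, rfl⟩ := exists_toLocalCoh i 0 x
  rw [localCohAut_toLocalCoh, localCohAut_toLocalCoh, localCohAut_toLocalCoh]
  refine congrArg _ (congrArg Submodule.Quotient.mk (Subtype.ext ?_))
  funext m a
  obtain ⟨x⟩ := m
  rfl

theorem localCohAut_one (i : ℕ) (x : LocalCoh 𝒜 i) :
    localCohAut 𝒜 (1 : gradedAut 𝒜 ε) i x = x := by
  obtain ⟨r, -, f, hf, rfl⟩ := exists_toLocalCoh i 0 x
  rw [localCohAut_toLocalCoh]
  refine congrArg _ (congrArg Submodule.Quotient.mk (Subtype.ext ?_))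
  funext m a
  obtain ⟨x⟩ := m
  rfl

theorem localCohAut_injective (g : gradedAut 𝒜 ε) (i : ℕ) :
    Function.Injective (localCohAut 𝒜 g i) :=
  Function.LeftInverse.injective (g := localCohAut 𝒜 g⁻¹ i) fun x => by
    rw [← localCohAut_mul, inv_mul_cancel, localCohAut_one]

/-- Semilinearity: `H(g)(x b) = H(g)(x) g(b)`. On cochains it comes from `g⁻¹ (g(b) x) = b g⁻¹(x)`.
-/
theorem localCohAut_localCohRight (g : gradedAut 𝒜 ε) (i : ℕ) (b : B) (x : LocalCoh 𝒜 i) :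
    localCohAut 𝒜 g i (localCohRight 𝒜 i b x)
      = localCohRight 𝒜 i ((g : B ≃ₐ[k] B) b) (localCohAut 𝒜 g i x) := by
  obtain ⟨r, -, f, hf, rfl⟩ := exists_toLocalCoh i 0 x
  rw [localCohRight_toLocalCoh, localCohAut_toLocalCoh, localCohAut_toLocalCoh,
    localCohRight_toLocalCoh]
  refine congrArg _ (congrArg Submodule.Quotient.mk (Subtype.ext ?_))
  funext m a
  obtain ⟨x⟩ := m
  show (g : B ≃ₐ[k] B) (f (Submodule.Quotient.mk (b * (g : B ≃ₐ[k] B).symm x)) _)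
    = (g : B ≃ₐ[k] B) (f (Submodule.Quotient.mk ((g : B ≃ₐ[k] B).symm ((g : B ≃ₐ[k] B) b * x))) _)
  rw [map_mul, AlgEquiv.symm_apply_apply]
  rfl

theorem localCohAut_localCohLeft (g : gradedAut 𝒜 ε) (i : ℕ) (b : B) (x : LocalCoh 𝒜 i) :
    localCohAut 𝒜 g i (localCohLeft 𝒜 i b x)
      = localCohLeft 𝒜 i ((g : B ≃ₐ[k] B) b) (localCohAut 𝒜 g i x) := by
  obtain ⟨r, -, f, hf, rfl⟩ := exists_toLocalCoh i 0 x
  rw [localCohLeft_toLocalCoh, localCohAut_toLocalCoh, localCohAut_toLocalCoh,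
    localCohLeft_toLocalCoh]
  refine congrArg _ (congrArg Submodule.Quotient.mk (Subtype.ext ?_))
  funext m a
  exact map_mul (g : B ≃ₐ[k] B) _ _

theorem localCohAut_mem (g : gradedAut 𝒜 ε) (i : ℕ) {d : ℤ} {x : LocalCoh 𝒜 i}
    (hx : x ∈ localCohDeg 𝒜 i d) : localCohAut 𝒜 g i x ∈ localCohDeg 𝒜 i d := by
  obtain ⟨r, y, hy, rfl⟩ := mem_localCohDeg.1 hx
  obtain ⟨f, hf, hd, rfl⟩ := exists_extClass_of_mem hy
  rw [localCohAut_toLocalCoh]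
  have := barPull_mem_homCochain (ℳ' := quoDeg 𝒜 r) (𝒩' := zdeg 𝒜)
    (quoMap 𝒜 _ (gradedAut_mem_geq 𝒜 g⁻¹ r))
    ((g⁻¹ : gradedAut 𝒜 ε) : B ≃ₐ[k] B).toAlgHom (g : B ≃ₐ[k] B).toLinearMap 0 0
    (quoMap_mem_quoDeg 𝒜 _ _ 0 (gradedAut_mem_zdeg 𝒜 g⁻¹)) (gradedAut_mem 𝒜 g⁻¹)
    (gradedAut_mem_zdeg 𝒜 g) i d f hd
  rw [add_zero, add_zero] at this
  exact mem_localCohDeg.2 ⟨r, _, extClass_mem_gextDeg this, rfl⟩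

end Aut

end LocalCohomology

/-! ### From `Ext^i(S_j, B)` to local cohomology. -/

section SimpleExt

variable {k B : Type*} [Field k] [Ring B] [Algebra k B] (𝒜 : ℕ → Submodule k B)
  [GradedAlgebra 𝒜] {n : ℕ} (ε : (Fin n → k) ≃ₐ[k] 𝒜 0)

theorem isGradedAction_simpleRDeg (j : Fin n) :
    IsGradedAction 𝒜 (simpleRDeg 𝒜 (idem 𝒜 ε j)) := by
  rintro p q _ b ⟨y, hy, rfl⟩ hb
  exact ⟨MulOpposite.op b • y, zdeg_mul_mem 𝒜 (e := (q : ℤ)) hy hb, rfl⟩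

theorem idem_notMem_geq (j : Fin n) : idem 𝒜 ε j ∉ geq 𝒜 1 := fun h => by
  have h1 := trunc_of_mem_geq _ h
  rw [trunc_apply_of_mem (idem_mem 𝒜 ε j), if_pos Nat.one_pos] at h1
  have h2 : ε (Pi.single j 1) = 0 := Subtype.ext h1
  rw [map_eq_zero_iff ε ε.injective] at h2
  exact one_ne_zero (α := k) ((Pi.single_eq_same j 1).symm.trans (congrFun h2 j))

/-- The generator of `S_j^∨`. -/
def simpleLGen (j : Fin n) : SimpleL 𝒜 (idem 𝒜 ε j) :=
  Submodule.Quotient.mk ⟨idem 𝒜 ε j, Submodule.subset_span rfl⟩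

theorem exists_eq_smul_simpleLGen (j : Fin n) (x : SimpleL 𝒜 (idem 𝒜 ε j)) :
    ∃ c : k, x = c • simpleLGen 𝒜 ε j := by
  obtain ⟨⟨x, hx⟩⟩ := x
  obtain ⟨b, rfl⟩ := Submodule.mem_span_singleton.1 hx
  obtain ⟨c, -, hc⟩ := exists_idem_mul 𝒜 ε (trunc_one_mem 𝒜 b) j
  refine ⟨c, (Submodule.Quotient.eq _).2 ?_⟩
  show b * idem 𝒜 ε j - c • idem 𝒜 ε j ∈ geq 𝒜 1
  rw [← hc, ← sub_mul]
  exact mul_mem_geq_right (sub_trunc_mem_geq 1 b) _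

theorem smul_simpleLGen (j : Fin n) :
    idem 𝒜 ε j • simpleLGen 𝒜 ε j = simpleLGen 𝒜 ε j :=
  congrArg Submodule.Quotient.mk (Subtype.ext (idem_mul_self 𝒜 ε j))

theorem simpleLGen_ne_zero (j : Fin n) : simpleLGen 𝒜 ε j ≠ 0 := fun h =>
  idem_notMem_geq 𝒜 ε j
    ((Submodule.Quotient.mk_eq_zero ((geqL 𝒜 1).submoduleOf (leftGen (idem 𝒜 ε j)))).1 h)

theorem simpleLGen_mem (j : Fin n) : simpleLGen 𝒜 ε j ∈ simpleLDeg 𝒜 (idem 𝒜 ε j) 0 :=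
  ⟨_, idem_mem 𝒜 ε j, rfl⟩

/-- The projection `B / B_{≥ r} → S_j`. -/
def simpleProj {r : ℕ} (hr : 1 ≤ r) (j : Fin n) : Quo 𝒜 r →ₗ[k] SimpleR 𝒜 (idem 𝒜 ε j) :=
  orbit (fun x hx m => simpleR_smul_eq_zero 𝒜 ε j x (geq_anti 𝒜 hr hx) m) (simpleGen 𝒜 ε j)

theorem simpleProj_mem {r : ℕ} (hr : 1 ≤ r) (j : Fin n) (d : ℤ) :
    ∀ x ∈ quoDeg 𝒜 r d, simpleProj 𝒜 ε hr j x ∈ simpleRDeg 𝒜 (idem 𝒜 ε j) (d + 0) := by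
  rintro _ ⟨x, hx, rfl⟩
  rcases d with d | d
  · have := isGradedAction_simpleRDeg 𝒜 ε j 0 d _ x (simpleGen_mem 𝒜 ε j) hx
    rwa [add_comm] at this
  · rw [show x = 0 from hx, map_zero, map_zero]
    exact Submodule.zero_mem _

theorem isBarMap_simpleProj {r : ℕ} (hr : 1 ≤ r) (j : Fin n) :
    IsBarMap 𝒜 (simpleRDeg 𝒜 (idem 𝒜 ε j)) (zdeg 𝒜) (quoDeg 𝒜 r) (zdeg 𝒜)
      (pull (simpleProj 𝒜 ε hr j)) :=
  ⟨fun i f => barD_pull (orbit_op _ _) i f, fun _ _ hf =>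
    pull_mem_cochains 0 (simpleProj_mem 𝒜 ε hr j) hf⟩

/-- The map `Ext^i_B(S_j, B) → H^i(B)` given by the projections `B / B_{≥ r} → S_j`. -/
noncomputable def simpleToLocalCoh (i : ℕ) (j : Fin n) :
    GExt 𝒜 (simpleRDeg 𝒜 (idem 𝒜 ε j)) (zdeg 𝒜) i →ₗ[k] LocalCoh 𝒜 i :=
  toLocalCoh 𝒜 i 1 ∘ₗ extMap _ (isBarMap_simpleProj 𝒜 ε le_rfl j) i

/-- The definition uses stage `1`, while the pairing on `B / B_{≥ r}` needs the same class at stage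
`r`; the projections to `S_j` are compatible. -/
theorem simpleToLocalCoh_eq {r : ℕ} (hr : 1 ≤ r) (i : ℕ) (j : Fin n)
    (x : GExt 𝒜 (simpleRDeg 𝒜 (idem 𝒜 ε j)) (zdeg 𝒜) i) :
    simpleToLocalCoh 𝒜 ε i j x = toLocalCoh 𝒜 i r (extMap _ (isBarMap_simpleProj 𝒜 ε hr j) i x) := by
  obtain ⟨f, hf, rfl⟩ := exists_extClass x
  refine (Module.DirectLimit.of_f (hij := hr)).symm.trans (congrArg _ ?_)
  refine congrArg Submodule.Quotient.mk (Subtype.ext ?_)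
  funext m a
  obtain ⟨x⟩ := m
  rfl

theorem simpleToLocalCoh_mem {i : ℕ} {j : Fin n} {d : ℤ}
    {x : GExt 𝒜 (simpleRDeg 𝒜 (idem 𝒜 ε j)) (zdeg 𝒜) i}
    (hx : x ∈ gextDeg 𝒜 (simpleRDeg 𝒜 (idem 𝒜 ε j)) (zdeg 𝒜) i d) :
    simpleToLocalCoh 𝒜 ε i j x ∈ localCohDeg 𝒜 i d := by
  obtain ⟨f, hf, hd, rfl⟩ := exists_extClass_of_mem hx
  have := pull_mem_homCochain 0 (simpleProj_mem 𝒜 ε le_rfl j) hd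
  rw [add_zero] at this
  exact mem_localCohDeg.2 ⟨1, _, extClass_mem_gextDeg this, rfl⟩

theorem localCohRight_simpleToLocalCoh (i : ℕ) (j : Fin n)
    (x : GExt 𝒜 (simpleRDeg 𝒜 (idem 𝒜 ε j)) (zdeg 𝒜) i) :
    localCohRight 𝒜 i (idem 𝒜 ε j) (simpleToLocalCoh 𝒜 ε i j x)
      = simpleToLocalCoh 𝒜 ε i j x := by
  obtain ⟨f, hf, rfl⟩ := exists_extClass x
  refine (localCohRight_toLocalCoh i 1 _ _).trans (congrArg _ ?_)
  refine congrArg Submodule.Quotient.mk (Subtype.ext ?_)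
  funext m a
  obtain ⟨x⟩ := m
  show f (MulOpposite.op (idem 𝒜 ε j * x) • simpleGen 𝒜 ε j) _
    = f (MulOpposite.op x • simpleGen 𝒜 ε j) _
  rw [MulOpposite.op_mul, mul_smul, op_smul_simpleGen]
  rfl

theorem localCohLeft_simpleToLocalCoh (i : ℕ) (j : Fin n) (b : B)
    (x : GExt 𝒜 (simpleRDeg 𝒜 (idem 𝒜 ε j)) (zdeg 𝒜) i) :
    localCohLeft 𝒜 i b (simpleToLocalCoh 𝒜 ε i j x)
      = simpleToLocalCoh 𝒜 ε i j (extLeft 𝒜 (simpleRDeg 𝒜 (idem 𝒜 ε j)) i b x) := by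
  obtain ⟨f, hf, rfl⟩ := exists_extClass x
  exact localCohLeft_toLocalCoh i 1 _ _

/-- The class of `e_j` in `B / B_{≥ 1}` defines a right linear section of the projection to `S_j`,
so pulling back along the section inverts pulling back along the projection. -/
theorem extMap_simpleProj_injective (i : ℕ) (j : Fin n) :
    Function.Injective (extMap _ (isBarMap_simpleProj 𝒜 ε (le_refl 1) j) i) := by
  refine (injective_iff_map_eq_zero _).2 fun x hx => ?_
  obtain ⟨f, hf, rfl⟩ := exists_extClass x
  have hf' := (isBarMap_simpleProj 𝒜 ε (le_refl 1) j).cocycles_le i f hf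
  have h0 : pull (simpleProj 𝒜 ε (le_refl 1) j) i f ∈ coboundaries 𝒜 (quoDeg 𝒜 1) (zdeg 𝒜) i :=
    (extClass_eq_zero (hf := hf')).1 hx
  let m : Quo 𝒜 1 := Submodule.Quotient.mk (idem 𝒜 ε j)
  have hm : MulOpposite.op (idem 𝒜 ε j) • m = m :=
    congrArg Submodule.Quotient.mk (idem_mul_self 𝒜 ε j)
  let ι : SimpleR 𝒜 (idem 𝒜 ε j) →ₗ[k] Quo 𝒜 1 :=
    (simpleMap ε j m fun x hx => quo_smul_eq_zero 1 x hx m).restrictScalars k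
  have hι : ∀ c : k, ι (c • simpleGen 𝒜 ε j) = c • m := fun c => by
    rw [map_smul]; exact congrArg (c • ·) hm
  have hπι : ∀ x, simpleProj 𝒜 ε (le_refl 1) j (ι x) = x := fun x => by
    obtain ⟨c, rfl⟩ := exists_eq_smul_simpleGen 𝒜 ε j x
    rw [hι, map_smul]
    exact congrArg (c • ·) (op_smul_simpleGen 𝒜 ε j)
  have hιd : ∀ d, ∀ x ∈ simpleRDeg 𝒜 (idem 𝒜 ε j) d, ι x ∈ quoDeg 𝒜 1 (d + 0) := by
    intro d x hx
    by_cases hd : d = 0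
    · subst hd
      obtain ⟨c, rfl⟩ := exists_eq_smul_simpleGen 𝒜 ε j x
      rw [hι]
      exact Submodule.smul_mem _ _ ⟨_, idem_mem 𝒜 ε j, rfl⟩
    · rw [eq_zero_of_mem_simpleRDeg 𝒜 ε j hd hx, map_zero]
      exact Submodule.zero_mem _
  rw [extClass_eq_zero]
  have := pull_mem_coboundaries (ℳ' := simpleRDeg 𝒜 (idem 𝒜 ε j)) (α := ι)
    (fun b x => LinearMap.map_smul (simpleMap ε j m fun x hx => quo_smul_eq_zero 1 x hx m) _ _)
    (fun i f hf => pull_mem_cochains 0 hιd hf) h0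
  convert this using 1
  funext x a
  show f x a = f (simpleProj 𝒜 ε (le_refl 1) j (ι x)) a
  rw [hπι]

end SimpleExt

/-! ### The generating functional and the isomorphism with the graded dual. -/

section Gorenstein

variable {k B : Type*} [Field k] [Ring B] [Algebra k B] {𝒜 : ℕ → Submodule k B}
  [GradedAlgebra 𝒜] {n : ℕ} {ε : (Fin n → k) ≃ₐ[k] 𝒜 0} {N : ℕ} {σ : Equiv.Perm (Fin n)}
  {ℓ : Fin n → ℤ}

namespace IsGeneralizedGorenstein

/-- The generator of `S^∨_{σ(j)}` sits in degree `0`, which the shift by `ℓ_j` turns into degree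
`-ℓ_j` in Ext. -/
theorem exists_extGen (hB : IsGeneralizedGorenstein 𝒜 ε N σ ℓ) (j : Fin n) :
    ∃ x : GExt 𝒜 (simpleRDeg 𝒜 (idem 𝒜 ε j)) (zdeg 𝒜) N, x ≠ 0 ∧
      (∀ y, ∃ c : k, y = c • x) ∧
      x ∈ gextDeg 𝒜 (simpleRDeg 𝒜 (idem 𝒜 ε j)) (zdeg 𝒜) N (-ℓ j) ∧
      extLeft 𝒜 (simpleRDeg 𝒜 (idem 𝒜 ε j)) N (idem 𝒜 ε (σ j)) x = x := by
  obtain ⟨ψ, hψ, hd⟩ := hB.ext_iso j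
  refine ⟨ψ.symm (simpleLGen 𝒜 ε (σ j)), ?_, fun y => ?_, ?_, ?_⟩
  · exact fun h => simpleLGen_ne_zero 𝒜 ε (σ j) (ψ.symm.map_eq_zero_iff.1 h)
  · obtain ⟨c, hc⟩ := exists_eq_smul_simpleLGen 𝒜 ε (σ j) (ψ y)
    exact ⟨c, by rw [← map_smul, ← hc, ψ.symm_apply_apply]⟩
  · rw [hd, ψ.apply_symm_apply, neg_add_cancel]
    exact simpleLGen_mem 𝒜 ε (σ j)
  · apply ψ.injective
    rw [hψ, ψ.apply_symm_apply, smul_simpleLGen]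

theorem extVanishes_simple (hB : IsGeneralizedGorenstein 𝒜 ε N σ ℓ) {i : ℕ} (hi : i ≠ N)
    (j : Fin n) : ExtVanishes 𝒜 (simpleRDeg 𝒜 (idem 𝒜 ε j)) i :=
  extVanishes_of_subsingleton_gExt (hB.ext_eq_zero j i hi)

theorem finiteDimensional_quoKer (hB : IsGeneralizedGorenstein 𝒜 ε N σ ℓ) (r s : ℕ) :
    FiniteDimensional k (quoKer 𝒜 r s) :=
  have := finiteDimensional_quo (𝒜 := 𝒜) hB.locallyFinite s
  Module.Finite.of_injective ((quoKer 𝒜 r s).subtype.restrictScalars k) Subtype.val_injective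

/-- The kernels of the transition projections are finite dimensional and killed by `B_{≥ s}`, so
their `Ext^{N-1}` vanishes by induction from the `S_j`. -/
theorem toLocalCoh_injective (hB : IsGeneralizedGorenstein 𝒜 ε N σ ℓ) (r : ℕ) :
    Function.Injective (toLocalCoh 𝒜 N r) :=
  HomDet.toLocalCoh_injective fun s _ j hj =>
    have := hB.finiteDimensional_quoKer r s
    extVanishes_of_simple ε (hB.extVanishes_simple (by omega)) (isGradedModule_quoKerDeg r s)
      (r := s) fun x hx m => Subtype.ext (quo_smul_eq_zero s x hx m)

theorem simpleToLocalCoh_injective (hB : IsGeneralizedGorenstein 𝒜 ε N σ ℓ) (j : Fin n) :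
    Function.Injective (simpleToLocalCoh 𝒜 ε N j) :=
  (hB.toLocalCoh_injective 1).comp (extMap_simpleProj_injective 𝒜 ε N j)

end IsGeneralizedGorenstein

/-- A functional on `H^N(B)` that generates it as a right module over its graded dual: it is
concentrated in bidegrees `e_{σ(b)} H^N(B)_{-ℓ_b} e_b` and maps the elements `u b` of the socle
to `1`. -/
structure IsGeneratingFunctional (ε : (Fin n → k) ≃ₐ[k] 𝒜 0) (N : ℕ) (σ : Equiv.Perm (Fin n))
    (ℓ : Fin n → ℤ) (t : LocalCoh 𝒜 N →ₗ[k] k) (u : Fin n → LocalCoh 𝒜 N) : Prop where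
  mem : ∀ b, u b ∈ localCohDeg 𝒜 N (-ℓ b)
  right : ∀ b, localCohRight 𝒜 N (idem 𝒜 ε b) (u b) = u b
  left : ∀ b, localCohLeft 𝒜 N (idem 𝒜 ε (σ b)) (u b) = u b
  apply_u : ∀ b, t (u b) = 1
  apply_deg : ∀ b d, d ≠ -ℓ b → ∀ x ∈ localCohDeg 𝒜 N d,
    t (localCohRight 𝒜 N (idem 𝒜 ε b) x) = 0
  apply_left : ∀ b x, t (localCohLeft 𝒜 N (idem 𝒜 ε (σ b)) (localCohRight 𝒜 N (idem 𝒜 ε b) x))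
    = t (localCohRight 𝒜 N (idem 𝒜 ε b) x)

/-- By independence of the grading `u` lies outside the sum of the other pieces, so some functional
vanishes on that sum but not on `u`. -/
theorem exists_functional_of_ne_zero {i : ℕ} {d : ℤ} {u : LocalCoh 𝒜 i}
    (hu : u ∈ localCohDeg 𝒜 i d) (h0 : u ≠ 0) : ∃ t : LocalCoh 𝒜 i →ₗ[k] k, t u = 1 ∧
      ∀ e, e ≠ d → ∀ x ∈ localCohDeg 𝒜 i e, t x = 0 := by
  have h1 : u ∉ ⨆ e, ⨆ (_ : e ≠ d), localCohDeg 𝒜 i e := fun h =>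
    h0 (Submodule.disjoint_def.1 (iSupIndep_localCohDeg i d) u hu h)
  obtain ⟨t, ht, hker⟩ := Submodule.exists_le_ker_of_notMem h1
  refine ⟨(t u)⁻¹ • t, ?_, fun e he x hx => ?_⟩
  · rw [LinearMap.smul_apply, smul_eq_mul, inv_mul_cancel₀ ht]
  · have : t x = 0 := hker (Submodule.mem_iSup_of_mem e (Submodule.mem_iSup_of_mem he hx))
    rw [LinearMap.smul_apply, this, smul_zero]

theorem localCohRight_zero (i : ℕ) (x : LocalCoh 𝒜 i) : localCohRight 𝒜 i 0 x = 0 := by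
  have := localCohRight_smul i (0 : k) 0 x
  rwa [zero_smul, zero_smul] at this

theorem IsGeneralizedGorenstein.exists_generatingFunctional
    (hB : IsGeneralizedGorenstein 𝒜 ε N σ ℓ) : ∃ t u, IsGeneratingFunctional ε N σ ℓ t u ∧
      ∀ j, ∃ x : GExt 𝒜 (simpleRDeg 𝒜 (idem 𝒜 ε j)) (zdeg 𝒜) N, (∀ y, ∃ c : k, y = c • x) ∧
        simpleToLocalCoh 𝒜 ε N j x = u j := by
  choose x hx0 hx hxd hxl using hB.exists_extGen
  have h1 := fun j => exists_functional_of_ne_zero (simpleToLocalCoh_mem 𝒜 ε (hxd j))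
    fun h => hx0 j (hB.simpleToLocalCoh_injective j (h.trans (map_zero _).symm))
  choose t ht htd using h1
  have hr : ∀ b, localCohRight 𝒜 N (idem 𝒜 ε b) (simpleToLocalCoh 𝒜 ε N b (x b))
      = simpleToLocalCoh 𝒜 ε N b (x b) := fun b => localCohRight_simpleToLocalCoh 𝒜 ε N b (x b)
  have hl : ∀ b, localCohLeft 𝒜 N (idem 𝒜 ε (σ b)) (simpleToLocalCoh 𝒜 ε N b (x b))
      = simpleToLocalCoh 𝒜 ε N b (x b) := fun b => by
    rw [localCohLeft_simpleToLocalCoh, hxl]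
  -- Sandwiching each `t b` between `e_{σ(b)}` and `e_b` forces the support into the required
  -- bidegrees without changing the value on `u b`.
  let T : LocalCoh 𝒜 N →ₗ[k] k := ∑ b, t b ∘ₗ localCohLeft 𝒜 N (idem 𝒜 ε (σ b)) ∘ₗ
    localCohRight 𝒜 N (idem 𝒜 ε b)
  have hT : ∀ b y, T (localCohRight 𝒜 N (idem 𝒜 ε b) y)
      = t b (localCohLeft 𝒜 N (idem 𝒜 ε (σ b)) (localCohRight 𝒜 N (idem 𝒜 ε b) y)) := by
    intro b y
    simp only [T, LinearMap.sum_apply, LinearMap.comp_apply]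
    rw [Finset.sum_eq_single b, ← localCohRight_mul, idem_mul_self]
    · intro c _ hc
      rw [← localCohRight_mul, idem_mul_of_ne 𝒜 ε hc.symm, localCohRight_zero, map_zero, map_zero]
    · simp
  refine ⟨T, fun b => simpleToLocalCoh 𝒜 ε N b (x b),
    ⟨fun b => simpleToLocalCoh_mem 𝒜 ε (hxd b), hr, hl, fun b => ?_, fun b d hd y hy => ?_,
      fun b y => ?_⟩, fun j => ⟨x j, hx j, rfl⟩⟩
  · rw [← hr b, hT, hr, hl, ht]
  · rw [hT]
    refine htd b d hd _ (localCohLeft_mem N (idem_mem 𝒜 ε _) ?_)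
    have := localCohRight_mem N (idem_mem 𝒜 ε b) hy
    rwa [Nat.cast_zero, add_zero] at this
  · rw [localCohLeft_localCohRight, hT, hT, ← localCohLeft_localCohRight, ← localCohLeft_mul,
      idem_mul_self]

theorem mem_gradedDual_iff {φ : Module.Dual k B} :
    φ ∈ gradedDual 𝒜 ↔ ∃ r, ∀ x ∈ geq 𝒜 r, φ x = 0 := by
  constructor
  · intro h
    induction h using Submodule.iSup_induction' with
    | zero => exact ⟨0, fun _ _ => rfl⟩
    | add φ ψ _ _ hφ hψ =>
      obtain ⟨r, hr⟩ := hφ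
      obtain ⟨s, hs⟩ := hψ
      exact ⟨max r s, fun x hx => by
        rw [LinearMap.add_apply, hr x (geq_anti 𝒜 (le_max_left _ _) hx),
          hs x (geq_anti 𝒜 (le_max_right _ _) hx), add_zero]⟩
    | mem d φ hφ =>
      have : geq 𝒜 (d + 1) ≤ LinearMap.ker φ := iSup_le fun i x hx => hφ i (by have := i.2; omega) x hx
      exact ⟨d + 1, fun x hx => this hx⟩
  · rintro ⟨r, hr⟩
    have : φ = ∑ i ∈ Finset.range r, φ ∘ₗ GradedAlgebra.proj 𝒜 i := by
      refine LinearMap.ext fun x => ?_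
      have h1 := hr _ (sub_trunc_mem_geq r x)
      rw [map_sub, sub_eq_zero] at h1
      rw [h1, trunc, LinearMap.sum_apply, LinearMap.sum_apply, map_sum]
      rfl
    rw [this]
    refine Submodule.sum_mem _ fun i _ => Submodule.mem_iSup_of_mem i fun j hj x hx => ?_
    rw [LinearMap.comp_apply, show GradedAlgebra.proj 𝒜 i x = 0 from
      DirectSum.decompose_of_mem_ne 𝒜 hx hj, map_zero]

theorem localCohRight_toLocalCoh_eq_zero (i r : ℕ) (y : ExtQuo 𝒜 i r) {b : B} (hb : b ∈ geq 𝒜 r) :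
    localCohRight 𝒜 i b (toLocalCoh 𝒜 i r y) = 0 := by
  obtain ⟨f, hf, rfl⟩ := exists_extClass y
  rw [localCohRight_toLocalCoh, ← map_zero (toLocalCoh 𝒜 i r)]
  refine congrArg _ (congrArg Submodule.Quotient.mk (Subtype.ext ?_))
  funext m a
  obtain ⟨x⟩ := m
  show f (Submodule.Quotient.mk (b * x)) a = 0
  rw [(Submodule.Quotient.mk_eq_zero (geqR 𝒜 r)).2 (mul_mem_geq_right hb x),
    (isMultilinear_of_mem_cochains hf.1).map_zero]

/-- The functional `b ↦ t (x b)` on `B`. -/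
noncomputable def matrixCoeff {i : ℕ} (t : LocalCoh 𝒜 i →ₗ[k] k) (x : LocalCoh 𝒜 i) :
    Module.Dual k B where
  toFun b := t (localCohRight 𝒜 i b x)
  map_add' b c := by rw [localCohRight_add, map_add]
  map_smul' c b := by rw [localCohRight_smul, map_smul, RingHom.id_apply]

theorem matrixCoeff_apply {i : ℕ} (t : LocalCoh 𝒜 i →ₗ[k] k) (x : LocalCoh 𝒜 i) (b : B) :
    matrixCoeff t x b = t (localCohRight 𝒜 i b x) := rfl

theorem matrixCoeff_mem {i : ℕ} (t : LocalCoh 𝒜 i →ₗ[k] k) (x : LocalCoh 𝒜 i) :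
    matrixCoeff t x ∈ gradedDual 𝒜 := by
  obtain ⟨r, -, f, hf, rfl⟩ := exists_toLocalCoh i 0 x
  refine mem_gradedDual_iff.2 ⟨r, fun b hb => ?_⟩
  rw [matrixCoeff_apply, localCohRight_toLocalCoh_eq_zero i r _ hb, map_zero]

/-- The map `H^i(B) → B^∨` given by a functional `t` on `H^i(B)`, namely `x ↦ (b ↦ t (x b))`. -/
noncomputable def dualMap {i : ℕ} (t : LocalCoh 𝒜 i →ₗ[k] k) :
    LocalCoh 𝒜 i →ₗ[k] gradedDual 𝒜 where
  toFun x := ⟨matrixCoeff t x, matrixCoeff_mem t x⟩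
  map_add' x y := Subtype.ext <| LinearMap.ext fun b => by
    rw [matrixCoeff_apply, map_add, map_add]
    rfl
  map_smul' c x := Subtype.ext <| LinearMap.ext fun b => by
    rw [matrixCoeff_apply, map_smul, map_smul]
    rfl

/-- Extending the functional from cocycles to all cochains lets it be evaluated on pullbacks before
they are known to be cocycles. -/
theorem exists_extension {i : ℕ} (t : LocalCoh 𝒜 i →ₗ[k] k) (r : ℕ) :
    ∃ T : (Quo 𝒜 r → (Fin i → B) → B) →ₗ[k] k,
      (∀ f ∈ coboundaries 𝒜 (quoDeg 𝒜 r) (zdeg 𝒜) i, T f = 0) ∧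
      ∀ f hf, T f = t (toLocalCoh 𝒜 i r (extClass (quoDeg 𝒜 r) f hf)) := by
  obtain ⟨T, hT⟩ := LinearMap.exists_extend (t ∘ₗ toLocalCoh 𝒜 i r ∘ₗ
    Submodule.mkQ ((coboundaries 𝒜 (quoDeg 𝒜 r) (zdeg 𝒜) i).submoduleOf
      (cocycles 𝒜 (quoDeg 𝒜 r) (zdeg 𝒜) i)))
  have h : ∀ f hf, T f = t (toLocalCoh 𝒜 i r (extClass (quoDeg 𝒜 r) f hf)) :=
    fun f hf => LinearMap.congr_fun hT ⟨f, hf⟩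
  refine ⟨T, fun f hf => ?_, h⟩
  rw [h f (coboundaries_le_cocycles (isGradedAction_zdeg 𝒜) (isGradedModule_quoDeg r).act
    (isGradedAction_zdeg 𝒜) i hf), extClass_eq_zero.2 hf, map_zero, map_zero]

/-- Base case of the duality: `S_j` and `Ext^N(S_j, B)` are each spanned by one vector, and these
pair to `1`. -/
theorem isPerfect_simple {t : LocalCoh 𝒜 N →ₗ[k] k} {j : Fin n}
    {x : GExt 𝒜 (simpleRDeg 𝒜 (idem 𝒜 ε j)) (zdeg 𝒜) N} (hx : ∀ y, ∃ c : k, y = c • x)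
    (ht : t (simpleToLocalCoh 𝒜 ε N j x) = 1) {r : ℕ} (hr : 1 ≤ r)
    {T : (Quo 𝒜 r → (Fin N → B) → B) →ₗ[k] k}
    (hT : ∀ f hf, T f = t (toLocalCoh 𝒜 N r (extClass (quoDeg 𝒜 r) f hf))) :
    IsPerfect (simpleRDeg 𝒜 (idem 𝒜 ε j)) N T
      fun x hx m => simpleR_smul_eq_zero 𝒜 ε j x (geq_anti 𝒜 hr hx) m := by
  have key : ∀ f hf, T (pull (simpleProj 𝒜 ε hr j) N f)
      = t (simpleToLocalCoh 𝒜 ε N j (extClass (simpleRDeg 𝒜 (idem 𝒜 ε j)) f hf)) := by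
    intro f hf
    rw [hT _ ((isBarMap_simpleProj 𝒜 ε hr j).cocycles_le N f hf), simpleToLocalCoh_eq 𝒜 ε hr]
    rfl
  refine ⟨fun f hf h0 => ?_, fun φ => ?_⟩
  · obtain ⟨c, hc⟩ := hx (extClass (simpleRDeg 𝒜 (idem 𝒜 ε j)) f hf)
    have h1 : T (pull (simpleProj 𝒜 ε hr j) N f) = 0 := h0 (simpleGen 𝒜 ε j)
    rw [key f hf, hc, map_smul, map_smul, ht, smul_eq_mul, mul_one] at h1
    rw [← extClass_eq_zero (hf := hf), hc, h1, zero_smul]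
  · obtain ⟨f, hf, rfl⟩ := exists_extClass x
    refine ⟨φ (simpleGen 𝒜 ε j) • f, Submodule.smul_mem _ _ hf, fun m => ?_⟩
    obtain ⟨c, rfl⟩ := exists_eq_smul_simpleGen 𝒜 ε j m
    rw [pull_orbit_smul _ (isMultilinear_of_mem_cochains (Submodule.smul_mem _ _ hf.1)), map_smul,
      map_smul, map_smul, map_smul]
    change c • φ (simpleGen 𝒜 ε j) • T (pull (simpleProj 𝒜 ε hr j) N f) = _
    rw [key f hf, ht, smul_eq_mul, smul_eq_mul, mul_one]
    rfl

theorem IsGeneralizedGorenstein.dualMap_bijective (hB : IsGeneralizedGorenstein 𝒜 ε N σ ℓ)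
    {t : LocalCoh 𝒜 N →ₗ[k] k}
    (h : ∀ j, ∃ x : GExt 𝒜 (simpleRDeg 𝒜 (idem 𝒜 ε j)) (zdeg 𝒜) N, (∀ y, ∃ c : k, y = c • x) ∧
        t (simpleToLocalCoh 𝒜 ε N j x) = 1) : Function.Bijective (dualMap t) := by
  have hp : ∀ r, 1 ≤ r → ∃ T : (Quo 𝒜 r → (Fin N → B) → B) →ₗ[k] k,
      (∀ f hf, T f = t (toLocalCoh 𝒜 N r (extClass (quoDeg 𝒜 r) f hf))) ∧
      IsPerfect (quoDeg 𝒜 r) N T (quo_smul_eq_zero r) := by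
    intro r hr
    obtain ⟨T, hT0, hT⟩ := exists_extension t r
    have := finiteDimensional_quo (𝒜 := 𝒜) hB.locallyFinite r
    refine ⟨T, hT, isPerfect_of_simple ε hr hT0 (hB.extVanishes_simple (by omega)) (fun j => ?_)
      (isGradedModule_quoDeg r) (quo_smul_eq_zero r)⟩
    obtain ⟨x, hx, htx⟩ := h j
    exact isPerfect_simple hx htx hr hT
  -- For the class of `b` in `B / B_{≥ r}`, the map `x ↦ b x` is the one defining the right action
  -- of `b`, so the pairing with that class is `t (x b)`.
  have key : ∀ {r : ℕ} {T : (Quo 𝒜 r → (Fin N → B) → B) →ₗ[k] k},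
      (∀ f hf, T f = t (toLocalCoh 𝒜 N r (extClass (quoDeg 𝒜 r) f hf))) → ∀ f hf (b : B),
      T (pull (orbit (quo_smul_eq_zero r) (Submodule.Quotient.mk b : Quo 𝒜 r)) N f)
        = t (localCohRight 𝒜 N b (toLocalCoh 𝒜 N r (extClass (quoDeg 𝒜 r) f hf))) := by
    intro r T hT f hf b
    rw [localCohRight_toLocalCoh]
    have hb := (isBarMap_right 𝒜 r b).cocycles_le N f hf
    have : pull (orbit (quo_smul_eq_zero r) (Submodule.Quotient.mk b : Quo 𝒜 r)) N f
        = barPull (quoMap 𝒜 (LinearMap.mulLeft k b) fun _ h => mul_mem_geq_left b h)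
        (AlgHom.id k B) (LinearMap.id : B →ₗ[k] B) N f := by
      funext m a
      obtain ⟨x⟩ := m
      rfl
    rw [this, hT _ hb]
    rfl
  constructor
  · refine (injective_iff_map_eq_zero _).2 fun x hx => ?_
    obtain ⟨r, hr, f, hf, rfl⟩ := exists_toLocalCoh N 1 x
    obtain ⟨T, hT, hP⟩ := hp r hr
    rw [extClass_eq_zero.2 (hP.inj f hf ?_), map_zero]
    rintro ⟨b⟩
    exact (key hT f hf b).trans (LinearMap.congr_fun (congrArg Subtype.val hx) b)
  · rintro ⟨φ, hφ⟩
    obtain ⟨r, hr⟩ := mem_gradedDual_iff.1 hφ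
    -- The stage must be at least `1` for the projections to the `S_j` to exist, hence `r + 1`
    -- rather than `r`.
    obtain ⟨T, hT, hP⟩ := hp (r + 1) (by omega)
    obtain ⟨f, hf, hfφ⟩ := hP.surj (liftK (geqR 𝒜 (r + 1)) φ fun x hx =>
      hr x (geq_anti 𝒜 (Nat.le_succ r) hx))
    refine ⟨toLocalCoh 𝒜 N (r + 1) (extClass (quoDeg 𝒜 (r + 1)) f hf),
      Subtype.ext (LinearMap.ext fun b => ?_)⟩
    exact (key hT f hf b).symm.trans (hfφ (Submodule.Quotient.mk b))

end Gorenstein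

/-! ### Coordinate functionals, uniqueness and multiplicativity of the scalars. -/

section Algebra

variable {k B : Type*} [Field k] [Ring B] [Algebra k B] {𝒜 : ℕ → Submodule k B}
  [GradedAlgebra 𝒜] {n : ℕ} {ε : (Fin n → k) ≃ₐ[k] 𝒜 0} {N : ℕ}

theorem linearMap_ext_homogeneous {M : Type*} [AddCommGroup M] [Module k M] {φ ψ : B →ₗ[k] M}
    (h : ∀ i, ∀ y ∈ 𝒜 i, φ y = ψ y) : φ = ψ := by
  refine LinearMap.ext fun y => ?_
  induction y using DirectSum.Decomposition.inductionOn 𝒜 with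
  | zero => rw [map_zero, map_zero]
  | add x y hx hy => rw [map_add, map_add, hx, hy]
  | @homogeneous i y => exact h i y y.2

theorem linearMap_ext_mul_idem (ε : (Fin n → k) ≃ₐ[k] 𝒜 0) {M : Type*} [AddCommGroup M]
    [Module k M] {φ ψ : B →ₗ[k] M}
    (h : ∀ b i, ∀ y ∈ 𝒜 i, φ (y * idem 𝒜 ε b) = ψ (y * idem 𝒜 ε b)) : φ = ψ := by
  refine linearMap_ext_homogeneous (𝒜 := 𝒜) fun i y hy => ?_
  rw [← mul_one y, ← sum_idem 𝒜 ε, Finset.mul_sum, map_sum, map_sum]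
  exact Finset.sum_congr rfl fun b _ => h b i y hy

/-- The algebra homomorphism `B → B_0 → k` given by the `s`-th coordinate. -/
noncomputable def coord (ε : (Fin n → k) ≃ₐ[k] 𝒜 0) (s : Fin n) : B →ₐ[k] k :=
  (Pi.evalAlgHom k (fun _ : Fin n => k) s).comp
    (ε.symm.toAlgHom.comp
      { GradedRing.projZeroRingHom' 𝒜 with
        commutes' := fun c => Subtype.ext <|
          DirectSum.decompose_of_mem_same 𝒜 (algebraMap k (𝒜 0) c).2 })

theorem coord_of_ne {s : Fin n} {i : ℕ} (hi : i ≠ 0) {y : B} (hy : y ∈ 𝒜 i) :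
    coord ε s y = 0 := by
  have : (GradedRing.projZeroRingHom' 𝒜 y : 𝒜 0) = 0 := Subtype.ext <|
    DirectSum.decompose_of_mem_ne 𝒜 hy hi
  show ε.symm (GradedRing.projZeroRingHom' 𝒜 y) s = 0
  rw [this, map_zero]
  rfl

theorem coord_mem (s : Fin n) : (coord ε s).toLinearMap ∈ gradedDual 𝒜 :=
  Submodule.mem_iSup_of_mem 0 fun _ hi _ hx => coord_of_ne hi hx

theorem coord_idem (s : Fin n) : coord ε s (idem 𝒜 ε s) = 1 := by
  have : (GradedRing.projZeroRingHom' 𝒜 (idem 𝒜 ε s) : 𝒜 0) = ε (Pi.single s 1) := Subtype.ext <|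
    DirectSum.decompose_of_mem_same 𝒜 (idem_mem 𝒜 ε s)
  show ε.symm (GradedRing.projZeroRingHom' 𝒜 (idem 𝒜 ε s)) s = 1
  rw [this, ε.symm_apply_apply, Pi.single_eq_same]

theorem gradedAut_apply_of_mem_zero (g : gradedAut 𝒜 ε) {y : B} (hy : y ∈ 𝒜 0) :
    (g : B ≃ₐ[k] B) y = y := by
  obtain ⟨c, rfl⟩ := exists_eq_sum_idem 𝒜 ε hy
  rw [map_sum]
  exact Finset.sum_congr rfl fun j _ => by rw [map_smul, g.2.2]

/-- An automorphism fixing the idempotents fixes `B_0` pointwise and preserves positive degrees,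
where the coordinate vanishes. -/
theorem coord_comp_gradedAut (g : gradedAut 𝒜 ε) (s : Fin n) :
    (coord ε s).toLinearMap ∘ₗ ((g : B ≃ₐ[k] B)⁻¹).toLinearMap = (coord ε s).toLinearMap := by
  refine linearMap_ext_homogeneous (𝒜 := 𝒜) fun i y hy => ?_
  show coord ε s (((g⁻¹ : gradedAut 𝒜 ε) : B ≃ₐ[k] B) y) = coord ε s y
  rcases eq_or_ne i 0 with rfl | hi
  · rw [gradedAut_apply_of_mem_zero _ hy]
  · rw [coord_of_ne hi hy, coord_of_ne hi (gradedAut_mem 𝒜 g⁻¹ i y hy)]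

section Uniqueness

variable {θ θ' : LocalCoh 𝒜 N ≃ₗ[k] gradedDual 𝒜} {g h : gradedAut 𝒜 ε} {c c' : Fin n → k}

/-- The coordinate functional lies in `e_s B^∨` and is `g`-invariant, so it is an eigenvector. The
factor `a` allows for a second isomorphism that matches `w` with the coordinate only up to scale. -/
theorem IsScaledBy.localCohAut_eq_smul (hc : IsScaledBy 𝒜 θ g c) {s : Fin n} {w : LocalCoh 𝒜 N}
    {a : k} (hw : (θ w : Module.Dual k B) = a • (coord ε s).toLinearMap) :
    localCohAut 𝒜 g N w = c s • w := by
  apply θ.injective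
  apply Subtype.ext
  have h1 := hc s w fun y => by
    rw [hw]
    show a • coord ε s (y * idem 𝒜 ε s) = a • coord ε s y
    rw [map_mul, coord_idem, mul_one]
  rw [h1, map_smul, Submodule.coe_smul, hw, LinearMap.smul_comp, coord_comp_gradedAut]

theorem IsScaledBy.unique (hθ : IsRightLinear 𝒜 θ) (hθ' : IsRightLinear 𝒜 θ')
    (hc : IsScaledBy 𝒜 θ g c) (hc' : IsScaledBy 𝒜 θ' g c') : c = c' := by
  funext s
  set w := θ.symm ⟨_, coord_mem (ε := ε) s⟩ with hw
  have hθw : (θ w : Module.Dual k B) = (coord ε s).toLinearMap := by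
    rw [hw, θ.apply_symm_apply]
  -- This property of `w` is intrinsic to the right module `H^N(B)`, so it can be transported
  -- through `θ'`.
  have h1 : ∀ y, localCohRight 𝒜 N y w = coord ε s y • w := fun y => by
    apply θ.injective
    apply Subtype.ext
    rw [hθ, map_smul, Submodule.coe_smul, hθw]
    exact LinearMap.ext fun z => map_mul (coord ε s) y z
  have h2 : (θ' w : Module.Dual k B) = (θ' w : Module.Dual k B) 1 • (coord ε s).toLinearMap := by
    refine LinearMap.ext fun y => ?_
    -- Evaluating at `1` determines the whole functional `θ' w` from its value there.
    have h3 := LinearMap.congr_fun (hθ' y w) 1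
    rw [h1, map_smul, Submodule.coe_smul, LinearMap.comp_apply, LinearMap.mulLeft_apply,
      mul_one] at h3
    rw [← h3, LinearMap.smul_apply, LinearMap.smul_apply, smul_eq_mul, smul_eq_mul, mul_comm]
    rfl
  have h4 : w ≠ 0 := fun h0 => by
    rw [h0, map_zero] at hθw
    have := LinearMap.congr_fun hθw (idem 𝒜 ε s)
    exact zero_ne_one (this.trans (coord_idem s))
  have h5 := hc.localCohAut_eq_smul (a := 1) (hθw.trans (one_smul _ _).symm)
  rw [hc'.localCohAut_eq_smul h2] at h5
  exact (smul_left_injective k h4 h5).symm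

theorem IsScaledBy.hdet_eq (hθ : IsRightLinear 𝒜 θ) (hc : IsScaledBy 𝒜 θ g c) :
    Hdet 𝒜 N g = Matrix.diagonal fun s => (c s)⁻¹ := by
  have h : ∃ c : Fin n → k, ∃ θ : LocalCoh 𝒜 N ≃ₗ[k] gradedDual 𝒜,
    IsRightLinear 𝒜 θ ∧ IsScaledBy 𝒜 θ g c := ⟨c, θ, hθ, hc⟩
  obtain ⟨θ', hθ', hc'⟩ := h.choose_spec
  rw [Hdet, dif_pos h, hc'.unique hθ' hθ hc]

theorem IsScaledBy.one : IsScaledBy 𝒜 θ (1 : gradedAut 𝒜 ε) 1 := fun s x _ => by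
  rw [localCohAut_one, Pi.one_apply, one_smul]
  rfl

/-- The scaling rule for `g` can be applied after that of `h` because `h⁻¹` fixes `e_s`, so `φ ∘
h⁻¹` is again in `e_s B^∨`. -/
theorem IsScaledBy.mul (hg : IsScaledBy 𝒜 θ g c) (hh : IsScaledBy 𝒜 θ h c') :
    IsScaledBy 𝒜 θ (g * h) (c * c') := fun s x hx => by
  have h1 := hh s x hx
  rw [localCohAut_mul, hg s _ fun y => ?_, h1]
  · refine LinearMap.ext fun y => ?_
    show c s • c' s • (θ x : Module.Dual k B) _ = (c s * c' s) • (θ x : Module.Dual k B) _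
    rw [smul_smul]
    rfl
  · rw [h1]
    show c' s • (θ x : Module.Dual k B) (((h⁻¹ : gradedAut 𝒜 ε) : B ≃ₐ[k] B) (y * idem 𝒜 ε s))
      = c' s • (θ x : Module.Dual k B) (((h⁻¹ : gradedAut 𝒜 ε) : B ≃ₐ[k] B) y)
    rw [map_mul, (h⁻¹).2.2, hx]

end Uniqueness

end Algebra

/-! ### How automorphisms act on the generating functional. -/

section Gorenstein

variable {k B : Type*} [Field k] [Ring B] [Algebra k B] {𝒜 : ℕ → Submodule k B}
  [GradedAlgebra 𝒜] {n : ℕ} {ε : (Fin n → k) ≃ₐ[k] 𝒜 0} {N : ℕ} {σ : Equiv.Perm (Fin n)}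
  {ℓ : Fin n → ℤ} {t : LocalCoh 𝒜 N →ₗ[k] k} {u : Fin n → LocalCoh 𝒜 N}

theorem sum_localCohRight_idem (ε : (Fin n → k) ≃ₐ[k] 𝒜 0) {i : ℕ} (t : LocalCoh 𝒜 i →ₗ[k] k)
    (x : LocalCoh 𝒜 i) : t x = ∑ b, t (localCohRight 𝒜 i (idem 𝒜 ε b) x) := by
  have h := map_sum (matrixCoeff t x) (fun b => idem 𝒜 ε b) Finset.univ
  rw [sum_idem, matrixCoeff_apply, localCohRight_one] at h
  exact h

theorem eq_of_dualMap_injective (ε : (Fin n → k) ≃ₐ[k] 𝒜 0)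
    (ht : Function.Injective (dualMap t)) {x y : LocalCoh 𝒜 N}
    (h : ∀ b i, ∀ z ∈ 𝒜 i, t (localCohRight 𝒜 N (z * idem 𝒜 ε b) x)
      = t (localCohRight 𝒜 N (z * idem 𝒜 ε b) y)) : x = y :=
  ht (Subtype.ext (linearMap_ext_mul_idem ε (φ := matrixCoeff t x) (ψ := matrixCoeff t y) h))

namespace IsGeneratingFunctional

theorem apply_mul_idem (H : IsGeneratingFunctional ε N σ ℓ t u) {d : ℤ} {x : LocalCoh 𝒜 N}
    (hx : x ∈ localCohDeg 𝒜 N d) {b : Fin n} {i : ℕ} (hi : d + i ≠ -ℓ b) {y : B} (hy : y ∈ 𝒜 i) :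
    t (localCohRight 𝒜 N (y * idem 𝒜 ε b) x) = 0 := by
  rw [localCohRight_mul]
  exact H.apply_deg b _ hi _ (localCohRight_mem N hy hx)

/-- For the converse, `x` is split into components. Once `b` and `i` are fixed, only one degree `e`
contributes to `t (x y e_b)`, namely `e = -ℓ_b - i`; so the vanishing of these values for `e ≠ d`
passes to the single component `f e`, which is then zero. -/
theorem mem_localCohDeg_iff (H : IsGeneratingFunctional ε N σ ℓ t u)
    (ht : Function.Injective (dualMap t)) {d : ℤ} {x : LocalCoh 𝒜 N} :
    x ∈ localCohDeg 𝒜 N d ↔ ∀ (b : Fin n) (i : ℕ), -(i : ℤ) ≠ d + ℓ b →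
      ∀ y ∈ 𝒜 i, t (localCohRight 𝒜 N (y * idem 𝒜 ε b) x) = 0 := by
  refine ⟨fun hx b i hi y hy => H.apply_mul_idem hx (by omega) hy, fun h => ?_⟩
  obtain ⟨f, hf, rfl⟩ := (Submodule.mem_iSup_iff_exists_finsupp _ x).1
    (show x ∈ ⨆ d, localCohDeg 𝒜 N d by rw [iSup_localCohDeg]; trivial)
  have h0 : ∀ e, e ≠ d → f e = 0 := fun e he => by
    refine eq_of_dualMap_injective ε ht fun b i y hy => ?_
    rw [map_zero, map_zero]
    by_cases hi : e + i = -ℓ b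
    · rw [← h b i (by omega) y hy, Finsupp.sum, map_sum, map_sum]
      symm
      apply Finset.sum_eq_single e
      · intro e' _ he'
        exact H.apply_mul_idem (hf e') (by omega) hy
      · intro he'
        rw [Finsupp.notMem_support_iff.1 he', map_zero, map_zero]
    · exact H.apply_mul_idem (hf e) hi hy
  rw [Finsupp.sum]
  refine Submodule.sum_mem _ fun e _ => ?_
  rcases eq_or_ne e d with rfl | he
  · exact hf e
  · rw [h0 e he]; exact Submodule.zero_mem _

/-- Tested against `y e_c` with `y` homogeneous, `t` sees only `c = b`, since `e_{σ(c)} e_{σ(b)} =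
0` otherwise, and only degree `0`, where `y e_b` is a multiple of `e_b`. The left action is
essential: when the shifts `ℓ` differ, degree and right idempotent alone need not cut out a line. -/
theorem eq_smul (H : IsGeneratingFunctional ε N σ ℓ t u) (ht : Function.Injective (dualMap t))
    {b : Fin n} {z : LocalCoh 𝒜 N} (hz : z ∈ localCohDeg 𝒜 N (-ℓ b))
    (hr : localCohRight 𝒜 N (idem 𝒜 ε b) z = z)
    (hl : localCohLeft 𝒜 N (idem 𝒜 ε (σ b)) z = z) : z = t z • u b := by
  have h1 : ∀ w, localCohLeft 𝒜 N (idem 𝒜 ε (σ b)) w = w → ∀ c, c ≠ b → ∀ y,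
      t (localCohRight 𝒜 N (y * idem 𝒜 ε c) w) = 0 := fun w hw c hc y => by
    rw [localCohRight_mul, ← H.apply_left, ← hw, ← localCohRight_mul, localCohLeft_localCohRight,
      ← localCohLeft_mul, idem_mul_of_ne 𝒜 ε (σ.injective.ne hc), localCohLeft_zero, map_zero,
      map_zero]
  refine eq_of_dualMap_injective ε ht fun c i y hy => ?_
  rw [map_smul, map_smul, smul_eq_mul]
  rcases eq_or_ne c b with rfl | hc
  · rcases eq_or_ne i 0 with rfl | hi
    · obtain ⟨a, -, ha⟩ := exists_idem_mul 𝒜 ε hy c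
      rw [ha, localCohRight_smul, localCohRight_smul, hr, H.right, map_smul, map_smul, H.apply_u,
        smul_eq_mul, smul_eq_mul, mul_one, mul_comm]
    · rw [H.apply_mul_idem hz (by omega) hy, H.apply_mul_idem (H.mem c) (by omega) hy, mul_zero]
  · rw [h1 z hl c hc, h1 (u b) (H.left b) c hc, mul_zero]

theorem localCohAut_eq_smul (H : IsGeneratingFunctional ε N σ ℓ t u)
    (ht : Function.Injective (dualMap t)) (g : gradedAut 𝒜 ε) (b : Fin n) :
    localCohAut 𝒜 g N (u b) = t (localCohAut 𝒜 g N (u b)) • u b := by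
  refine H.eq_smul ht (localCohAut_mem g N (H.mem b)) ?_ ?_
  · conv_rhs => rw [← H.right b, localCohAut_localCohRight, g.2.2]
  · conv_rhs => rw [← H.left b, localCohAut_localCohLeft, g.2.2]

theorem apply_localCohAut_ne_zero (H : IsGeneratingFunctional ε N σ ℓ t u)
    (ht : Function.Injective (dualMap t)) (g : gradedAut 𝒜 ε) (b : Fin n) :
    t (localCohAut 𝒜 g N (u b)) ≠ 0 := fun h0 => by
  have h1 := H.localCohAut_eq_smul ht g b
  rw [h0, zero_smul, ← map_zero (localCohAut 𝒜 g N)] at h1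
  have h2 := H.apply_u b
  rw [localCohAut_injective g N h1, map_zero] at h2
  exact zero_ne_one h2

/-- Only `e_{σ(b)} x e_b` in degree `-ℓ_b` contributes to `t (x e_b)`. It is a multiple of `u b`, on
which `H^N(g)` is a scalar, and `H^N(g)` commutes with taking this part. -/
theorem apply_right_localCohAut (H : IsGeneratingFunctional ε N σ ℓ t u)
    (ht : Function.Injective (dualMap t)) (g : gradedAut 𝒜 ε) (b : Fin n) (x : LocalCoh 𝒜 N) :
    t (localCohRight 𝒜 N (idem 𝒜 ε b) (localCohAut 𝒜 g N x))
      = t (localCohAut 𝒜 g N (u b)) * t (localCohRight 𝒜 N (idem 𝒜 ε b) x) := by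
  have hx : x ∈ ⨆ d, localCohDeg 𝒜 N d := by rw [iSup_localCohDeg]; trivial
  induction hx using Submodule.iSup_induction' with
  | zero => simp only [map_zero, mul_zero]
  | add x y _ _ hx hy => simp only [map_add, mul_add, hx, hy]
  | mem d x hx =>
    by_cases hd : d = -ℓ b
    · subst hd
      set z := localCohLeft 𝒜 N (idem 𝒜 ε (σ b)) (localCohRight 𝒜 N (idem 𝒜 ε b) x) with hz
      have h0 : localCohRight 𝒜 N (idem 𝒜 ε b) x ∈ localCohDeg 𝒜 N (-ℓ b) := by
        have := localCohRight_mem N (idem_mem 𝒜 ε b) hx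
        rwa [Nat.cast_zero, add_zero] at this
      have h1 : z = t z • u b := by
        refine H.eq_smul ht (localCohLeft_mem N (idem_mem 𝒜 ε _) h0) ?_ ?_
        · rw [hz, ← localCohLeft_localCohRight, ← localCohRight_mul, idem_mul_self]
        · rw [hz, ← localCohLeft_mul, idem_mul_self]
      rw [← H.apply_left, ← H.apply_left b x, ← hz]
      have h2 : localCohLeft 𝒜 N (idem 𝒜 ε (σ b)) (localCohRight 𝒜 N (idem 𝒜 ε b)
          (localCohAut 𝒜 g N x)) = localCohAut 𝒜 g N z := by
        rw [hz, localCohAut_localCohLeft, localCohAut_localCohRight, g.2.2, g.2.2]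
      rw [h2, h1, map_smul, map_smul, map_smul, H.apply_u, smul_eq_mul, smul_eq_mul, mul_one,
        mul_comm]
    · rw [H.apply_deg b d hd _ hx, H.apply_deg b d hd _ (localCohAut_mem g N hx), mul_zero]

/-- Writing `y = g(w)` gives `t (H(g)(x) y) = t (H(g)(x w))`. Of its parts indexed by the
idempotents only that of `e_s` survives, as `θ(x)` lies in `e_s B^∨`, and there `H(g)` scales `t`.
-/
theorem isScaledBy (H : IsGeneratingFunctional ε N σ ℓ t u)
    (ht : Function.Bijective (dualMap t)) (g : gradedAut 𝒜 ε) :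
    IsScaledBy 𝒜 (LinearEquiv.ofBijective _ ht) g fun b => t (localCohAut 𝒜 g N (u b)) := by
  intro s x hx
  refine LinearMap.ext fun y => ?_
  have hx' : ∀ y, t (localCohRight 𝒜 N (y * idem 𝒜 ε s) x) = t (localCohRight 𝒜 N y x) := hx
  set w := ((g : B ≃ₐ[k] B)⁻¹) y with hw
  have hy : y = (g : B ≃ₐ[k] B) w := ((g : B ≃ₐ[k] B).apply_symm_apply y).symm
  show t (localCohRight 𝒜 N y (localCohAut 𝒜 g N x))
    = t (localCohAut 𝒜 g N (u s)) * t (localCohRight 𝒜 N w x)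
  rw [hy, ← localCohAut_localCohRight, sum_localCohRight_idem ε, Finset.sum_eq_single s]
  · rw [H.apply_right_localCohAut ht.1, ← localCohRight_mul, hx']
  · intro b _ hb
    rw [H.apply_right_localCohAut ht.1, ← localCohRight_mul, ← hx', mul_assoc,
      idem_mul_of_ne 𝒜 ε hb, mul_zero, localCohRight_zero, map_zero, mul_zero]
  · simp

end IsGeneratingFunctional

theorem isRightLinear_dualMap (ht : Function.Bijective (dualMap t)) :
    IsRightLinear 𝒜 (LinearEquiv.ofBijective _ ht) := fun b x => LinearMap.ext fun y => by
  show t (localCohRight 𝒜 N y (localCohRight 𝒜 N b x)) = t (localCohRight 𝒜 N (b * y) x)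
  rw [localCohRight_mul]

end Gorenstein
end HomDet

theorem proposition3p7 {k B : Type*} [Field k] [IsAlgClosed k] [CharZero k]
    [Ring B] [Algebra k B] (𝒜 : ℕ → Submodule k B) [GradedAlgebra 𝒜]
    {n : ℕ} (ε : (Fin n → k) ≃ₐ[k] 𝒜 0) (N : ℕ) (σ : Equiv.Perm (Fin n)) (ℓ : Fin n → ℤ)
    (hB : HomDet.IsGeneralizedGorenstein 𝒜 ε N σ ℓ) :
    -- `Hdet` is well defined: some graded isomorphism `H^N(B) ≅ ⨁_b e_b B^∨[ℓ_b]` of right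
    -- modules turns every `H^N(g)` into `(g⁻¹)^*` up to nonzero scalars `c_s`,
    (∃ θ : HomDet.LocalCoh 𝒜 N ≃ₗ[k] HomDet.gradedDual 𝒜,
      HomDet.IsRightLinear 𝒜 θ ∧ HomDet.IsShiftGraded 𝒜 ε ℓ θ ∧
      ∀ g : HomDet.gradedAut 𝒜 ε, ∃ c : Fin n → k,
        (∀ s, c s ≠ 0) ∧ HomDet.IsScaledBy 𝒜 θ g c) ∧
    -- and whenever an isomorphism of right modules does so, the scalars are those of `Hdet`;
    (∀ (g : HomDet.gradedAut 𝒜 ε) (θ : HomDet.LocalCoh 𝒜 N ≃ₗ[k] HomDet.gradedDual 𝒜)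
      (c : Fin n → k), HomDet.IsRightLinear 𝒜 θ → HomDet.IsScaledBy 𝒜 θ g c →
        HomDet.Hdet 𝒜 N g = Matrix.diagonal fun s => (c s)⁻¹) ∧
    -- `Hdet` is a homomorphism to the group of invertible matrices.
    ∃ Φ : HomDet.gradedAut 𝒜 ε →* (Matrix (Fin n) (Fin n) k)ˣ,
      ∀ g, (Φ g : Matrix (Fin n) (Fin n) k) = HomDet.Hdet 𝒜 N g := by
  obtain ⟨t, u, H, hu⟩ := hB.exists_generatingFunctional
  have ht := hB.dualMap_bijective (t := t) fun j => by
    obtain ⟨x, hx, hxu⟩ := hu j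
    exact ⟨x, hx, by rw [hxu, H.apply_u]⟩
  have hlin := HomDet.isRightLinear_dualMap ht
  refine ⟨⟨LinearEquiv.ofBijective _ ht, hlin, fun d x => H.mem_localCohDeg_iff ht.1, fun g =>
      ⟨_, H.apply_localCohAut_ne_zero ht.1 g, H.isScaledBy ht g⟩⟩,
    fun g θ c hθ hc => hc.hdet_eq hθ, ?_⟩
  let Ψ : HomDet.gradedAut 𝒜 ε →* Matrix (Fin n) (Fin n) k :=
    { toFun := HomDet.Hdet 𝒜 N
      map_one' := by
        rw [HomDet.IsScaledBy.one.hdet_eq hlin]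
        simp
      map_mul' := fun g h => by
        have hg := H.isScaledBy ht g
        have hh := H.isScaledBy ht h
        rw [(hg.mul hh).hdet_eq hlin, hg.hdet_eq hlin, hh.hdet_eq hlin, Matrix.diagonal_mul_diagonal]
        simp only [Pi.mul_apply, mul_inv] }
  -- A multiplicative map from a group to a monoid takes values in units, so invertibility needs no
  -- separate argument.
  exact ⟨Ψ.toHomUnits, fun g => rfl⟩
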